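/- Let $\mathbb T^2=[-\pi,\pi]^2$ be the torus (functions on it are $2\pi\mathbb Z^2$-periodic functions on $\mathbb R^2$), and fix $T>0$ and a viscosity $\nu\ge 0$. Let $\varphi\in C^5(\mathbb T^2;\mathbb R^2)$ satisfy $\operatorname{div}\varphi=0$ and $\int_{\mathbb T^2}\varphi\,dx=0$, and put $w_0=\operatorname{curl}\varphi=\partial_1\varphi_2-\partial_2\varphi_1$. Let $(\tau_k)_{k\ge1}$ be i.i.d. exponential random variables of parameter $1$ and $(\xi_k)_{k\ge1}$ i.i.d. random variables uniformly distributed on $\{\pm e_1,\pm e_2\}$, the two sequences being independent. Put $S_n=\tau_1+\dots+\tau_n$, $\mathcal N_t=\max\{n:S_n\le t\}$ and, for $\varepsilon\in(0,1)$, $\mathcal N^\varepsilon_t=\mathcal N_{t/\varepsilon}$ and $H^\varepsilon_t=\sum_{1\le n\le\mathcal N^\varepsilon_t}\xi_n$. Let $K_2=\nabla^\perp G$ be the Biot–Savart kernel on $\mathbb T^2$, where $\nabla^\perp=(-\partial_2,\partial_1)$ and $G$ is the Green function with mean zero, $\Delta G=\delta_0-(2\pi)^{-2}$. Consider, for $0\le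 s\le t\le T$ and $x\in\mathbb T^2$, the stochastic system $$ X^\varepsilon_{s,t}(x)=x+\varepsilon\int_s^t u_\varepsilon\big(r,X^\varepsilon_{s,r-}(x)\big)\,d\mathcal N^\varepsilon_r+2\sqrt{\varepsilon\nu}\,\big(H^\varepsilon_t-H^\varepsilon_s\big),\qquad w_\varepsilon(s,x)=\mathbb E\,w_0\big(X^\varepsilon_{s,T}(x)\big),\qquad u_\varepsilon=K_2*w_\varepsilon , $$ where $w_\varepsilon$ is required to lie in $C([0,T];C^1(\mathbb T^2))$. (1) For every $\varepsilon\in(0,1)$ this system has a solution, and it is unique: for any two solutions the functions $w_\varepsilon$ (hence $u_\varepsilon$) coincide on $[0,T]\times\mathbb T^2$ and, for all $s$ and $x$, almost surely the paths $t\mapsto X^\varepsilon_{s,t}(x)$, $t\in[s,T]$, coincide. (2) Let $u\in C([0,T];C^5(\mathbb T^2;\mathbb R^2))$ be the solution of the backward Navier–Stokes equation $$ \partial_s u+\nu\Delta u+u\cdot\nabla u+\nabla p=0,\qquad \operatorname{div}u=0,\qquad u(T)=\varphi $$ on $[0,T]\times\mathbb T^2$, with a pressure $p\in C([0,T];C^1(\mathbb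 T^2))$. Then there is a constant $C>0$ such that for all $\varepsilon\in(0,1)$ $$ \sup_{s\in[0,T]}\|u_\varepsilon(s)-u(s)\|_\infty\le C\varepsilon . $$ -/

import Mathlib

open Real Set Filter Topology MeasureTheory ProbabilityTheory
open scoped Laplacian Gradient

noncomputable section

/-! ### Functions on the torus `𝕋² = [-π, π]²`, as `2πℤ²`-periodic functions on the plane -/

/-- The Euclidean plane. -/
abbrev Plane : Type := EuclideanSpace ℝ (Fin 2)

/-- The standard basis vector `e_i` of the plane. -/
def planeBasis (i : Fin 2) : Plane := EuclideanSpace.single i 1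

/-- The point `2πm` of the period lattice `2πℤ²`. -/
def latticePoint (m : Fin 2 → ℤ) : Plane := WithLp.toLp 2 (fun i => 2 * π * (m i : ℝ))

/-- `f` is a function on the torus. -/
def TorusPeriodic {F : Type*} (f : Plane → F) : Prop :=
  ∀ (x : Plane) (m : Fin 2 → ℤ), f (x + latticePoint m) = f x

/-- The fundamental cell `[-π, π]²`. -/
def torusCell : Set Plane := {x | ∀ i, x i ∈ Icc (-π) π}

/-- `f ∈ C([0,T]; C^k(𝕋²; F))`: every `f s` is a `C^k` function on the torus, and `s ↦ f s` is
continuous on `[0,T]` for the `C^k` norm (all space derivatives of order at most `k` depend on `s`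
continuously in the sup norm). -/
def ContTimeCk {F : Type*} [NormedAddCommGroup F] [NormedSpace ℝ F]
    (k : ℕ) (T : ℝ) (f : ℝ → Plane → F) : Prop :=
  (∀ s ∈ Icc 0 T, TorusPeriodic (f s) ∧ ContDiff ℝ k (f s)) ∧
  ∀ j ≤ k, ∀ s₀ ∈ Icc 0 T,
    TendstoUniformly (fun s => iteratedFDeriv ℝ j (f s)) (iteratedFDeriv ℝ j (f s₀))
      (𝓝[Icc 0 T] s₀)

/-- The partial derivative `∂_i v_j`. -/
def partialDeriv (v : Plane → Plane) (i j : Fin 2) (x : Plane) : ℝ :=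
  fderiv ℝ v x (planeBasis i) j

/-- `div v = ∂₁v₁ + ∂₂v₂`. -/
def planeDiv (v : Plane → Plane) (x : Plane) : ℝ := ∑ i, partialDeriv v i i x

/-- `curl v = ∂₁v₂ - ∂₂v₁`. -/
def planeCurl (v : Plane → Plane) (x : Plane) : ℝ :=
  partialDeriv v 0 1 x - partialDeriv v 1 0 x

/-! ### The backward Navier–Stokes equation -/

/-- `u ∈ C([0,T]; C⁵(𝕋²; ℝ²))` is a classical solution on `[0,T]`, with some pressure
`p ∈ C([0,T]; C¹(𝕋²))`, of
`∂ₛu + νΔu + u·∇u + ∇p = 0`, `div u = 0`, `u(T) = φ`. -/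
def IsBackwardNSESolution (ν T : ℝ) (φ : Plane → Plane) (u : ℝ → Plane → Plane) : Prop :=
  ContTimeCk 5 T u ∧
  (∃ p : ℝ → Plane → ℝ, ContTimeCk 1 T p ∧
    ∀ s ∈ Icc 0 T, ∀ x : Plane,
      HasDerivWithinAt (fun r => u r x)
        (-(ν • Laplacian.laplacian (u s) x + fderiv ℝ (u s) x (u s x) + gradient (p s) x))
        (Icc 0 T) s) ∧
  (∀ s ∈ Icc 0 T, ∀ x, planeDiv (u s) x = 0) ∧
  u T = φ

/-! ### The Biot–Savart law on the torus -/

/-- `(x₁, x₂)^⊥ = (-x₂, x₁)`. -/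
def perp (x : Plane) : Plane := !₂[-x 1, x 0]

/-- `-∇^⊥ p_t(x)`, where `∇^⊥ = (-∂₂, ∂₁)` and
`p_t(x) = ∑_{m ∈ ℤ²} (4πt)⁻¹ exp(-|x + 2πm|² / (4t))` is the heat kernel of the torus. -/
def negPerpGradHeat (t : ℝ) (x : Plane) : Plane :=
  ∑' m : Fin 2 → ℤ,
    ((8 * π * t ^ 2)⁻¹ * Real.exp (-‖x + latticePoint m‖ ^ 2 / (4 * t))) •
      perp (x + latticePoint m)

/-- The Biot–Savart kernel `K₂ = ∇^⊥ G` of the torus, where `G = -∫₀^∞ (p_t - (2π)⁻²) dt` is the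
Green function with zero mean, `ΔG = δ₀ - (2π)⁻²`. Since
`∫₀^∞ (8πt²)⁻¹ exp(-|x|²/(4t)) dt = (2π|x|²)⁻¹`, the term `m = 0` of the sum contributes
`x^⊥ / (2π|x|²)`, which is the singular part of the kernel at the origin. -/
def biotSavartKernel (x : Plane) : Plane := ∫ t in Ioi (0 : ℝ), negPerpGradHeat t x

/-- The convolution `K₂ * w` on the torus. -/
def biotSavart (w : Plane → ℝ) (x : Plane) : Plane :=
  ∫ y in torusCell, w (x - y) • biotSavartKernel y

/-! ### The compound Poisson process and the scheme -/

section Scheme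

variable {Ω : Type*} [MeasurableSpace Ω]

/-- The random inputs, indexed from `0`: waiting times `τ k` (exponential of parameter `1`) and
steps `ξ k` (uniform on `{±e₁, ±e₂}`, the points of `ℤ²` of norm `1`), all of them independent. -/
structure IsPoissonDriver (P : Measure Ω) (τ : ℕ → Ω → ℝ) (ξ : ℕ → Ω → Plane) : Prop where
  measurable_wait : ∀ k, Measurable (τ k)
  measurable_step : ∀ k, Measurable (ξ k)
  law_wait : ∀ k, P.map (τ k) = expMeasure 1
  law_step_pos : ∀ k i, P {ω | ξ k ω = planeBasis i} = 1 / 4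
  law_step_neg : ∀ k i, P {ω | ξ k ω = -planeBasis i} = 1 / 4
  indep_wait : iIndepFun τ P
  indep_step : iIndepFun ξ P
  indep_wait_step : IndepFun (fun ω k => τ k ω) (fun ω k => ξ k ω) P

/-- The `n`-th arrival time `S_n` of the Poisson process of intensity `1`; `S_0 = 0`. -/
def arrivalTime (τ : ℕ → Ω → ℝ) (n : ℕ) (ω : Ω) : ℝ := ∑ k ∈ Finset.range n, τ k ω

/-- The Poisson process `𝒩_t = max {n | S_n ≤ t}` of intensity `1`. -/
def poissonCount (τ : ℕ → Ω → ℝ) (t : ℝ) (ω : Ω) : ℕ := sSup {n : ℕ | arrivalTime τ n ω ≤ t}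

/-- The Poisson process `𝒩^ε_t = 𝒩_{t/ε}` of intensity `1/ε`. -/
def poissonCountEps (τ : ℕ → Ω → ℝ) (ε t : ℝ) (ω : Ω) : ℕ := poissonCount τ (t / ε) ω

/-- The compound Poisson process `H^ε_t`, the sum of the first `𝒩^ε_t` steps. -/
def compoundPoisson (τ : ℕ → Ω → ℝ) (ξ : ℕ → Ω → Plane) (ε t : ℝ) (ω : Ω) : Plane :=
  ∑ k ∈ Finset.range (poissonCountEps τ ε t ω), ξ k ω

/-- The integral `∫_s^t g(r) d𝒩^ε_r` over `(s,t]`: the sum of `g` over the jump times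
`S^ε_n = ε S_n` with `s < S^ε_n ≤ t`, that is with `𝒩^ε_s < n ≤ 𝒩^ε_t`. -/
def poissonIntegral (τ : ℕ → Ω → ℝ) (ε s t : ℝ) (g : ℝ → Plane) (ω : Ω) : Plane :=
  ∑ n ∈ Finset.Ioc (poissonCountEps τ ε s ω) (poissonCountEps τ ε t ω),
    g (ε * arrivalTime τ n ω)

/-- `(X, w)` solves the stochastic Lagrangian scheme with terminal vorticity `w₀`: with
`u_ε(r) = K₂ * w(r)`,
`X_{s,t}(x) = x + ε ∫_s^t u_ε(r, X_{s,r-}(x)) d𝒩^ε_r + 2√(εν) (H^ε_t - H^ε_s)` and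
`w(s,x) = 𝔼 w₀(X_{s,T}(x))` for `0 ≤ s ≤ t ≤ T`, where `w ∈ C([0,T]; C¹(𝕋²))`.
Positions on the torus are represented in the plane, which is harmless because all coefficients
are periodic. -/
structure IsSchemeSolution (P : Measure Ω) (τ : ℕ → Ω → ℝ) (ξ : ℕ → Ω → Plane)
    (ν T : ℝ) (w₀ : Plane → ℝ) (ε : ℝ)
    (X : ℝ → ℝ → Plane → Ω → Plane) (w : ℝ → Plane → ℝ) : Prop where
  measurable_flow : ∀ s ∈ Icc 0 T, ∀ t ∈ Icc s T, ∀ x, Measurable (X s t x)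
  flow_eq : ∀ s ∈ Icc 0 T, ∀ x, ∀ᵐ ω ∂P, ∀ t ∈ Icc s T,
    X s t x ω = x
      + ε • poissonIntegral τ ε s t
          (fun r => biotSavart (w r) (Function.leftLim (fun q => X s q x ω) r)) ω
      + (2 * √(ε * ν)) • (compoundPoisson τ ξ ε t ω - compoundPoisson τ ξ ε s ω)
  vorticity_eq : ∀ s ∈ Icc 0 T, ∀ x, w s x = ∫ ω, w₀ (X s T x ω) ∂P
  vorticity_regular : ContTimeCk 1 T w

end Scheme

end

/-! Condition on the first jump after time `s`. With the exponential weight of the waiting time,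
`w(s,x)` is a mixture of `w₀(x)` (no jump before `T`) and of means of `w(r,·)` over the four points
around `x + ε u_ε(r,x)`, where `r` is the time of the jump. This is the mild form (`mild`) of the
closed deterministic equation `-∂ₛw = ε⁻¹ (stepMean w (x + ε K₂*w) - w)`. Both claims come from
comparing this equation with the random scheme.

The kernel is handled through `K₂ = ∫₀^∞ (-∇^⊥ p_t) dt`: the integrand has `L¹` norm `O(t^(-1/2))`
for small `t` and decays exponentially for large `t`. Hence `K₂` is integrable, the velocity
gradient is bounded by the logarithm of the vorticity gradient
(`exists_norm_biotSavartDeriv_le_log`), and a divergence-free field of zero mean is recovered from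
its curl (`biotSavart_planeCurl`).

The deterministic equation is solved by Picard iteration (`exists_mild_vorticity`). The sup norm of
`w` does not grow. Its gradient grows at the rate `‖∇u‖ ≲ 1 + log ‖∇w‖`, so it stays below a double
exponential on the whole of `[0,T]`. The Lipschitz constant of the gradient then grows at most
exponentially, and the iterates contract in a weighted `C¹` norm.

The passage to the random scheme is `IsPoissonDriver.abs_sub_integral_le`. Jump times and positions
form a Markov chain along which a mild solution is harmonic; if it solves the equation only
approximately, its defects are telescoped against those of a supersolution. `flow_eq_iff` identifies
the paths of the stochastic equation with this chain, almost surely.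

The two lead to a stability estimate, `IsSchemeSolution.abs_vorticity_sub_le`: a function `V` that
solves the mild equation up to an error `E`, with a Lipschitz dependence on the velocity, is within
a constant times `E` of the vorticity of every scheme solution. Only `V` has to be regular. With `E
= 0` and `V` the Picard solution this is uniqueness. For the rate, `V = curl u`: it satisfies the
vorticity equation in mild form (`planeCurl_eq_mild`), and the Taylor expansion
`abs_generator_sub_le` (steps of length `2√(εν)` produce `νΔ`, the drift produces `u·∇`) gives `E =
O(ε)`. Integrability of `K₂` carries the bound over to velocities. -/

noncomputable section

/-! ### The Gaussian weight on the plane -/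

/-- The density of the centred Gaussian law of covariance `2`. -/
def gaussWeight (z : Plane) : ℝ := (4 * π)⁻¹ * Real.exp (-‖z‖ ^ 2 / 4)

lemma gaussWeight_nonneg (z : Plane) : 0 ≤ gaussWeight z := by
  unfold gaussWeight; positivity

lemma continuous_gaussWeight : Continuous gaussWeight := by
  unfold gaussWeight; fun_prop

lemma hasFDerivAt_gaussWeight (z : Plane) :
    HasFDerivAt gaussWeight ((-gaussWeight z / 2) • innerSL ℝ z) z := by
  have h1 : HasFDerivAt (fun z : Plane => ‖z‖ ^ 2) (2 • innerSL ℝ z) z :=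
    (hasStrictFDerivAt_norm_sq z).hasFDerivAt
  have h2 := ((h1.neg.mul_const (1/4 : ℝ)).exp).const_mul ((4 * π)⁻¹)
  have h3 : gaussWeight = fun z : Plane => (4 * π)⁻¹ * Real.exp (-‖z‖ ^ 2 * (1/4)) := by
    funext z; unfold gaussWeight; ring_nf
  rw [h3]
  refine h2.congr_fderiv ?_
  ext v
  simp
  ring

lemma integrable_exp_neg_mul_sq_norm {b : ℝ} (hb : 0 < b) :
    Integrable (fun z : Plane => Real.exp (-b * ‖z‖ ^ 2)) := by
  apply Integrable.of_integral_ne_zero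
  rw [GaussianFourier.integral_rexp_neg_mul_sq_norm hb]
  positivity

lemma integral_gaussWeight : ∫ z, gaussWeight z = 1 := by
  have h := GaussianFourier.integral_rexp_neg_mul_sq_norm (V := Plane) (b := 1/4) (by norm_num)
  have h3 : gaussWeight = fun z : Plane => (4 * π)⁻¹ * Real.exp (-(1/4) * ‖z‖ ^ 2) := by
    funext z; unfold gaussWeight; ring_nf
  rw [h3, integral_const_mul, h]
  simp
  field_simp

lemma integrable_norm_pow_mul_gaussWeight (k : ℕ) :
    Integrable (fun z : Plane => ‖z‖ ^ k * gaussWeight z) := by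
  have h1 := (integrable_exp_neg_mul_sq_norm (b := 1/8) (by norm_num)).const_mul
    ((4 * π)⁻¹ * (1 + 8 ^ k * k.factorial))
  refine h1.mono' (by have := continuous_gaussWeight; fun_prop) (ae_of_all _ fun z => ?_)
  rw [Real.norm_of_nonneg (mul_nonneg (by positivity) (gaussWeight_nonneg z))]
  unfold gaussWeight
  have e : Real.exp (-‖z‖ ^ 2 / 4) = Real.exp (-(1/8) * ‖z‖ ^ 2) * Real.exp (-(‖z‖ ^ 2 / 8)) := by
    rw [← Real.exp_add]; ring_nf
  -- Half of the Gaussian exponent absorbs the power: `y^k / k! ≤ exp y` at `y = ‖z‖²/8`, combined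
  -- with `‖z‖^k ≤ 1 + ‖z‖^(2k)`.
  have hk : ‖z‖ ^ k ≤ (1 + 8 ^ k * k.factorial) * Real.exp (‖z‖ ^ 2 / 8) := by
    have a1 : ‖z‖ ^ k ≤ 1 + (‖z‖ ^ 2) ^ k := by
      rcases le_total ‖z‖ 1 with h | h
      · have := pow_le_one₀ (norm_nonneg z) h (n := k)
        have : 0 ≤ (‖z‖ ^ 2) ^ k := by positivity
        linarith
      · have : ‖z‖ ^ k ≤ (‖z‖ ^ 2) ^ k := by gcongr; nlinarith
        linarith
    have a2 := Real.pow_div_factorial_le_exp (‖z‖ ^ 2 / 8) (by positivity) k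
    rw [div_pow, div_div, div_le_iff₀ (by positivity)] at a2
    have a3 : 1 ≤ Real.exp (‖z‖ ^ 2 / 8) := Real.one_le_exp (by positivity)
    nlinarith
  have hk2 : ‖z‖ ^ k * Real.exp (-(‖z‖ ^ 2 / 8)) ≤ 1 + 8 ^ k * k.factorial := by
    rw [Real.exp_neg, ← div_eq_mul_inv, div_le_iff₀ (Real.exp_pos _)]; exact hk
  calc ‖z‖ ^ k * ((4 * π)⁻¹ * Real.exp (-‖z‖ ^ 2 / 4))
      = (4 * π)⁻¹ * (‖z‖ ^ k * Real.exp (-(‖z‖ ^ 2 / 8))) * Real.exp (-(1/8) * ‖z‖ ^ 2) := by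
        rw [e]; ring
    _ ≤ _ := by gcongr

lemma integrable_gaussWeight : Integrable gaussWeight := by
  simpa using integrable_norm_pow_mul_gaussWeight 0

/-- A continuous function of at most polynomial growth is integrable against the Gaussian weight. -/
lemma integrable_mul_gaussWeight {E : Type*} [NormedAddCommGroup E] [NormedSpace ℝ E]
    {f : Plane → E} (hf : AEStronglyMeasurable f) {C : ℝ} {k : ℕ} (hb : ∀ z, ‖f z‖ ≤ C * ‖z‖ ^ k) :
    Integrable (fun z => gaussWeight z • f z) := by
  refine ((integrable_norm_pow_mul_gaussWeight k).const_mul C).mono'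
    (continuous_gaussWeight.aestronglyMeasurable.smul hf) (ae_of_all _ fun z => ?_)
  rw [norm_smul, Real.norm_of_nonneg (gaussWeight_nonneg z)]
  nlinarith [hb z, gaussWeight_nonneg z]

/-- Integration by parts for a Gaussian-type average. -/
lemma integral_fderiv_comp_mul {f : Plane → ℝ} {f' : Plane → Plane →L[ℝ] ℝ}
    (hf : ∀ x, HasFDerivAt f (f' x) x) (hf'c : Continuous f') {M M' : ℝ}
    (hM : ∀ x, |f x| ≤ M) (hM' : ∀ x, ‖f' x‖ ≤ M')
    {G : Plane → ℝ} {G' : Plane → Plane →L[ℝ] ℝ} (hG : ∀ z, HasFDerivAt G (G' z) z)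
    (v : Plane) (hGi : Integrable G) (hG'i : Integrable (fun z => G' z v))
    {σ : ℝ} (hσ : 0 < σ) (x : Plane) :
    ∫ z, f' (x - σ • z) v * G z = σ⁻¹ * ∫ z, f (x - σ • z) * G' z v := by
  have hfc : Continuous f := continuous_iff_continuousAt.2 fun x => (hf x).continuousAt
  have hF : ∀ z, HasFDerivAt (fun z => f (x - σ • z)) ((-σ) • f' (x - σ • z)) z := by
    intro z
    have h1 : HasFDerivAt (fun z : Plane => x - σ • z) (-(σ • ContinuousLinearMap.id ℝ Plane)) z :=
      ((hasFDerivAt_id z).const_smul σ).const_sub x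
    refine ((hf (x - σ • z)).comp z h1).congr_fderiv ?_
    ext v; simp
  have hGc : Continuous G := continuous_iff_continuousAt.2 fun x => (hG x).continuousAt
  have i1 : Integrable (fun z => f' (x - σ • z) v * G z) := by
    refine hGi.bdd_mul (c := M' * ‖v‖) (by fun_prop) (ae_of_all _ fun z => ?_)
    exact (f' _).le_of_opNorm_le (hM' _) v
  have i2 : Integrable (fun z => f (x - σ • z) * G' z v) :=
    hG'i.bdd_mul (c := M) (by fun_prop) (ae_of_all _ fun z => hM _)
  have i3 : Integrable (fun z => f (x - σ • z) * G z) :=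
    hGi.bdd_mul (c := M) (by fun_prop) (ae_of_all _ fun z => hM _)
  have := integral_bilinear_hasFDerivAt_right_eq_neg_left_of_integrable
    (B := ContinuousLinearMap.mul ℝ ℝ) (μ := (volume : Measure Plane)) (v := v)
    (f := fun z => f (x - σ • z)) (f' := fun z => (-σ) • f' (x - σ • z)) (g := G) (g' := G')
    (by simpa [mul_assoc] using i1.const_mul (-σ)) (by simpa using i2) (by simpa using i3)
    (fun z _ => hF z) (fun z _ => hG z)
  simp only [ContinuousLinearMap.mul_apply', smul_apply, smul_eq_mul] at this
  rw [this]
  simp only [mul_assoc]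
  rw [integral_const_mul]
  field_simp

/-! ### Unfolding of integrals over the fundamental cell -/

/-- The half-open fundamental cell. -/
def halfOpenCell : Set Plane := {x | ∀ i, x i ∈ Ioc (-π) π}

lemma measurableSet_halfOpenCell : MeasurableSet halfOpenCell := by
  have : halfOpenCell = ⋂ i : Fin 2, (fun x : Plane => x i) ⁻¹' Ioc (-π) π := by
    ext x; simp [halfOpenCell]
  rw [this]
  exact MeasurableSet.iInter fun i => measurableSet_Ioc.preimage (by fun_prop)

lemma isCompact_torusCell : IsCompact torusCell := by
  have : torusCell = (WithLp.ofLp : Plane → Fin 2 → ℝ) ⁻¹' (Set.pi univ fun _ => Icc (-π) π) := by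
    ext x; simp only [torusCell, Set.mem_ofPred_eq, mem_preimage, Set.mem_pi, mem_univ, true_imp_iff]
  rw [this]
  exact (PiLp.homeomorph 2 (fun _ : Fin 2 => ℝ)).isCompact_preimage.2
    (isCompact_univ_pi fun _ => isCompact_Icc)

/-- The translates of the half-open cell partition the plane, those of the closed cell do not. The
boundary is a null set, so integrals pass from one to the other. -/
lemma halfOpenCell_ae_eq_torusCell : halfOpenCell =ᵐ[volume] torusCell := by
  have h1 := Measure.univ_pi_Ioc_ae_eq_Icc (ι := Fin 2) (α := fun _ => ℝ)
    (μ := fun _ => (volume : Measure ℝ)) (f := fun _ => -π) (g := fun _ => π)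
  have h2 := (EuclideanSpace.volume_preserving_symm_measurableEquiv_toLp
    (Fin 2)).quasiMeasurePreserving.preimage_ae_eq h1
  have e1 : halfOpenCell = (MeasurableEquiv.toLp 2 (Fin 2 → ℝ)).symm ⁻¹'
      (Set.pi univ fun _ => Ioc (-π) π) := by
    ext x; simp [halfOpenCell]
  have e2 : torusCell = (MeasurableEquiv.toLp 2 (Fin 2 → ℝ)).symm ⁻¹'
      Icc (fun _ => -π) (fun _ => π) := by
    ext x; simp [torusCell, Pi.le_def, forall_and]
  rw [e1, e2]
  exact h2

lemma existsUnique_sub_latticePoint_mem (x : Plane) :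
    ∃! m, x - latticePoint m ∈ halfOpenCell := by
  have h : ∀ i, ∃! n : ℤ, x i - n • (2 * π) ∈ Ioc (-π) (-π + 2 * π) := fun i =>
    existsUnique_sub_zsmul_mem_Ioc (by positivity) (x i) (-π)
  choose n hn hu using h
  have e : -π + 2 * π = π := by ring
  have e2 : ∀ (m : Fin 2 → ℤ) i, (x - latticePoint m) i = x i - (m i) • (2 * π) := by
    intro m i; simp [latticePoint]; ring
  refine ⟨n, fun i => ?_, fun m hm => ?_⟩
  · have := hn i; simp only [e] at this; rw [e2]; exact this
  · funext i
    refine hu i (m i) ?_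
    have := hm i
    rw [e2] at this
    simp only [e]; exact this

lemma exists_add_latticePoint_mem (x : Plane) : ∃ m, x + latticePoint m ∈ torusCell := by
  obtain ⟨m, hm, -⟩ := existsUnique_sub_latticePoint_mem x
  refine ⟨-m, fun i => ?_⟩
  have : latticePoint (-m) = - latticePoint m := by ext i; simp [latticePoint]
  rw [this, ← sub_eq_add_neg]
  exact Ioc_subset_Icc_self (hm i)

def shiftedCell (m : Fin 2 → ℤ) : Set Plane := {y | y - latticePoint m ∈ halfOpenCell}

lemma measurableSet_shiftedCell (m : Fin 2 → ℤ) : MeasurableSet (shiftedCell m) :=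
  measurableSet_halfOpenCell.preimage (by fun_prop)

lemma pairwise_disjoint_shiftedCell : Pairwise (Function.onFun Disjoint shiftedCell) := by
  intro m n hmn
  refine Set.disjoint_left.2 fun x hx hx' => hmn ?_
  exact (existsUnique_sub_latticePoint_mem x).unique hx hx'

lemma iUnion_shiftedCell : ⋃ m, shiftedCell m = univ :=
  eq_univ_of_forall fun x => mem_iUnion.2 (existsUnique_sub_latticePoint_mem x).exists

lemma preimage_shiftedCell (m : Fin 2 → ℤ) :
    (fun y => y + latticePoint m) ⁻¹' shiftedCell m = halfOpenCell := by
  ext x; simp [shiftedCell]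

lemma setIntegral_shiftedCell {E : Type*} [NormedAddCommGroup E] [NormedSpace ℝ E]
    (F : Plane → E) (m : Fin 2 → ℤ) :
    ∫ y in shiftedCell m, F y = ∫ y in torusCell, F (y + latticePoint m) := by
  rw [← setIntegral_congr_set halfOpenCell_ae_eq_torusCell, ← preimage_shiftedCell m]
  exact ((measurePreserving_add_right volume (latticePoint m)).setIntegral_preimage_emb
    (MeasurableEquiv.addRight _).measurableEmbedding _ _).symm

lemma lintegral_eq_tsum_torusCell {F : Plane → ENNReal} (hF : Measurable F) :
    ∫⁻ y, F y = ∑' m, ∫⁻ y in torusCell, F (y + latticePoint m) := by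
  rw [← setLIntegral_univ, ← iUnion_shiftedCell,
    lintegral_iUnion measurableSet_shiftedCell pairwise_disjoint_shiftedCell]
  congr 1; funext m
  rw [← setLIntegral_congr halfOpenCell_ae_eq_torusCell, ← preimage_shiftedCell m]
  exact ((measurePreserving_add_right volume (latticePoint m)).setLIntegral_comp_preimage
    (measurableSet_shiftedCell m) hF).symm

lemma hasSum_integral_torusCell {E : Type*} [NormedAddCommGroup E] [NormedSpace ℝ E]
    {F : Plane → E} (hF : Integrable F) :
    HasSum (fun m => ∫ y in torusCell, F (y + latticePoint m)) (∫ y, F y) := by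
  have := hasSum_integral_iUnion measurableSet_shiftedCell pairwise_disjoint_shiftedCell
    (f := F) (μ := volume) (by rw [iUnion_shiftedCell]; exact hF.integrableOn)
  rw [iUnion_shiftedCell, setIntegral_univ] at this
  simpa only [setIntegral_shiftedCell] using this

/-- Integrals of a function against a periodised kernel are integrals over the whole plane. -/
lemma integral_torusCell_tsum {E : Type*} [NormedAddCommGroup E] [NormedSpace ℝ E]
    {F : Plane → E} {h : Plane → ℝ} (hper : TorusPeriodic h)
    (hhF : Integrable (fun y => h y • F y)) :
    ∫ y, h y • F y = ∫ y in torusCell, h y • ∑' m, F (y + latticePoint m) := by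
  have h1 : ∀ m y, h (y + latticePoint m) • F (y + latticePoint m)
      = h y • F (y + latticePoint m) := fun m y => by rw [hper]
  have h2 := (hasSum_integral_torusCell hhF.norm).summable
  have h3 := hasSum_integral_of_summable_integral_norm (μ := volume.restrict torusCell)
    (F := fun m y => h (y + latticePoint m) • F (y + latticePoint m))
    (fun m => (hhF.comp_add_right (latticePoint m)).integrableOn) h2
  have h4 := hasSum_integral_torusCell hhF
  rw [h4.unique h3]
  congr 1; funext y
  simp only [h1]
  -- A scalar passes through `tsum` even where the translates of `F` are not summable, so no
  -- pointwise summability is needed.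
  by_cases hy : h y = 0
  · simp [hy]
  · exact tsum_const_smul'' (h y)

/-! ### The heat kernel of the torus -/

lemma summable_int_abs_pow_mul_exp (k : ℕ) :
    Summable (fun n : ℤ => |(n : ℝ)| ^ k * Real.exp (-(1/2) * |(n : ℝ)|)) := by
  have h := Real.summable_pow_mul_exp_neg_nat_mul k (r := 1/2) (by norm_num)
  refine Summable.of_nat_of_neg ?_ ?_ <;> simpa using h

/-- Here `n² t ≥ t/2 + |n|/2`: one half of the exponent supplies the decay in `t`, the other keeps
the series over `n` summable. -/
lemma exp_neg_sq_mul_le {n : ℤ} (hn : n ≠ 0) {t : ℝ} (ht : 1 ≤ t) :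
    Real.exp (-π * (n : ℝ) ^ 2 * (t / π)) ≤
      Real.exp (-(t / 2)) * Real.exp (-(1/2) * |(n : ℝ)|) := by
  have h0 : -π * (n : ℝ) ^ 2 * (t / π) = -((n : ℝ) ^ 2 * t) := by field_simp
  have h1 : (1 : ℝ) ≤ |(n : ℝ)| := by exact_mod_cast Int.one_le_abs hn
  have h2 : |(n : ℝ)| ≤ (n : ℝ) ^ 2 := by rw [← sq_abs]; nlinarith
  rw [h0, ← Real.exp_add]
  apply Real.exp_le_exp.2
  nlinarith

/-- The coefficient `n` removes the zero mode from the sine series; all other modes decay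
exponentially. -/
lemma exists_abs_sinKernel_le : ∃ C, 0 ≤ C ∧ ∀ (a : ℝ) (t : ℝ), 1 ≤ t →
    |HurwitzZeta.sinKernel a (t / π)| ≤ C * Real.exp (-(t / 2)) := by
  refine ⟨∑' n : ℤ, |(n : ℝ)| ^ 1 * Real.exp (-(1/2) * |(n : ℝ)|),
    tsum_nonneg fun n => by positivity, fun a t ht => ?_⟩
  · have h := HurwitzZeta.hasSum_int_sinKernel a (t := t / π) (by positivity)
    have hs := (summable_int_abs_pow_mul_exp 1).hasSum.mul_right (Real.exp (-(t / 2)))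
    have := h.norm_le_of_bounded hs ?_
    · simpa using this
    intro n
    by_cases hn : n = 0
    · simp [hn]
    have e := exp_neg_sq_mul_le hn ht
    have e2 : ‖Complex.exp (2 * π * Complex.I * a * n)‖ = 1 := by
      rw [Complex.norm_exp]; simp
    rw [norm_mul, norm_mul, norm_mul, e2, Complex.norm_real,
      Real.norm_of_nonneg (Real.exp_pos _).le]
    simp only [norm_neg, Complex.norm_I, one_mul, mul_one, Complex.norm_intCast, pow_one, mul_assoc]
    rw [mul_comm (Real.exp _) (Real.exp (-(t/2)))]
    gcongr
    simpa [mul_assoc] using e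

/-- The zero mode, equal to `1`, is the only one that does not decay. -/
lemma exists_abs_cosKernel_sub_one_le : ∃ C, 0 ≤ C ∧ ∀ (a : ℝ) (t : ℝ), 1 ≤ t →
    |HurwitzZeta.cosKernel a (t / π) - 1| ≤ C * Real.exp (-(t / 2)) := by
  refine ⟨∑' n : ℤ, |(n : ℝ)| ^ 0 * Real.exp (-(1/2) * |(n : ℝ)|),
    tsum_nonneg fun n => by positivity, fun a t ht => ?_⟩
  · have h := HurwitzZeta.hasSum_int_cosKernel₀ a (t := t / π) (by positivity)
    have hs := (summable_int_abs_pow_mul_exp 0).hasSum.mul_right (Real.exp (-(t / 2)))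
    have := h.norm_le_of_bounded hs ?_
    · have e : ((HurwitzZeta.cosKernel a (t / π) : ℝ) : ℂ) - 1
        = ((HurwitzZeta.cosKernel a (t / π) - 1 : ℝ) : ℂ) := by push_cast; rfl
      rwa [e, Complex.norm_real, Real.norm_eq_abs] at this
    intro n
    by_cases hn : n = 0
    · simp only [hn, if_true, norm_zero]; positivity
    have e := exp_neg_sq_mul_le hn ht
    have e2 : ‖Complex.exp (2 * π * Complex.I * a * n)‖ = 1 := by
      rw [Complex.norm_exp]; simp
    rw [if_neg hn, norm_mul, e2, Complex.norm_real, Real.norm_of_nonneg (Real.exp_pos _).le]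
    simp only [one_mul, pow_zero]
    rwa [mul_comm (Real.exp (-(1/2) * _))]

/-- Gaussians are products over the coordinates, so lattice sums over `ℤ²` become products of
one-dimensional theta series. -/
lemma hasSum_fin_two_mul {f g : ℤ → ℝ} {a b : ℝ} (hf : HasSum f a) (hg : HasSum g b) :
    HasSum (fun m : Fin 2 → ℤ => f (m 0) * g (m 1)) (a * b) := by
  have h := hf.mul hg (summable_mul_of_summable_norm hf.summable.norm hg.summable.norm)
  exact (finTwoArrowEquiv ℤ).hasSum_iff.2 h

/-- The term `m = 0` of the series of the kernel `-∇^⊥ p_t`. -/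
def perpGradGauss (t : ℝ) (y : Plane) : Plane :=
  ((8 * π * t ^ 2)⁻¹ * Real.exp (-‖y‖ ^ 2 / (4 * t))) • perp y

/-- The heat kernel of the plane. -/
def planeHeat (t : ℝ) (y : Plane) : ℝ := (4 * π * t)⁻¹ * Real.exp (-‖y‖ ^ 2 / (4 * t))

lemma exp_neg_norm_add_latticePoint (x : Plane) (m : Fin 2 → ℤ) {t : ℝ} (ht : 0 < t) :
    Real.exp (-‖x + latticePoint m‖ ^ 2 / (4 * t)) =
      Real.exp (-π * ((m 0 : ℝ) + x 0 / (2 * π)) ^ 2 * (π / t)) *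
      Real.exp (-π * ((m 1 : ℝ) + x 1 / (2 * π)) ^ 2 * (π / t)) := by
  rw [← Real.exp_add, EuclideanSpace.norm_sq_eq]
  congr 1
  simp [latticePoint, Fin.sum_univ_two]
  field_simp
  ring

lemma perp_eq (v : Plane) : perp v = (-v 1) • planeBasis 0 + v 0 • planeBasis 1 := by
  ext i; fin_cases i <;> simp [perp, planeBasis]

/-- Writing the lattice sum with Jacobi theta functions at `π/t` makes their functional equation
available, which is what controls large `t`. -/
lemma hasSum_planeHeat (x : Plane) {t : ℝ} (ht : 0 < t) :
    HasSum (fun m => planeHeat t (x + latticePoint m))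
      ((4 * π * t)⁻¹ * (HurwitzZeta.evenKernel (x 0 / (2 * π) : ℝ) (π / t) *
        HurwitzZeta.evenKernel (x 1 / (2 * π) : ℝ) (π / t))) := by
  have := (hasSum_fin_two_mul (HurwitzZeta.hasSum_int_evenKernel (x 0 / (2 * π)) (t := π / t)
    (by positivity)) (HurwitzZeta.hasSum_int_evenKernel (x 1 / (2 * π)) (t := π / t)
    (by positivity))).mul_left (4 * π * t)⁻¹
  refine this.congr_fun fun m => ?_
  rw [planeHeat, exp_neg_norm_add_latticePoint x m ht]

lemma hasSum_perpGradGauss (x : Plane) {t : ℝ} (ht : 0 < t) :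
    HasSum (fun m => perpGradGauss t (x + latticePoint m))
      ((4 * t ^ 2)⁻¹ • ((-(HurwitzZeta.evenKernel (x 0 / (2 * π) : ℝ) (π / t) *
          HurwitzZeta.oddKernel (x 1 / (2 * π) : ℝ) (π / t))) • planeBasis 0 +
        (HurwitzZeta.oddKernel (x 0 / (2 * π) : ℝ) (π / t) *
          HurwitzZeta.evenKernel (x 1 / (2 * π) : ℝ) (π / t)) • planeBasis 1)) := by
  have hp : 0 < π / t := by positivity
  have e := fun i : Fin 2 => HurwitzZeta.hasSum_int_evenKernel (x i / (2 * π)) hp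
  have o := fun i : Fin 2 => HurwitzZeta.hasSum_int_oddKernel (x i / (2 * π)) hp
  have h1 := ((hasSum_fin_two_mul (e 0) (o 1)).neg).smul_const (planeBasis 0)
  have h2 := (hasSum_fin_two_mul (o 0) (e 1)).smul_const (planeBasis 1)
  refine ((h1.add h2).const_smul ((4 * t ^ 2)⁻¹)).congr_fun fun m => ?_
  rw [perpGradGauss, exp_neg_norm_add_latticePoint x m ht, perp_eq]
  simp only [smul_add, smul_smul]
  congr 2
  · simp [latticePoint]; field_simp; ring
  · simp [latticePoint]; field_simp; ring

lemma negPerpGradHeat_eq_tsum (t : ℝ) (x : Plane) :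
    negPerpGradHeat t x = ∑' m, perpGradGauss t (x + latticePoint m) := rfl

/-- For large `t` the theta series at `π/t` is spread over many terms. The functional equation
(Poisson summation) trades it for the bounded cosine series at `t/π`, at the price of a factor
`(t/π)^(1/2)`. -/
lemma exists_abs_evenKernel_le : ∃ C, 0 ≤ C ∧ ∀ (a : ℝ) (t : ℝ), 1 ≤ t →
    |HurwitzZeta.evenKernel a (π / t)| ≤ C * t ^ (1 / 2 : ℝ) := by
  obtain ⟨C, hC, h⟩ := exists_abs_cosKernel_sub_one_le
  refine ⟨C + 1, by positivity, fun a t ht => ?_⟩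
  have ht0 : 0 < t := by linarith
  rw [HurwitzZeta.evenKernel_functional_equation, one_div_div, abs_mul]
  have h1 : |HurwitzZeta.cosKernel a (t / π)| ≤ C + 1 := by
    have h2 := h a t ht
    have h3 : Real.exp (-(t / 2)) ≤ 1 := Real.exp_le_one_iff.2 (by linarith)
    have h4 := abs_sub_abs_le_abs_sub (HurwitzZeta.cosKernel a (t / π)) 1
    rw [abs_one] at h4
    nlinarith
  have h5 : |1 / (π / t) ^ (1 / 2 : ℝ)| ≤ t ^ (1 / 2 : ℝ) := by
    rw [abs_of_nonneg (by positivity), one_div, ← Real.inv_rpow (by positivity), inv_div]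
    gcongr
    rw [div_le_iff₀ (by positivity)]
    nlinarith [Real.pi_gt_three]
  calc _ ≤ t ^ (1 / 2 : ℝ) * (C + 1) := by gcongr
    _ = _ := by ring

/-- The same transformation costs `(t/π)^(3/2)` here, but the sine series has no zero mode and
contributes the exponential decay. -/
lemma exists_abs_oddKernel_le : ∃ C, 0 ≤ C ∧ ∀ (a : ℝ) (t : ℝ), 1 ≤ t →
    |HurwitzZeta.oddKernel a (π / t)| ≤ C * t ^ (3 / 2 : ℝ) * Real.exp (-(t / 2)) := by
  obtain ⟨C, hC, h⟩ := exists_abs_sinKernel_le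
  refine ⟨C, hC, fun a t ht => ?_⟩
  have ht0 : 0 < t := by linarith
  rw [HurwitzZeta.oddKernel_functional_equation, one_div_div, abs_mul]
  have h5 : |1 / (π / t) ^ (3 / 2 : ℝ)| ≤ t ^ (3 / 2 : ℝ) := by
    rw [abs_of_nonneg (by positivity), one_div, ← Real.inv_rpow (by positivity), inv_div]
    gcongr
    rw [div_le_iff₀ (by positivity)]
    nlinarith [Real.pi_gt_three]
  calc _ ≤ t ^ (3 / 2 : ℝ) * (C * Real.exp (-(t / 2))) := by
        gcongr; exact h a t ht
    _ = _ := by ring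

lemma norm_planeBasis (i : Fin 2) : ‖planeBasis i‖ = 1 := by simp [planeBasis]

/-- The kernel `-∇^⊥ p_t` decays exponentially, uniformly in space. -/
lemma exists_norm_negPerpGradHeat_le : ∃ C, 0 ≤ C ∧ ∀ (x : Plane) (t : ℝ), 1 ≤ t →
    ‖negPerpGradHeat t x‖ ≤ C * Real.exp (-(t / 2)) := by
  obtain ⟨A, hA, hE⟩ := exists_abs_evenKernel_le
  obtain ⟨B, hB, hO⟩ := exists_abs_oddKernel_le
  refine ⟨A * B, by positivity, fun x t ht => ?_⟩
  have ht0 : 0 < t := by linarith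
  rw [negPerpGradHeat_eq_tsum, (hasSum_perpGradGauss x ht0).tsum_eq, norm_smul,
    Real.norm_of_nonneg (by positivity)]
  have e : t ^ (1 / 2 : ℝ) * t ^ (3 / 2 : ℝ) = t ^ 2 := by
    rw [← Real.rpow_add ht0]; norm_num
  have key : ∀ a b : ℝ, |HurwitzZeta.evenKernel a (π / t)| * |HurwitzZeta.oddKernel b (π / t)| ≤
      A * B * t ^ 2 * Real.exp (-(t / 2)) := by
    intro a b
    calc _ ≤ (A * t ^ (1 / 2 : ℝ)) * (B * t ^ (3 / 2 : ℝ) * Real.exp (-(t / 2))) := by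
          gcongr
          · exact hE a t ht
          · exact hO b t ht
      _ = A * B * (t ^ (1 / 2 : ℝ) * t ^ (3 / 2 : ℝ)) * Real.exp (-(t / 2)) := by ring
      _ = _ := by rw [e]
  calc _ ≤ (4 * t ^ 2)⁻¹ * (A * B * t ^ 2 * Real.exp (-(t / 2)) +
        A * B * t ^ 2 * Real.exp (-(t / 2))) := by
        gcongr
        refine (norm_add_le _ _).trans (add_le_add ?_ ?_)
        · rw [norm_smul, norm_neg, norm_planeBasis, mul_one, norm_mul]
          exact key _ _
        · rw [norm_smul, norm_planeBasis, mul_one, norm_mul, mul_comm]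
          exact key _ _
    _ = (1 / 2) * (A * B * Real.exp (-(t / 2))) := by field_simp; ring
    _ ≤ A * B * Real.exp (-(t / 2)) := by
      have : 0 ≤ A * B * Real.exp (-(t / 2)) := by positivity
      linarith

/-- The heat kernel of the torus converges to the constant `(2π)⁻²`, uniformly in space. -/
lemma exists_abs_tsum_planeHeat_sub_le : ∃ C, 0 ≤ C ∧ ∀ (x : Plane) (t : ℝ), 1 ≤ t →
    |∑' m, planeHeat t (x + latticePoint m) - (4 * π ^ 2)⁻¹| ≤ C * Real.exp (-(t / 2)) := by
  obtain ⟨C, hC, h⟩ := exists_abs_cosKernel_sub_one_le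
  refine ⟨C * (C + 2), by positivity, fun x t ht => ?_⟩
  have ht0 : 0 < t := by linarith
  rw [(hasSum_planeHeat x ht0).tsum_eq]
  simp only [HurwitzZeta.evenKernel_functional_equation _ (π / t), one_div_div]
  set a := HurwitzZeta.cosKernel (x 0 / (2 * π) : ℝ) (t / π)
  set b := HurwitzZeta.cosKernel (x 1 / (2 * π) : ℝ) (t / π)
  have ha : |a - 1| ≤ C * Real.exp (-(t / 2)) := h _ t ht
  have hb : |b - 1| ≤ C * Real.exp (-(t / 2)) := h _ t ht
  have hs : (π / t) ^ (1 / 2 : ℝ) * (π / t) ^ (1 / 2 : ℝ) = π / t := by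
    rw [← Real.rpow_add (by positivity)]; norm_num
  have e : (4 * π * t)⁻¹ * (1 / (π / t) ^ (1 / 2 : ℝ) * a * (1 / (π / t) ^ (1 / 2 : ℝ) * b))
      = (4 * π ^ 2)⁻¹ * (a * b) := by
    have : (1 / (π / t) ^ (1 / 2 : ℝ) * a * (1 / (π / t) ^ (1 / 2 : ℝ) * b))
      = (1 / ((π / t) ^ (1 / 2 : ℝ) * (π / t) ^ (1 / 2 : ℝ))) * (a * b) := by field_simp
    rw [this, hs]; field_simp
  have hexp : Real.exp (-(t / 2)) ≤ 1 := Real.exp_le_one_iff.2 (by linarith)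
  have hep := Real.exp_pos (-(t / 2))
  have h1 : (4 * π ^ 2)⁻¹ ≤ 1 := inv_le_one_of_one_le₀ (by nlinarith [Real.pi_gt_three])
  have h0 : 0 ≤ (4 * π ^ 2)⁻¹ := by positivity
  have hab : |a * b - 1| ≤ C * (C + 2) * Real.exp (-(t / 2)) := by
    have : a * b - 1 = (a - 1) * (b - 1) + (a - 1) + (b - 1) := by ring
    rw [this]
    refine (abs_add_three _ _ _).trans ?_
    rw [abs_mul]
    have : |a - 1| * |b - 1| ≤ (C * Real.exp (-(t / 2))) * (C * 1) := by gcongr; exact hb.trans (by gcongr)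
    nlinarith
  rw [e, ← mul_sub_one, abs_mul, abs_of_nonneg h0]
  nlinarith [abs_nonneg (a * b - 1)]

/-! ### Gaussian averages of functions -/

/-- The heat semigroup at time `t`. -/
def heatMean (t : ℝ) (f : Plane → ℝ) (x : Plane) : ℝ := ∫ z, f (x - √t • z) * gaussWeight z

/-- The convolution with `-∇^⊥ p_t`, over the whole plane. -/
def perpHeat (t : ℝ) (f : Plane → ℝ) (x : Plane) : Plane :=
  ∫ z, (f (x - √t • z)) • ((2 * √t)⁻¹ * gaussWeight z) • perp z

lemma norm_perp (v : Plane) : ‖perp v‖ = ‖v‖ := by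
  rw [EuclideanSpace.norm_eq, EuclideanSpace.norm_eq]
  simp [perp, Fin.sum_univ_two, add_comm]

lemma continuous_perp : Continuous perp := by
  have : perp = fun v => (-v 1) • planeBasis 0 + v 0 • planeBasis 1 := funext perp_eq
  rw [this]; fun_prop

lemma perp_smul (c : ℝ) (v : Plane) : perp (c • v) = c • perp v := by
  ext i; fin_cases i <;> simp [perp]

/-- Parabolic scaling `y = √t z`, with Jacobian `t` in dimension two, reduces every heat kernel to
the Gaussian at time one and moves `t` into the argument of the function. -/
lemma integral_eq_mul_integral_comp_sqrt_smul {E : Type*} [NormedAddCommGroup E] [NormedSpace ℝ E]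
    (F : Plane → E) {t : ℝ} (ht : 0 < t) : ∫ y, F y = t • ∫ z, F (√t • z) := by
  rw [Measure.integral_comp_smul]
  simp [Real.sq_sqrt ht.le, smul_smul, abs_of_pos ht, ht.ne']

lemma perpGradGauss_sqrt_smul {t : ℝ} (ht : 0 < t) (z : Plane) :
    t • perpGradGauss t (√t • z) = ((2 * √t)⁻¹ * gaussWeight z) • perp z := by
  have hs : 0 < √t := Real.sqrt_pos.2 ht
  rw [perpGradGauss, perp_smul, smul_smul, smul_smul, gaussWeight, norm_smul,
    Real.norm_of_nonneg hs.le, mul_pow, Real.sq_sqrt ht.le]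
  have : -(t * ‖z‖ ^ 2) / (4 * t) = -‖z‖ ^ 2 / 4 := by field_simp
  rw [this]
  congr 1
  have h2 : t = √t * √t := (Real.mul_self_sqrt ht.le).symm
  generalize √t = s at *
  subst h2
  field_simp
  ring

lemma integral_smul_perpGradGauss (f : Plane → ℝ) (x : Plane) {t : ℝ} (ht : 0 < t) :
    ∫ y, f (x - y) • perpGradGauss t y = perpHeat t f x := by
  rw [integral_eq_mul_integral_comp_sqrt_smul _ ht, ← integral_smul]
  congr 1; funext z
  rw [smul_comm, perpGradGauss_sqrt_smul ht]

lemma integral_norm_perpGradGauss {t : ℝ} (ht : 0 < t) :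
    ∫ y, ‖perpGradGauss t y‖ = (2 * √t)⁻¹ * ∫ z, ‖z‖ * gaussWeight z := by
  rw [integral_eq_mul_integral_comp_sqrt_smul _ ht, ← integral_smul, ← integral_const_mul]
  congr 1; funext z
  have := congrArg norm (perpGradGauss_sqrt_smul ht z)
  rw [norm_smul, Real.norm_of_nonneg ht.le, norm_smul, norm_perp,
    Real.norm_of_nonneg (mul_nonneg (by positivity) (gaussWeight_nonneg z))] at this
  rw [smul_eq_mul, this]; ring

lemma integral_mul_planeHeat (f : Plane → ℝ) (x : Plane) {t : ℝ} (ht : 0 < t) :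
    ∫ y, f (x - y) * planeHeat t y = heatMean t f x := by
  rw [integral_eq_mul_integral_comp_sqrt_smul _ ht, ← integral_smul]
  congr 1; funext z
  have hs : 0 < √t := Real.sqrt_pos.2 ht
  rw [planeHeat, gaussWeight, norm_smul, Real.norm_of_nonneg hs.le, mul_pow, Real.sq_sqrt ht.le]
  have : -(t * ‖z‖ ^ 2) / (4 * t) = -‖z‖ ^ 2 / 4 := by field_simp
  rw [this, smul_eq_mul]
  field_simp

lemma continuous_perpGradGauss (t : ℝ) : Continuous (perpGradGauss t) := by
  have := continuous_perp
  unfold perpGradGauss; fun_prop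

lemma integrable_perpGradGauss {t : ℝ} (ht : 0 < t) : Integrable (perpGradGauss t) := by
  have hs : 0 < √t := Real.sqrt_pos.2 ht
  rw [← integrable_comp_smul_iff _ _ hs.ne']
  have h := integrable_mul_gaussWeight (f := fun z => (t⁻¹ * (2 * √t)⁻¹) • perp z)
    (by have := continuous_perp; fun_prop) (C := t⁻¹ * (2 * √t)⁻¹) (k := 1)
    (fun z => by rw [norm_smul, norm_perp, Real.norm_of_nonneg (by positivity), pow_one])
  refine h.congr (ae_of_all _ fun z => ?_)
  have := congrArg (fun v => t⁻¹ • v) (perpGradGauss_sqrt_smul ht z)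
  simp only [smul_smul, inv_mul_cancel₀ ht.ne', one_smul] at this
  simp only [this, smul_smul]; congr 1; ring

lemma integrable_planeHeat {t : ℝ} (ht : 0 < t) : Integrable (planeHeat t) := by
  have h := (integrable_exp_neg_mul_sq_norm (b := (4 * t)⁻¹) (by positivity)).const_mul (4 * π * t)⁻¹
  refine h.congr (ae_of_all _ fun z => ?_)
  simp only [planeHeat]; congr 2; field_simp

/-! ### Integrability of the Biot–Savart kernel -/

lemma latticePoint_neg (m : Fin 2 → ℤ) : latticePoint (-m) = -latticePoint m := by
  ext i; simp [latticePoint]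

lemma TorusPeriodic.sub_left {F : Type*} {f : Plane → F} (hf : TorusPeriodic f) (x : Plane) :
    TorusPeriodic (fun y => f (x - y)) := by
  intro y m
  have := hf (x - y) (-m)
  rw [latticePoint_neg] at this
  simp only [← this]; congr 1; abel

lemma measure_torusCell_lt_top : volume torusCell < ⊤ := isCompact_torusCell.measure_lt_top

instance isFiniteMeasure_restrict_torusCell :
    IsFiniteMeasure ((volume : Measure Plane).restrict torusCell) :=
  ⟨by rw [Measure.restrict_apply_univ]; exact measure_torusCell_lt_top⟩

/-- The first absolute moment of the Gaussian weight. -/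
def gaussMoment : ℝ := ∫ z : Plane, ‖z‖ * gaussWeight z

lemma gaussMoment_nonneg : 0 ≤ gaussMoment :=
  integral_nonneg fun z => mul_nonneg (norm_nonneg z) (gaussWeight_nonneg z)

/-- Lattice sum and cell integral merge into one integral over the plane, whose scaling is
`t^(-1/2)`: integrable at `t = 0`. -/
lemma lintegral_negPerpGradHeat_le {t : ℝ} (ht : 0 < t) :
    ∫⁻ y in torusCell, ‖negPerpGradHeat t y‖ₑ ≤ ENNReal.ofReal ((2 * √t)⁻¹ * gaussMoment) := by
  have hm : Measurable fun y => ‖perpGradGauss t y‖ₑ :=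
    (continuous_perpGradGauss t).measurable.enorm
  calc ∫⁻ y in torusCell, ‖negPerpGradHeat t y‖ₑ
      ≤ ∫⁻ y in torusCell, ∑' m, ‖perpGradGauss t (y + latticePoint m)‖ₑ :=
        lintegral_mono fun y => enorm_tsum_le_tsum_enorm
    _ = ∑' m, ∫⁻ y in torusCell, ‖perpGradGauss t (y + latticePoint m)‖ₑ :=
        lintegral_tsum fun m => (hm.comp (measurable_add_const _)).aemeasurable
    _ = ∫⁻ y, ‖perpGradGauss t y‖ₑ := (lintegral_eq_tsum_torusCell hm).symm
    _ = ENNReal.ofReal (∫ y, ‖perpGradGauss t y‖) :=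
        (ofReal_integral_norm_eq_lintegral_enorm (integrable_perpGradGauss ht)).symm
    _ = _ := by rw [integral_norm_perpGradGauss ht]; rfl

/-- For `t ≤ 0` convergence of the lattice sum is not available, hence the value `0` there; for `t >
0` the kernel is the pointwise limit of its finite partial sums. -/
lemma measurable_negPerpGradHeat :
    Measurable (fun p : ℝ × Plane => if 0 < p.1 then negPerpGradHeat p.1 p.2 else 0) := by
  refine measurable_of_tendsto_metrizable' (atTop : Filter (Finset (Fin 2 → ℤ)))
    (f := fun s (p : ℝ × Plane) => ∑ m ∈ s,
      if 0 < p.1 then perpGradGauss p.1 (p.2 + latticePoint m) else 0) (fun s => ?_) ?_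
  · refine Finset.measurable_sum _ fun m _ => Measurable.ite ?_ ?_ measurable_const
    · exact measurableSet_lt measurable_const measurable_fst
    · have := continuous_perp.measurable
      unfold perpGradGauss
      fun_prop
  · rw [tendsto_pi_nhds]
    rintro ⟨t, y⟩
    by_cases ht : 0 < t
    · simp only [ht, if_true]
      rw [negPerpGradHeat_eq_tsum]
      exact (hasSum_perpGradGauss y ht).summable.hasSum
    · simp [ht]

lemma integrableOn_inv_sqrt (b : ℝ) : IntegrableOn (fun t : ℝ => (√t)⁻¹) (Ioc 0 b) := by
  rcases le_or_gt b 0 with hb | hb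
  · simp [Ioc_eq_empty_of_le hb]
  have h : IntervalIntegrable (fun t : ℝ => t ^ (-(1/2) : ℝ)) volume 0 b :=
    intervalIntegral.intervalIntegrable_rpow' (by norm_num)
  rw [intervalIntegrable_iff_integrableOn_Ioc_of_le hb.le] at h
  refine h.congr_fun (fun t ht => ?_) measurableSet_Ioc
  show t ^ (-(1/2) : ℝ) = (√t)⁻¹
  rw [Real.sqrt_eq_rpow, Real.rpow_neg ht.1.le]

lemma setIntegral_inv_sqrt {b : ℝ} (hb : 0 ≤ b) : ∫ t in Ioc 0 b, (√t)⁻¹ = 2 * √b := by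
  have h := integral_rpow (a := 0) (b := b) (r := -(1/2)) (Or.inl (by norm_num))
  rw [intervalIntegral.integral_of_le hb] at h
  have e : ∫ t in Ioc 0 b, (√t)⁻¹ = ∫ t in Ioc 0 b, t ^ (-(1/2) : ℝ) := by
    refine setIntegral_congr_fun measurableSet_Ioc fun t ht => ?_
    rw [Real.sqrt_eq_rpow, Real.rpow_neg ht.1.le]
  rw [e, h, Real.sqrt_eq_rpow]
  norm_num
  ring

lemma integrableOn_exp_neg_half (b : ℝ) :
    IntegrableOn (fun t : ℝ => Real.exp (-(t / 2))) (Ioi b) := by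
  have := integrableOn_exp_mul_Ioi (a := -(1/2)) (by norm_num) b
  refine this.congr_fun (fun t _ => ?_) measurableSet_Ioi
  ring_nf

lemma setIntegral_exp_neg_half (b : ℝ) :
    ∫ t in Ioi b, Real.exp (-(t / 2)) = 2 * Real.exp (-(b / 2)) := by
  have := integral_exp_mul_Ioi (a := -(1/2)) (by norm_num) b
  have e : ∀ t : ℝ, -(t / 2) = -(1/2) * t := fun t => by ring
  rw [setIntegral_congr_fun measurableSet_Ioi fun t _ => congrArg Real.exp (e t), this, e b]
  ring

/-- The `L¹` norm over the cell is `O(t^(-1/2))` up to `t = 1` and exponentially small beyond.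
Fubini then makes `biotSavartKernel` integrable and allows the time integral to be exchanged with
the convolution. -/
lemma integrable_negPerpGradHeat :
    Integrable (fun p : ℝ × Plane => negPerpGradHeat p.1 p.2)
      ((volume.restrict (Ioi 0)).prod (volume.restrict torusCell)) := by
  have hae : (fun p : ℝ × Plane => if 0 < p.1 then negPerpGradHeat p.1 p.2 else 0)
      =ᵐ[(volume.restrict (Ioi 0)).prod (volume.restrict torusCell)]
      (fun p : ℝ × Plane => negPerpGradHeat p.1 p.2) := by
    have h1 : ∀ᵐ t ∂(volume.restrict (Ioi (0 : ℝ))), 0 < t := ae_restrict_mem measurableSet_Ioi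
    filter_upwards [Measure.quasiMeasurePreserving_fst.ae h1] with p hp
    simp [hp]
  refine Integrable.congr ⟨measurable_negPerpGradHeat.aestronglyMeasurable, ?_⟩ hae
  rw [HasFiniteIntegral, lintegral_prod _ measurable_negPerpGradHeat.enorm.aemeasurable]
  have e : ∫⁻ t in Ioi (0 : ℝ), ∫⁻ y in torusCell,
      ‖(if 0 < t then negPerpGradHeat t y else 0 : Plane)‖ₑ
      = ∫⁻ t in Ioi (0 : ℝ), ∫⁻ y in torusCell, ‖negPerpGradHeat t y‖ₑ := by
    refine setLIntegral_congr_fun measurableSet_Ioi fun t ht => ?_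
    have ht : 0 < t := ht
    simp [ht]
  simp only [e]
  obtain ⟨C, hC, hb⟩ := exists_norm_negPerpGradHeat_le
  rw [← Ioc_union_Ioi_eq_Ioi zero_le_one,
    lintegral_union measurableSet_Ioi (Ioc_disjoint_Ioi le_rfl)]
  refine ENNReal.add_lt_top.2 ⟨?_, ?_⟩
  · refine lt_of_le_of_lt (setLIntegral_mono' measurableSet_Ioc
      fun t ht => lintegral_negPerpGradHeat_le ht.1) ?_
    have h : IntegrableOn (fun t : ℝ => (2 * √t)⁻¹ * gaussMoment) (Ioc 0 1) := by
      refine ((integrableOn_inv_sqrt 1).const_mul (gaussMoment / 2)).congr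
        (ae_of_all _ fun t => ?_)
      simp only [mul_inv]; ring
    exact h.lintegral_lt_top
  · refine lt_of_le_of_lt (setLIntegral_mono' (g := fun t =>
      ENNReal.ofReal (C * Real.exp (-(t / 2))) * volume torusCell)
      measurableSet_Ioi fun t ht => ?_) ?_
    · refine (lintegral_mono (g := fun _ => ENNReal.ofReal (C * Real.exp (-(t / 2)))) fun y => ?_).trans ?_
      · rw [← ofReal_norm]
        exact ENNReal.ofReal_le_ofReal (hb y t (le_of_lt ht))
      · simp
    · rw [lintegral_mul_const _ (by fun_prop)]
      exact ENNReal.mul_lt_top ((integrableOn_exp_neg_half 1).const_mul C).lintegral_lt_top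
        measure_torusCell_lt_top

lemma integrableOn_biotSavartKernel : IntegrableOn biotSavartKernel torusCell :=
  integrable_negPerpGradHeat.integral_prod_right

/-- The `L¹` norm of the Biot–Savart kernel. -/
def kernelMass : ℝ := ∫ y in torusCell, ‖biotSavartKernel y‖

lemma kernelMass_nonneg : 0 ≤ kernelMass := integral_nonneg fun _ => norm_nonneg _

/-! ### The Biot–Savart law as a time integral of Gaussian averages -/

lemma perpHeat_eq_setIntegral {w : Plane → ℝ} (hw : TorusPeriodic w) (hc : Continuous w) {M : ℝ}
    (hM : ∀ x, |w x| ≤ M) (x : Plane) {t : ℝ} (ht : 0 < t) :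
    perpHeat t w x = ∫ y in torusCell, w (x - y) • negPerpGradHeat t y := by
  rw [← integral_smul_perpGradGauss w x ht]
  exact integral_torusCell_tsum (hw.sub_left x)
    ((integrable_perpGradGauss ht).bdd_smul (φ := fun y => w (x - y)) M
      (Continuous.aestronglyMeasurable (by fun_prop)) (ae_of_all _ fun z => hM _))

lemma integrable_smul_negPerpGradHeat {w : Plane → ℝ} (hc : Continuous w) {M : ℝ}
    (hM : ∀ x, |w x| ≤ M) (x : Plane) :
    Integrable (fun p : ℝ × Plane => w (x - p.2) • negPerpGradHeat p.1 p.2)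
      ((volume.restrict (Ioi 0)).prod (volume.restrict torusCell)) :=
  Integrable.bdd_smul (f := fun p : ℝ × Plane => negPerpGradHeat p.1 p.2)
    (φ := fun p : ℝ × Plane => w (x - p.2)) integrable_negPerpGradHeat M
    (Continuous.aestronglyMeasurable (by fun_prop)) (ae_of_all _ fun z => hM _)

lemma integrableOn_perpHeat {w : Plane → ℝ} (hw : TorusPeriodic w) (hc : Continuous w) {M : ℝ}
    (hM : ∀ x, |w x| ≤ M) (x : Plane) : IntegrableOn (fun t => perpHeat t w x) (Ioi 0) :=
  IntegrableOn.congr_fun (integrable_smul_negPerpGradHeat hc hM x).integral_prod_left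
    (fun _ ht => (perpHeat_eq_setIntegral hw hc hM x ht).symm) measurableSet_Ioi

/-- By Fubini the singular convolution becomes a superposition of Gaussian averages, so that each
time scale can be estimated separately. -/
lemma biotSavart_eq_integral_perpHeat {w : Plane → ℝ} (hw : TorusPeriodic w) (hc : Continuous w)
    {M : ℝ} (hM : ∀ x, |w x| ≤ M) (x : Plane) :
    biotSavart w x = ∫ t in Ioi 0, perpHeat t w x := by
  have h := integral_integral_swap (f := fun t y => w (x - y) • negPerpGradHeat t y)
    (integrable_smul_negPerpGradHeat hc hM x)
  rw [setIntegral_congr_fun measurableSet_Ioi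
    fun t ht => perpHeat_eq_setIntegral hw hc hM x ht, h]
  unfold biotSavart biotSavartKernel
  congr 1; funext y
  rw [← integral_smul]

lemma norm_perpHeat_le {w : Plane → ℝ} {M : ℝ} (hM : ∀ x, |w x| ≤ M) (x : Plane) {t : ℝ} :
    ‖perpHeat t w x‖ ≤ M * gaussMoment * (√t)⁻¹ := by
  have hM0 : 0 ≤ M := (abs_nonneg _).trans (hM 0)
  have h2 := (integrable_norm_pow_mul_gaussWeight 1).const_mul (M * (2 * √t)⁻¹)
  refine (norm_integral_le_of_norm_le h2 (ae_of_all _ fun z => ?_)).trans ?_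
  · rw [norm_smul, norm_smul, norm_perp,
      Real.norm_of_nonneg (mul_nonneg (by positivity) (gaussWeight_nonneg z)), pow_one]
    calc _ ≤ M * ((2 * √t)⁻¹ * gaussWeight z * ‖z‖) := by
          have := gaussWeight_nonneg z
          gcongr
          exact hM _
      _ = _ := by ring
  · rw [integral_const_mul]
    simp only [pow_one]
    rw [show ∫ z : Plane, ‖z‖ * gaussWeight z = gaussMoment from rfl, mul_inv]
    have := gaussMoment_nonneg
    have : 0 ≤ M * gaussMoment * (√t)⁻¹ := by positivity
    linarith

lemma exists_norm_perpHeat_le_exp : ∃ C, 0 ≤ C ∧ ∀ (w : Plane → ℝ) (M : ℝ), TorusPeriodic w →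
    Continuous w → (∀ x, |w x| ≤ M) → ∀ (x : Plane) (t : ℝ), 1 ≤ t →
    ‖perpHeat t w x‖ ≤ C * M * Real.exp (-(t / 2)) := by
  obtain ⟨C, hC, hb⟩ := exists_norm_negPerpGradHeat_le
  refine ⟨C * volume.real torusCell, by positivity, fun w M hw hc hM x t ht => ?_⟩
  have hM0 : 0 ≤ M := (abs_nonneg _).trans (hM 0)
  rw [perpHeat_eq_setIntegral hw hc hM x (by linarith)]
  refine (norm_setIntegral_le_of_norm_le_const measure_torusCell_lt_top
    (C := M * (C * Real.exp (-(t / 2)))) fun y _ => ?_).trans (le_of_eq (by ring))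
  rw [norm_smul]
  exact mul_le_mul (hM _) (hb y t ht) (norm_nonneg _) hM0

/-! ### Elementary properties of the Biot–Savart law -/

lemma norm_biotSavart_le {w : Plane → ℝ} {M : ℝ} (hM : ∀ x, |w x| ≤ M) (x : Plane) :
    ‖biotSavart w x‖ ≤ kernelMass * M := by
  refine (norm_integral_le_of_norm_le (integrableOn_biotSavartKernel.norm.const_mul M)
    (ae_of_all _ fun y => ?_)).trans ?_
  · rw [norm_smul]; gcongr; exact hM _
  · rw [integral_const_mul, mul_comm]; rfl

lemma integrable_smul_biotSavartKernel {w : Plane → ℝ} (hc : Continuous w) {M : ℝ}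
    (hM : ∀ x, |w x| ≤ M) (x : Plane) :
    IntegrableOn (fun y => w (x - y) • biotSavartKernel y) torusCell :=
  Integrable.bdd_smul (φ := fun y => w (x - y)) integrableOn_biotSavartKernel M
    (Continuous.aestronglyMeasurable (by fun_prop)) (ae_of_all _ fun z => hM _)

lemma norm_biotSavart_sub_le {w w' : Plane → ℝ} (hc : Continuous w) (hc' : Continuous w') {M M' m : ℝ}
    (hM : ∀ x, |w x| ≤ M) (hM' : ∀ x, |w' x| ≤ M') (hm : ∀ x, |w x - w' x| ≤ m) (x : Plane) :
    ‖biotSavart w x - biotSavart w' x‖ ≤ kernelMass * m := by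
  have : biotSavart w x - biotSavart w' x = biotSavart (fun x => w x - w' x) x := by
    unfold biotSavart
    rw [← integral_sub (integrable_smul_biotSavartKernel hc hM x)
      (integrable_smul_biotSavartKernel hc' hM' x)]
    simp only [sub_smul]
  rw [this]
  exact norm_biotSavart_le hm x

lemma TorusPeriodic.biotSavart {w : Plane → ℝ} (hw : TorusPeriodic w) :
    TorusPeriodic (biotSavart w) := by
  intro x m
  unfold _root_.biotSavart
  congr 1; funext y
  rw [add_sub_right_comm, hw]

/-- The convolution of the Biot–Savart kernel with a field of linear forms. -/
def biotSavartDeriv (g : Plane → Plane →L[ℝ] ℝ) (x : Plane) : Plane →L[ℝ] Plane :=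
  ∫ y in torusCell, (g (x - y)).smulRight (biotSavartKernel y)

lemma integrable_smulRight_biotSavartKernel {g : Plane → Plane →L[ℝ] ℝ} (hc : Continuous g) {M : ℝ}
    (hM : ∀ x, ‖g x‖ ≤ M) (x : Plane) :
    IntegrableOn (fun y => (g (x - y)).smulRight (biotSavartKernel y)) torusCell := by
  refine Integrable.mono' (integrableOn_biotSavartKernel.norm.const_mul M) ?_
    (ae_of_all _ fun y => ?_)
  · have h1 : AEStronglyMeasurable (fun y => g (x - y)) (volume.restrict torusCell) :=
      (by fun_prop : Continuous fun y => g (x - y)).aestronglyMeasurable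
    exact ((ContinuousLinearMap.smulRightL ℝ Plane Plane).aestronglyMeasurable_comp₂ h1
      integrableOn_biotSavartKernel.aestronglyMeasurable)
  · rw [ContinuousLinearMap.norm_smulRight_apply]
    gcongr
    exact hM _

lemma norm_biotSavartDeriv_le {g : Plane → Plane →L[ℝ] ℝ} {M : ℝ} (hM : ∀ x, ‖g x‖ ≤ M)
    (x : Plane) : ‖biotSavartDeriv g x‖ ≤ kernelMass * M := by
  refine (norm_integral_le_of_norm_le (integrableOn_biotSavartKernel.norm.const_mul M)
    (ae_of_all _ fun y => ?_)).trans ?_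
  · rw [ContinuousLinearMap.norm_smulRight_apply]; gcongr; exact hM _
  · rw [integral_const_mul, mul_comm]; rfl

lemma biotSavartDeriv_sub {g g' : Plane → Plane →L[ℝ] ℝ} (hc : Continuous g) (hc' : Continuous g')
    {M M' : ℝ} (hM : ∀ x, ‖g x‖ ≤ M) (hM' : ∀ x, ‖g' x‖ ≤ M') (x : Plane) :
    biotSavartDeriv g x - biotSavartDeriv g' x = biotSavartDeriv (fun x => g x - g' x) x := by
  unfold biotSavartDeriv
  rw [← integral_sub (integrable_smulRight_biotSavartKernel hc hM x)
      (integrable_smulRight_biotSavartKernel hc' hM' x)]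
  congr 1; funext y; ext v; simp [sub_smul]

lemma norm_biotSavartDeriv_sub_le {g g' : Plane → Plane →L[ℝ] ℝ} (hc : Continuous g)
    (hc' : Continuous g') {M M' m : ℝ} (hM : ∀ x, ‖g x‖ ≤ M) (hM' : ∀ x, ‖g' x‖ ≤ M')
    (hm : ∀ x, ‖g x - g' x‖ ≤ m) (x : Plane) :
    ‖biotSavartDeriv g x - biotSavartDeriv g' x‖ ≤ kernelMass * m := by
  rw [biotSavartDeriv_sub hc hc' hM hM']
  exact norm_biotSavartDeriv_le hm x

lemma biotSavartDeriv_apply {g : Plane → Plane →L[ℝ] ℝ} (hc : Continuous g) {M : ℝ}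
    (hM : ∀ x, ‖g x‖ ≤ M) (x v : Plane) :
    biotSavartDeriv g x v = biotSavart (fun y => g y v) x := by
  unfold biotSavartDeriv biotSavart
  rw [ContinuousLinearMap.integral_apply (integrable_smulRight_biotSavartKernel hc hM x)]
  rfl

/-- All derivatives fall on `w`, since the kernel is known only to be integrable. -/
lemma hasFDerivAt_biotSavart {w : Plane → ℝ} {g : Plane → Plane →L[ℝ] ℝ}
    (hw : ∀ x, HasFDerivAt w (g x) x) (hg : Continuous g) {M M' : ℝ}
    (hM : ∀ x, |w x| ≤ M) (hM' : ∀ x, ‖g x‖ ≤ M') (x : Plane) :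
    HasFDerivAt (biotSavart w) (biotSavartDeriv g x) x := by
  have hc : Continuous w := continuous_iff_continuousAt.2 fun x => (hw x).continuousAt
  refine hasFDerivAt_integral_of_dominated_of_fderiv_le (s := univ)
    (bound := fun y => M' * ‖biotSavartKernel y‖) univ_mem
    (Eventually.of_forall fun x' => (integrable_smul_biotSavartKernel hc hM x').aestronglyMeasurable)
    (integrable_smul_biotSavartKernel hc hM x)
    (integrable_smulRight_biotSavartKernel hg hM' x).aestronglyMeasurable
    (F' := fun x y => (g (x - y)).smulRight (biotSavartKernel y))
    (ae_of_all _ fun y x' _ => ?_)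
    (integrableOn_biotSavartKernel.norm.const_mul M') (ae_of_all _ fun y x' _ => ?_)
  · rw [ContinuousLinearMap.norm_smulRight_apply]; gcongr; exact hM' _
  · have h1 : HasFDerivAt (fun x => w (x - y)) (g (x' - y)) x' := by
      have := (hw (x' - y)).comp x' ((hasFDerivAt_id x').sub_const y)
      rwa [ContinuousLinearMap.comp_id] at this
    exact h1.smul_const _

lemma continuous_biotSavart {X : Type*} [TopologicalSpace X] [FirstCountableTopology X]
    {w : X → Plane → ℝ} (hw : Continuous (Function.uncurry w)) {M : ℝ} (hM : ∀ a x, |w a x| ≤ M) :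
    Continuous (fun p : X × Plane => biotSavart (w p.1) p.2) := by
  refine continuous_of_dominated (bound := fun y => M * ‖biotSavartKernel y‖) (fun p => ?_)
    (fun p => ae_of_all _ fun y => ?_) (integrableOn_biotSavartKernel.norm.const_mul M)
    (ae_of_all _ fun y => ?_)
  · exact (integrable_smul_biotSavartKernel (w := w p.1) (by fun_prop)
      (hM p.1) p.2).aestronglyMeasurable
  · rw [norm_smul]; gcongr; exact hM _ _
  · have : Continuous fun p : X × Plane => w p.1 (p.2 - y) :=
      hw.comp (by fun_prop : Continuous fun p : X × Plane => (p.1, p.2 - y))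
    fun_prop

lemma continuous_biotSavartDeriv {X : Type*} [TopologicalSpace X] [FirstCountableTopology X]
    {g : X → Plane → Plane →L[ℝ] ℝ} (hg : Continuous (Function.uncurry g)) {M : ℝ}
    (hM : ∀ a x, ‖g a x‖ ≤ M) :
    Continuous (fun p : X × Plane => biotSavartDeriv (g p.1) p.2) := by
  refine continuous_of_dominated (bound := fun y => M * ‖biotSavartKernel y‖) (fun p => ?_)
    (fun p => ae_of_all _ fun y => ?_) (integrableOn_biotSavartKernel.norm.const_mul M)
    (ae_of_all _ fun y => ?_)
  · exact (integrable_smulRight_biotSavartKernel (g := g p.1) (by fun_prop)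
      (hM p.1) p.2).aestronglyMeasurable
  · rw [ContinuousLinearMap.norm_smulRight_apply]; gcongr; exact hM _ _
  · have : Continuous fun p : X × Plane => g p.1 (p.2 - y) :=
      hg.comp (by fun_prop : Continuous fun p : X × Plane => (p.1, p.2 - y))
    exact ((ContinuousLinearMap.smulRightL ℝ Plane Plane).flip (biotSavartKernel y)).continuous.comp
      this

/-! ### Gaussian averages against coordinates -/

/-- The coordinate `z_i` as a continuous linear form. -/
def coordForm (i : Fin 2) : Plane →L[ℝ] ℝ := EuclideanSpace.proj i

@[simp] lemma coordForm_apply (i : Fin 2) (z : Plane) : coordForm i z = z i := rfl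

lemma abs_coord_le_norm (z : Plane) (i : Fin 2) : |z i| ≤ ‖z‖ := PiLp.norm_apply_le z i

/-- The derivative of `z ↦ z_i g(z)`, where `g` is the Gaussian weight. -/
def coordGaussDeriv (i : Fin 2) (z : Plane) : Plane →L[ℝ] ℝ :=
  gaussWeight z • (coordForm i - (z i / 2) • innerSL ℝ z)

lemma hasFDerivAt_coord_mul_gaussWeight (i : Fin 2) (z : Plane) :
    HasFDerivAt (fun z : Plane => z i * gaussWeight z) (coordGaussDeriv i z) z := by
  have h := (coordForm i).hasFDerivAt (x := z) |>.mul (hasFDerivAt_gaussWeight z)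
  refine h.congr_fderiv ?_
  ext v
  simp [coordGaussDeriv]
  ring

lemma integrable_coord_mul_gaussWeight (i : Fin 2) :
    Integrable (fun z : Plane => z i * gaussWeight z) := by
  have := integrable_mul_gaussWeight (f := fun z : Plane => z i) (C := 1) (k := 1)
    (by fun_prop) (fun z => by simpa using abs_coord_le_norm z i)
  simpa [mul_comm] using this

lemma integrable_comp_mul_coord {f : Plane → ℝ} (hf : Continuous f) {M : ℝ} (hM : ∀ x, |f x| ≤ M)
    (x : Plane) (σ : ℝ) (i : Fin 2) :
    Integrable (fun z : Plane => f (x - σ • z) * (z i * gaussWeight z)) :=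
  (integrable_coord_mul_gaussWeight i).bdd_mul (c := M) (by fun_prop) (ae_of_all _ fun z => hM _)

lemma abs_coordGaussDeriv_apply_le (i : Fin 2) (z v : Plane) :
    |coordGaussDeriv i z v| ≤ ‖v‖ * (gaussWeight z + ‖z‖ ^ 2 * gaussWeight z) := by
  have h1 : |v i - z i / 2 * inner ℝ z v| ≤ ‖v‖ * (1 + ‖z‖ ^ 2) := by
    refine (abs_sub _ _).trans ?_
    have h2 := abs_coord_le_norm v i
    have h3 : |z i / 2 * inner ℝ z v| ≤ ‖z‖ * (‖z‖ * ‖v‖) := by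
      rw [abs_mul]
      refine mul_le_mul ?_ (abs_real_inner_le_norm z v) (abs_nonneg _) (norm_nonneg _)
      rw [abs_div, abs_two]
      have := abs_coord_le_norm z i
      have := abs_nonneg (z i)
      linarith
    nlinarith
  have e : coordGaussDeriv i z v = gaussWeight z * (v i - z i / 2 * inner ℝ z v) := by
    simp [coordGaussDeriv]
  rw [e, abs_mul, abs_of_nonneg (gaussWeight_nonneg z)]
  nlinarith [gaussWeight_nonneg z]

lemma continuous_coordGaussDeriv (i : Fin 2) : Continuous (coordGaussDeriv i) := by
  have := continuous_gaussWeight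
  unfold coordGaussDeriv; fun_prop

/-- A bound for the Gaussian moments of order two. -/
def gaussSecondMoment : ℝ := ∫ z : Plane, (gaussWeight z + ‖z‖ ^ 2 * gaussWeight z)

lemma integrable_gaussSecondMoment :
    Integrable (fun z : Plane => gaussWeight z + ‖z‖ ^ 2 * gaussWeight z) :=
  integrable_gaussWeight.add (integrable_norm_pow_mul_gaussWeight 2)

lemma gaussSecondMoment_nonneg : 0 ≤ gaussSecondMoment :=
  integral_nonneg fun z => by have := gaussWeight_nonneg z; positivity

lemma integrable_coordGaussDeriv_apply (i : Fin 2) (v : Plane) :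
    Integrable (fun z => coordGaussDeriv i z v) :=
  (integrable_gaussSecondMoment.const_mul ‖v‖).mono'
    (by have := continuous_coordGaussDeriv i; fun_prop)
    (ae_of_all _ fun z => abs_coordGaussDeriv_apply_le i z v)

lemma integral_fderiv_comp_mul_coord {f : Plane → ℝ} {f' : Plane → Plane →L[ℝ] ℝ}
    (hf : ∀ x, HasFDerivAt f (f' x) x) (hf'c : Continuous f') {M M' : ℝ}
    (hM : ∀ x, |f x| ≤ M) (hM' : ∀ x, ‖f' x‖ ≤ M') (i : Fin 2) (v : Plane) {σ : ℝ} (hσ : 0 < σ)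
    (x : Plane) :
    ∫ z, f' (x - σ • z) v * (z i * gaussWeight z)
      = σ⁻¹ * ∫ z, f (x - σ • z) * coordGaussDeriv i z v :=
  integral_fderiv_comp_mul hf hf'c hM hM' (hasFDerivAt_coord_mul_gaussWeight i) v
    (integrable_coord_mul_gaussWeight i) (integrable_coordGaussDeriv_apply i v) hσ x

lemma abs_integral_fderiv_comp_mul_coord_le {f : Plane → ℝ} {f' : Plane → Plane →L[ℝ] ℝ}
    (hf : ∀ x, HasFDerivAt f (f' x) x) (hf'c : Continuous f') {M M' : ℝ}
    (hM : ∀ x, |f x| ≤ M) (hM' : ∀ x, ‖f' x‖ ≤ M') (i : Fin 2) (v : Plane) {σ : ℝ} (hσ : 0 < σ)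
    (x : Plane) :
    |∫ z, f' (x - σ • z) v * (z i * gaussWeight z)| ≤ σ⁻¹ * (M * ‖v‖ * gaussSecondMoment) := by
  have hM0 : 0 ≤ M := (abs_nonneg _).trans (hM 0)
  rw [integral_fderiv_comp_mul_coord hf hf'c hM hM' i v hσ x, abs_mul, abs_of_pos (inv_pos.2 hσ)]
  gcongr
  rw [← Real.norm_eq_abs]
  refine (norm_integral_le_of_norm_le (integrable_gaussSecondMoment.const_mul (M * ‖v‖))
    (ae_of_all _ fun z => ?_)).trans ?_
  · rw [norm_mul, mul_assoc]
    exact mul_le_mul (hM _) (abs_coordGaussDeriv_apply_le i z v) (norm_nonneg _) hM0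
  · rw [integral_const_mul]; rfl

lemma perpHeat_eq_coord {f : Plane → ℝ} (hf : Continuous f) {M : ℝ} (hM : ∀ x, |f x| ≤ M)
    (t : ℝ) (x : Plane) :
    perpHeat t f x = (2 * √t)⁻¹ •
      ((-∫ z : Plane, f (x - √t • z) * (z 1 * gaussWeight z)) • planeBasis 0 +
        (∫ z : Plane, f (x - √t • z) * (z 0 * gaussWeight z)) • planeBasis 1) := by
  have i0 := integrable_comp_mul_coord hf hM x √t 0
  have i1 := integrable_comp_mul_coord hf hM x √t 1
  rw [← integral_neg, ← integral_smul_const, ← integral_smul_const,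
    ← integral_add (Integrable.smul_const (f := fun z : Plane =>
      -(f (x - √t • z) * (z 1 * gaussWeight z))) i1.neg _) (i0.smul_const _), ← integral_smul]
  unfold perpHeat
  congr 1; funext z
  rw [perp_eq]
  simp only [smul_add, smul_smul]
  congr 2 <;> ring

/-! ### The logarithmic estimate of the velocity gradient -/

/-- Integration by parts moves the derivative onto the Gaussian. The factor `t^(-1/2)` worsens to
`t^(-1)`, but only the sup norm of `f` enters the bound, not that of its derivative. -/
lemma norm_perpHeat_fderiv_le {f : Plane → ℝ} {f' : Plane → Plane →L[ℝ] ℝ}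
    (hf : ∀ x, HasFDerivAt f (f' x) x) (hf'c : Continuous f') {M M' : ℝ}
    (hM : ∀ x, |f x| ≤ M) (hM' : ∀ x, ‖f' x‖ ≤ M') (v x : Plane) {t : ℝ} (ht : 0 < t) :
    ‖perpHeat t (fun y => f' y v) x‖ ≤ M * ‖v‖ * gaussSecondMoment * t⁻¹ := by
  have hs : 0 < √t := Real.sqrt_pos.2 ht
  rw [perpHeat_eq_coord (M := M' * ‖v‖) (by fun_prop)
    (fun x => (f' x).le_of_opNorm_le (hM' x) v), norm_smul, Real.norm_of_nonneg (by positivity)]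
  have h := fun i => abs_integral_fderiv_comp_mul_coord_le hf hf'c hM hM' i v hs x
  set A := M * ‖v‖ * gaussSecondMoment
  calc _ ≤ (2 * √t)⁻¹ * ((√t)⁻¹ * A + (√t)⁻¹ * A) := by
        gcongr
        refine (norm_add_le _ _).trans (add_le_add ?_ ?_)
        · rw [norm_smul, norm_planeBasis, mul_one, norm_neg]; exact h 1
        · rw [norm_smul, norm_planeBasis, mul_one]; exact h 0
    _ = A * (√t * √t)⁻¹ := by field_simp; ring
    _ = _ := by rw [Real.mul_self_sqrt ht.le]

/-- The velocity gradient is controlled by the logarithm of the vorticity gradient. -/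
lemma exists_norm_biotSavartDeriv_le_log : ∃ C, 0 < C ∧ ∀ (w : Plane → ℝ)
    (g : Plane → Plane →L[ℝ] ℝ) (M Y : ℝ), TorusPeriodic g →
    (∀ x, HasFDerivAt w (g x) x) → Continuous g → (∀ x, |w x| ≤ M) → (∀ x, ‖g x‖ ≤ Y) → 1 ≤ Y →
    ∀ x, ‖biotSavartDeriv g x‖ ≤ C * (1 + M) * (1 + Real.log Y) := by
  obtain ⟨D, hD, hexp⟩ := exists_norm_perpHeat_le_exp
  have hg1 := gaussMoment_nonneg
  have hg2 := gaussSecondMoment_nonneg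
  refine ⟨2 * gaussMoment + 4 * gaussSecondMoment + 2 * D + 1, by positivity,
    fun w g M Y hgper hw hgc hM hY hY1 x => ?_⟩
  have hM0 : 0 ≤ M := (abs_nonneg _).trans (hM 0)
  have hY0 : 0 < Y := by linarith
  have hlog : 0 ≤ Real.log Y := Real.log_nonneg hY1
  refine ContinuousLinearMap.opNorm_le_bound _ (by positivity) fun v => ?_
  have hgv : ∀ x, |g x v| ≤ Y * ‖v‖ := fun x => (g x).le_of_opNorm_le (hY x) v
  have hper : TorusPeriodic fun y => g y v := fun x m => by simp only [hgper x m]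
  have hcont : Continuous fun y => g y v := by fun_prop
  have hint := integrableOn_perpHeat hper hcont hgv x
  rw [biotSavartDeriv_apply hgc hY x v, biotSavart_eq_integral_perpHeat hper hcont hgv x]
  -- The cuts are at `Y⁻²` and `Y²`. Below, the gradient bound `Y` against `t^(-1/2)` gives `Y √δ =
  -- 1`. Between, the bound `M t⁻¹` gives `M log (R/δ) = 4 M log Y`. Above, exponential decay beats
  -- the factor `Y`.
  set δ := (Y ^ 2)⁻¹
  set R := Y ^ 2
  have hδ : 0 < δ := by positivity
  have hR1 : 1 ≤ R := one_le_pow₀ hY1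
  have hδR : δ ≤ R := (inv_le_one_of_one_le₀ hR1).trans hR1
  have hδ0 : δ ≤ 1 := inv_le_one_of_one_le₀ hR1
  have e1 : Ioi (0 : ℝ) = Ioc 0 δ ∪ (Ioc δ R ∪ Ioi R) := by
    rw [Ioc_union_Ioi_eq_Ioi hδR, Ioc_union_Ioi_eq_Ioi hδ.le]
  have s1 : Ioc 0 δ ⊆ Ioi (0 : ℝ) := Ioc_subset_Ioi_self
  have s2 : Ioc δ R ⊆ Ioi (0 : ℝ) := Ioc_subset_Ioi_self.trans (Ioi_subset_Ioi hδ.le)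
  have s3 : Ioi R ⊆ Ioi (0 : ℝ) := Ioi_subset_Ioi (by linarith)
  rw [e1, setIntegral_union (by
      rw [Ioc_union_Ioi_eq_Ioi hδR]; exact Ioc_disjoint_Ioi le_rfl)
      (measurableSet_Ioc.union measurableSet_Ioi) (hint.mono_set s1)
      ((hint.mono_set s2).union (hint.mono_set s3)),
    setIntegral_union (Ioc_disjoint_Ioi le_rfl) measurableSet_Ioi (hint.mono_set s2)
      (hint.mono_set s3)]
  have b1 : ‖∫ t in Ioc 0 δ, perpHeat t (fun y => g y v) x‖ ≤ 2 * gaussMoment * ‖v‖ := by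
    refine (norm_integral_le_of_norm_le
      ((integrableOn_inv_sqrt δ).const_mul (Y * ‖v‖ * gaussMoment))
      (ae_of_all _ fun t => norm_perpHeat_le hgv x)).trans (le_of_eq ?_)
    rw [integral_const_mul, setIntegral_inv_sqrt hδ.le]
    have : √δ = Y⁻¹ := by
      rw [Real.sqrt_inv, Real.sqrt_sq hY0.le]
    rw [this]; field_simp
  have b2 : ‖∫ t in Ioc δ R, perpHeat t (fun y => g y v) x‖
      ≤ 4 * gaussSecondMoment * M * Real.log Y * ‖v‖ := by
    have hi : IntegrableOn (fun t : ℝ => t⁻¹) (Ioc δ R) := by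
      rw [← intervalIntegrable_iff_integrableOn_Ioc_of_le hδR]
      refine intervalIntegral.intervalIntegrable_inv (fun t ht => ?_) continuousOn_id
      rw [uIcc_of_le hδR] at ht
      exact (hδ.trans_le ht.1).ne'
    refine (norm_integral_le_of_norm_le (hi.const_mul (M * ‖v‖ * gaussSecondMoment))
      ((ae_restrict_iff' measurableSet_Ioc).2 (ae_of_all _ fun t ht =>
        norm_perpHeat_fderiv_le hw hgc hM hY v x (hδ.trans ht.1)))).trans (le_of_eq ?_)
    rw [integral_const_mul, ← intervalIntegral.integral_of_le hδR,
      integral_inv_of_pos hδ (by linarith)]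
    have : R / δ = Y ^ 4 := by simp only [δ, R]; field_simp
    rw [this, Real.log_pow]
    push_cast; ring
  have b3 : ‖∫ t in Ioi R, perpHeat t (fun y => g y v) x‖ ≤ 2 * D * ‖v‖ := by
    refine (norm_integral_le_of_norm_le
      ((integrableOn_exp_neg_half R).const_mul (D * (Y * ‖v‖)))
      ((ae_restrict_iff' measurableSet_Ioi).2 (ae_of_all _ fun t ht =>
        hexp _ _ hper hcont hgv x t (hR1.trans (le_of_lt ht))))).trans ?_
    rw [integral_const_mul, setIntegral_exp_neg_half]
    have : Y * Real.exp (-(R / 2)) ≤ 1 := by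
      rw [Real.exp_neg, ← div_eq_mul_inv, div_le_one (Real.exp_pos _)]
      have := Real.add_one_le_exp (R / 2)
      simp only [R] at *
      nlinarith [sq_nonneg (Y - 1)]
    have h0 : 0 ≤ D * ‖v‖ := by positivity
    nlinarith
  refine (norm_add_le _ _).trans ((add_le_add b1 ((norm_add_le _ _).trans
    (add_le_add b2 b3))).trans ?_)
  have hv := norm_nonneg v
  have key : 2 * gaussMoment + (4 * gaussSecondMoment * M * Real.log Y + 2 * D) ≤
      (2 * gaussMoment + 4 * gaussSecondMoment + 2 * D + 1) * (1 + M) * (1 + Real.log Y) := by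
    have : 0 ≤ M * Real.log Y := by positivity
    have : 1 ≤ (1 + M) * (1 + Real.log Y) := by nlinarith
    have h3 : M * Real.log Y ≤ (1 + M) * (1 + Real.log Y) := by nlinarith
    rw [mul_assoc]
    nlinarith
  calc _ = (2 * gaussMoment + (4 * gaussSecondMoment * M * Real.log Y + 2 * D)) * ‖v‖ := by ring
    _ ≤ _ := by gcongr

/-! ### Averages over the torus -/

lemma tsum_indicator_halfOpenCell (y : Plane) :
    ∑' m, halfOpenCell.indicator (fun _ => (1 : ℝ)) (y + latticePoint m) = 1 := by
  obtain ⟨m, hm, hu⟩ := existsUnique_sub_latticePoint_mem y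
  rw [tsum_eq_single (-m)]
  · rw [latticePoint_neg, ← sub_eq_add_neg]; simp [indicator_of_mem hm]
  · intro n hn
    rw [indicator_of_notMem]
    intro h
    refine hn ?_
    rw [← hu (-n) (by simpa [latticePoint_neg] using h), neg_neg]

/-- Integrals over the torus are invariant under translations and the reflection. -/
lemma setIntegral_torusCell_sub_left {f : Plane → ℝ} (hf : TorusPeriodic f) (hc : Continuous f)
    {M : ℝ} (hM : ∀ x, |f x| ≤ M) (x : Plane) :
    ∫ y in torusCell, f (x - y) = ∫ y in torusCell, f y := by
  have hind : Integrable (halfOpenCell.indicator fun _ : Plane => (1 : ℝ)) := by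
    rw [integrable_indicator_iff measurableSet_halfOpenCell]
    refine integrableOn_const ?_
    rw [measure_congr halfOpenCell_ae_eq_torusCell]; exact measure_torusCell_lt_top.ne
  -- The integral is unfolded to the plane against the indicator of a reflected and translated cell;
  -- folding it back, the periodised indicator is identically `1`.
  have h1 : ∫ y in torusCell, f (x - y)
      = ∫ y, f y • halfOpenCell.indicator (fun _ => (1 : ℝ)) (x - y) := by
    rw [← integral_sub_left_eq_self _ volume x]
    rw [setIntegral_congr_set halfOpenCell_ae_eq_torusCell.symm,
      ← integral_indicator measurableSet_halfOpenCell]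
    congr 1; funext y
    by_cases hy : y ∈ halfOpenCell <;> simp [hy]
  have hi2 := (integrable_comp_sub_left (g := x) (μ := volume) _).2 hind
  rw [h1, integral_torusCell_tsum hf (F := fun y => halfOpenCell.indicator (fun _ => (1 : ℝ)) (x - y))
    (hi2.bdd_smul (φ := f) M hc.aestronglyMeasurable (ae_of_all _ hM))]
  congr 1; funext y
  have : ∑' m, halfOpenCell.indicator (fun _ => (1 : ℝ)) (x - (y + latticePoint m)) = 1 := by
    refine Eq.trans ?_ (tsum_indicator_halfOpenCell (x - y))
    rw [← (Equiv.neg (Fin 2 → ℤ)).tsum_eq]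
    refine tsum_congr fun m => ?_
    rw [Equiv.neg_apply, latticePoint_neg]
    congr 1; abel
  simp [this]

lemma heatMean_eq_setIntegral {f : Plane → ℝ} (hf : TorusPeriodic f) (hc : Continuous f)
    {M : ℝ} (hM : ∀ x, |f x| ≤ M) (x : Plane) {t : ℝ} (ht : 0 < t) :
    heatMean t f x = ∫ y in torusCell, f (x - y) * ∑' m, planeHeat t (y + latticePoint m) := by
  rw [← integral_mul_planeHeat f x ht]
  exact integral_torusCell_tsum (hf.sub_left x)
    ((integrable_planeHeat ht).bdd_smul (φ := fun y => f (x - y)) M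
      (Continuous.aestronglyMeasurable (by fun_prop)) (ae_of_all _ fun z => hM _))

/-- The heat flow converges to the mean. -/
lemma tendsto_heatMean_atTop {f : Plane → ℝ} (hf : TorusPeriodic f) (hc : Continuous f)
    {M : ℝ} (hM : ∀ x, |f x| ≤ M) (x : Plane) :
    Tendsto (fun t => heatMean t f x) atTop (𝓝 ((4 * π ^ 2)⁻¹ * ∫ y in torusCell, f y)) := by
  obtain ⟨C, hC, hb⟩ := exists_abs_tsum_planeHeat_sub_le
  rw [tendsto_iff_norm_sub_tendsto_zero]
  have hlim : Tendsto (fun t : ℝ => M * C * volume.real torusCell * Real.exp (-(t / 2))) atTop (𝓝 0) := by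
    have : Tendsto (fun t : ℝ => Real.exp (-(t / 2))) atTop (𝓝 0) :=
      Real.tendsto_exp_neg_atTop_nhds_zero.comp (tendsto_id.atTop_div_const two_pos)
    simpa using this.const_mul (M * C * volume.real torusCell)
  refine squeeze_zero' (Eventually.of_forall fun t => norm_nonneg _) ?_ hlim
  filter_upwards [eventually_ge_atTop 1] with t ht
  have hM0 : 0 ≤ M := (abs_nonneg _).trans (hM 0)
  have ht0 : 0 < t := by linarith
  have hfc : Continuous fun y => f (x - y) := by fun_prop
  have i2 : IntegrableOn (fun y => f (x - y) * (4 * π ^ 2)⁻¹) torusCell :=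
    (hfc.mul continuous_const).continuousOn.integrableOn_compact isCompact_torusCell
  have i1 : IntegrableOn (fun y => f (x - y) * ∑' m, planeHeat t (y + latticePoint m))
      torusCell := by
    refine Integrable.bdd_mul (c := M) ?_ hfc.aestronglyMeasurable (ae_of_all _ fun z => hM _)
    refine Integrable.mono' (g := fun _ => (4 * π ^ 2)⁻¹ + C * Real.exp (-(t / 2)))
      (integrable_const _) ?_ (ae_of_all _ fun y => ?_)
    · refine (measurable_of_tendsto_metrizable' (atTop : Filter (Finset (Fin 2 → ℤ)))
        (f := fun s y => ∑ m ∈ s, planeHeat t (y + latticePoint m)) (fun s => ?_)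
        (tendsto_pi_nhds.2 fun y =>
          (hasSum_planeHeat y ht0).summable.hasSum)).aestronglyMeasurable
      unfold planeHeat; fun_prop
    · have h := hb y t ht
      have h2 : |(4 * π ^ 2)⁻¹| = (4 * π ^ 2)⁻¹ := abs_of_nonneg (by positivity)
      rw [Real.norm_eq_abs]
      have := abs_sub_abs_le_abs_sub (∑' m, planeHeat t (y + latticePoint m)) (4 * π ^ 2)⁻¹
      linarith
  rw [heatMean_eq_setIntegral hf hc hM x ht0, ← setIntegral_torusCell_sub_left hf hc hM x,
    mul_comm (4 * π ^ 2)⁻¹, ← integral_mul_const, ← integral_sub i1 i2]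
  refine (norm_setIntegral_le_of_norm_le_const measure_torusCell_lt_top
    (C := M * (C * Real.exp (-(t / 2)))) fun y _ => ?_).trans (le_of_eq (by ring))
  rw [← mul_sub, norm_mul]
  exact mul_le_mul (hM _) (hb y t ht) (norm_nonneg _) hM0

/-- The derivatives of functions on the torus have zero mean. -/
lemma setIntegral_torusCell_fderiv {f : Plane → ℝ} {f' : Plane → Plane →L[ℝ] ℝ}
    (hper : TorusPeriodic f') (hf : ∀ x, HasFDerivAt f (f' x) x) (hf'c : Continuous f') {M M' : ℝ}
    (hM : ∀ x, |f x| ≤ M) (hM' : ∀ x, ‖f' x‖ ≤ M') (v : Plane) :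
    ∫ y in torusCell, f' y v = 0 := by
  -- The mean is the limit of the heat flow. On a derivative the heat flow is `O(t^(-1/2))`, by an
  -- integration by parts against the Gaussian.
  have h1 := tendsto_heatMean_atTop (f := fun y => f' y v) (M := M' * ‖v‖)
    (fun x m => by simp only [hper x m]) (by fun_prop)
    (fun x => (f' x).le_of_opNorm_le (hM' x) v) 0
  have hG'i : Integrable fun z => ((-gaussWeight z / 2) • innerSL ℝ z) v := by
    have := integrable_mul_gaussWeight (f := fun z : Plane => (-(1/2)) * inner ℝ z v) (C := ‖v‖)
      (k := 1) (by fun_prop) (fun z => by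
        rw [norm_mul, pow_one]
        have := abs_real_inner_le_norm z v
        have h2 := abs_nonneg (inner ℝ z v)
        rw [Real.norm_eq_abs, Real.norm_eq_abs, abs_neg, abs_of_pos (by norm_num : (0:ℝ) < 1/2)]
        linarith)
    refine this.congr (ae_of_all _ fun z => ?_)
    simp; ring
  have h2 : Tendsto (fun t => heatMean t (fun y => f' y v) 0) atTop (𝓝 0) := by
    set B := ∫ z : Plane, M * ‖((-gaussWeight z / 2) • innerSL ℝ z) v‖
    have hlim : Tendsto (fun t : ℝ => (√t)⁻¹ * B) atTop (𝓝 0) := by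
      have := (tendsto_inv_atTop_zero.comp Real.tendsto_sqrt_atTop).mul_const B
      simpa using this
    refine squeeze_zero_norm' ?_ hlim
    filter_upwards [eventually_gt_atTop 0] with t ht
    have hs : 0 < √t := Real.sqrt_pos.2 ht
    unfold heatMean
    rw [integral_fderiv_comp_mul hf hf'c hM hM' hasFDerivAt_gaussWeight v integrable_gaussWeight
      hG'i hs 0, norm_mul, Real.norm_of_nonneg (by positivity)]
    gcongr
    refine norm_integral_le_of_norm_le (hG'i.norm.const_mul M) (ae_of_all _ fun z => ?_)
    rw [norm_mul]
    gcongr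
    exact hM _
  have := tendsto_nhds_unique h1 h2
  have hp : (4 * π ^ 2)⁻¹ ≠ 0 := by positivity
  exact (mul_eq_zero.1 this).resolve_left hp

/-! ### Periodic functions -/

lemma TorusPeriodic.exists_norm_le {F : Type*} [NormedAddCommGroup F] {f : Plane → F}
    (hf : TorusPeriodic f) (hc : Continuous f) : ∃ M, 0 ≤ M ∧ ∀ x, ‖f x‖ ≤ M := by
  obtain ⟨M, hM⟩ := isCompact_torusCell.exists_bound_of_continuousOn hc.continuousOn
  refine ⟨max M 0, le_max_right _ _, fun x => ?_⟩
  obtain ⟨m, hm⟩ := exists_add_latticePoint_mem x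
  rw [← hf x m]
  exact (hM _ hm).trans (le_max_left _ _)

lemma TorusPeriodic.fderiv {F : Type*} [NormedAddCommGroup F] [NormedSpace ℝ F] {f : Plane → F}
    (hf : TorusPeriodic f) : TorusPeriodic (fderiv ℝ f) := by
  intro x m
  rw [← fderiv_comp_add_right]
  congr 1; funext y; exact hf y m

lemma TorusPeriodic.comp {F G : Type*} {f : Plane → F} (hf : TorusPeriodic f) (φ : F → G) :
    TorusPeriodic (fun x => φ (f x)) := fun x m => by simp only [hf x m]

lemma plane_eq_sum (z : Plane) : z = z 0 • planeBasis 0 + z 1 • planeBasis 1 := by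
  ext i; fin_cases i <;> simp [planeBasis]

lemma map_plane_eq {F : Type*} [NormedAddCommGroup F] [NormedSpace ℝ F] (L : Plane →L[ℝ] F)
    (z : Plane) : L z = z 0 • L (planeBasis 0) + z 1 • L (planeBasis 1) := by
  conv_lhs => rw [plane_eq_sum z]
  simp

/-! ### The Biot–Savart law inverts the curl -/

lemma integrable_heatMean {f : Plane → ℝ} (hf : Continuous f) {M : ℝ} (hM : ∀ x, |f x| ≤ M)
    (t : ℝ) (x : Plane) : Integrable (fun z => f (x - √t • z) * gaussWeight z) :=
  integrable_gaussWeight.bdd_mul (c := M) (by fun_prop) (ae_of_all _ fun z => hM _)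

lemma continuous_heatMean {f : Plane → ℝ} (hf : Continuous f) {M : ℝ} (hM : ∀ x, |f x| ≤ M)
    (x : Plane) : Continuous (fun t => heatMean t f x) := by
  refine continuous_of_dominated (bound := fun z => M * gaussWeight z)
    (fun t => (integrable_heatMean hf hM t x).aestronglyMeasurable)
    (fun t => ae_of_all _ fun z => ?_) (integrable_gaussWeight.const_mul M)
    (ae_of_all _ fun z => by fun_prop)
  rw [norm_mul, Real.norm_of_nonneg (gaussWeight_nonneg z)]
  have := gaussWeight_nonneg z
  gcongr
  exact hM _

lemma heatMean_zero (f : Plane → ℝ) (x : Plane) : heatMean 0 f x = f x := by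
  simp [heatMean, integral_const_mul, integral_gaussWeight]

/-- Formally this is `Δ` of the heat flow with one of the two derivatives placed on the Gaussian, so
one derivative of `f` suffices. -/
lemma hasDerivAt_heatMean {f : Plane → ℝ} {f' : Plane → Plane →L[ℝ] ℝ}
    (hf : ∀ x, HasFDerivAt f (f' x) x) (hf'c : Continuous f') {M M' : ℝ}
    (hM : ∀ x, |f x| ≤ M) (hM' : ∀ x, ‖f' x‖ ≤ M') (x : Plane) {t : ℝ} (ht : 0 < t) :
    HasDerivAt (fun t => heatMean t f x)
      (-((2 * √t)⁻¹ *
        ((∫ z, f' (x - √t • z) (planeBasis 0) * (z 0 * gaussWeight z)) +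
        ∫ z, f' (x - √t • z) (planeBasis 1) * (z 1 * gaussWeight z)))) t := by
  have hfc : Continuous f := continuous_iff_continuousAt.2 fun x => (hf x).continuousAt
  have hM'0 : 0 ≤ M' := (norm_nonneg _).trans (hM' 0)
  have key := hasDerivAt_integral_of_dominated_loc_of_deriv_le (μ := (volume : Measure Plane))
    (s := Ioi (t / 2)) (x₀ := t) (F := fun t z => f (x - √t • z) * gaussWeight z)
    (F' := fun t z => f' (x - √t • z) (-((2 * √t)⁻¹ • z)) * gaussWeight z)
    (bound := fun z => M' * (2 * √(t / 2))⁻¹ * (‖z‖ ^ 1 * gaussWeight z))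
    (Ioi_mem_nhds (by linarith))
    (Eventually.of_forall fun t => (integrable_heatMean hfc hM t x).aestronglyMeasurable)
    (integrable_heatMean hfc hM t x)
    (by have := continuous_gaussWeight; fun_prop)
    (ae_of_all _ fun z s hs => ?_)
    ((integrable_norm_pow_mul_gaussWeight 1).const_mul _)
    (ae_of_all _ fun z s hs => ?_)
  · refine key.2.congr_deriv ?_
    have hi := fun i => integrable_comp_mul_coord (f := fun y => f' y (planeBasis i))
      (M := M' * 1) (by fun_prop) (fun x => by
        have := (f' x).le_of_opNorm_le (hM' x) (planeBasis i)
        rwa [norm_planeBasis] at this) x √t i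
    rw [← integral_add (hi 0) (hi 1), ← integral_const_mul, ← integral_neg]
    congr 1; funext z
    rw [map_plane_eq _ (-((2 * √t)⁻¹ • z))]
    simp
    ring
  · rw [norm_mul, Real.norm_of_nonneg (gaussWeight_nonneg z)]
    have hs : t / 2 < s := hs
    have hs0 : 0 < √(t / 2) := Real.sqrt_pos.2 (by linarith)
    have h1 := (f' (x - √s • z)).le_of_opNorm_le (hM' _) (-((2 * √s)⁻¹ • z))
    rw [norm_neg, norm_smul, Real.norm_of_nonneg (inv_nonneg.2 (by positivity))] at h1
    have h2 : (2 * √s)⁻¹ ≤ (2 * √(t / 2))⁻¹ := by gcongr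
    have := gaussWeight_nonneg z
    calc _ ≤ (M' * ((2 * √(t / 2))⁻¹ * ‖z‖)) * gaussWeight z := by
          gcongr
          exact h1.trans (by gcongr)
      _ = _ := by ring
  · have hs : t / 2 < s := hs
    have h1 : HasDerivAt (fun s : ℝ => x - √s • z) (-((1 / (2 * √s)) • z)) s :=
      ((Real.hasDerivAt_sqrt (by linarith)).smul_const z).const_sub x
    have h2 := ((hf (x - √s • z)).comp_hasDerivAt s h1).mul_const (gaussWeight z)
    simpa [one_div] using h2

/-- After integration by parts both sides contain the same weight `-z₀ z₁ g/2`, the mixed entry of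
the derivative of `z ↦ z_i g(z)`. It stands in for the symmetry of second derivatives of `f`, which
need not exist. -/
lemma integral_fderiv_coord_symm {f : Plane → ℝ} {f' : Plane → Plane →L[ℝ] ℝ}
    (hf : ∀ x, HasFDerivAt f (f' x) x) (hf'c : Continuous f') {M M' : ℝ}
    (hM : ∀ x, |f x| ≤ M) (hM' : ∀ x, ‖f' x‖ ≤ M') (x : Plane) {σ : ℝ} (hσ : 0 < σ) :
    ∫ z, f' (x - σ • z) (planeBasis 0) * (z 1 * gaussWeight z) =
      ∫ z, f' (x - σ • z) (planeBasis 1) * (z 0 * gaussWeight z) := by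
  rw [integral_fderiv_comp_mul_coord hf hf'c hM hM' 1 _ hσ x,
    integral_fderiv_comp_mul_coord hf hf'c hM hM' 0 _ hσ x]
  congr 2; funext z
  congr 1
  simp [coordGaussDeriv, planeBasis, PiLp.inner_apply]
  ring_nf
  simp

lemma contDiff_coord {u : Plane → Plane} {n : WithTop ℕ∞} (hu : ContDiff ℝ n u) (j : Fin 2) :
    ContDiff ℝ n (fun x => u x j) := (coordForm j).contDiff.comp hu

lemma fderiv_coord {u : Plane → Plane} {x : Plane} (hu : DifferentiableAt ℝ u x) (j : Fin 2) :
    fderiv ℝ (fun x => u x j) x = (coordForm j).comp (fderiv ℝ u x) :=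
  ((coordForm j).hasFDerivAt.comp x hu.hasFDerivAt).fderiv

lemma partialDeriv_eq {u : Plane → Plane} {x : Plane} (hu : DifferentiableAt ℝ u x) (i j : Fin 2) :
    partialDeriv u i j x = fderiv ℝ (fun x => u x j) x (planeBasis i) := by
  rw [fderiv_coord hu]; rfl

lemma hasFDerivAt_coord {u : Plane → Plane} (hu : ContDiff ℝ 1 u) (j : Fin 2) (x : Plane) :
    HasFDerivAt (fun x => u x j) (fderiv ℝ (fun x => u x j) x) x :=
  ((contDiff_coord hu j).differentiable one_ne_zero x).hasFDerivAt

/-- This is `Δu = ∇^⊥ curl u` for divergence-free `u`, read under the heat flow: `∂_t e^{tΔ}u = ∇^⊥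
e^{tΔ} curl u`. With `I i j k` the moment of `∂_i u_j` against `z_k`, zero divergence and the
symmetry of mixed moments leave only linear algebra. -/
lemma hasDerivAt_heatMean_coord {u : Plane → Plane} (hper : TorusPeriodic u)
    (hu : ContDiff ℝ 1 u) (hdiv : ∀ x, planeDiv u x = 0) (x : Plane) {t : ℝ} (ht : 0 < t)
    (j : Fin 2) :
    HasDerivAt (fun t => heatMean t (fun x => u x j) x) (-(perpHeat t (planeCurl u) x j)) t := by
  have hs : 0 < √t := Real.sqrt_pos.2 ht
  have hc := fun j => (contDiff_coord hu j)
  have hper' := fun j => hper.comp (fun v : Plane => v j)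
  have hfd := hasFDerivAt_coord hu
  have hfc : ∀ j, Continuous (fderiv ℝ fun x => u x j) := fun j =>
    (hc j).continuous_fderiv one_ne_zero
  choose M hM0 hM using fun j => (hper' j).exists_norm_le (hc j).continuous
  choose M' hM'0 hM' using fun j => (hper' j).fderiv.exists_norm_le (hfc j)
  have hdu : Differentiable ℝ u := hu.differentiable one_ne_zero
  set I : Fin 2 → Fin 2 → Fin 2 → ℝ := fun i j k =>
    ∫ z, fderiv ℝ (fun x => u x j) (x - √t • z) (planeBasis i) * (z k * gaussWeight z)
  have hint : ∀ i j k, Integrable fun z =>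
      fderiv ℝ (fun x => u x j) (x - √t • z) (planeBasis i) * (z k * gaussWeight z) := fun i j k =>
    integrable_comp_mul_coord (f := fun y => fderiv ℝ (fun x => u x j) y (planeBasis i))
      (M := M' j * 1) (by have := hfc j; fun_prop) (fun x => by
        have := (fderiv ℝ (fun x => u x j) x).le_of_opNorm_le (hM' j x) (planeBasis i)
        rwa [norm_planeBasis] at this) x √t k
  have hcurl : ∀ y, planeCurl u y = fderiv ℝ (fun x => u x 1) y (planeBasis 0)
      - fderiv ℝ (fun x => u x 0) y (planeBasis 1) := fun y => by
    rw [planeCurl, partialDeriv_eq (hdu y), partialDeriv_eq (hdu y)]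
  have hdiv' : ∀ y, fderiv ℝ (fun x => u x 0) y (planeBasis 0)
      = - fderiv ℝ (fun x => u x 1) y (planeBasis 1) := fun y => by
    have := hdiv y
    rw [planeDiv, Fin.sum_univ_two, partialDeriv_eq (hdu y), partialDeriv_eq (hdu y)] at this
    linarith
  have hcurlc : Continuous (planeCurl u) := by
    rw [show planeCurl u = _ from funext hcurl]
    have := hfc 0; have := hfc 1
    fun_prop
  obtain ⟨B, hB0, hB⟩ := (show TorusPeriodic (planeCurl u) from fun y m => by
    rw [hcurl, hcurl, (hper' 0).fderiv y m, (hper' 1).fderiv y m]).exists_norm_le hcurlc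
  have hsymm : ∀ j, I 0 j 1 = I 1 j 0 := fun j =>
    integral_fderiv_coord_symm (hfd j) (hfc j) (hM j) (hM' j) x hs
  have hdivI : ∀ k, I 0 0 k = - I 1 1 k := fun k => by
    simp only [I, ← integral_neg]
    congr 1; funext z; rw [hdiv']; ring
  have hcurlI : ∀ k, ∫ z, planeCurl u (x - √t • z) * (z k * gaussWeight z) = I 0 1 k - I 1 0 k := by
    intro k
    simp only [I, hcurl]
    rw [← integral_sub (hint 0 1 k) (hint 1 0 k)]
    congr 1; funext z; ring
  refine (hasDerivAt_heatMean (hfd j) (hfc j) (hM j) (hM' j) x ht).congr_deriv ?_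
  rw [perpHeat_eq_coord hcurlc hB, hcurlI, hcurlI]
  have e0 := hsymm 0
  have e1 := hsymm 1
  have d0 := hdivI 0
  have d1 := hdivI 1
  change -((2 * √t)⁻¹ * (I 0 j 0 + I 1 j 1)) = _
  fin_cases j
  · simp [planeBasis]
    left; linarith
  · simp [planeBasis]
    left; linarith

lemma TorusPeriodic.planeCurl {u : Plane → Plane} (hper : TorusPeriodic u) :
    TorusPeriodic (planeCurl u) := fun y m => by
  simp only [_root_.planeCurl, partialDeriv, hper.fderiv y m]

lemma continuous_planeCurl {u : Plane → Plane} (hu : ContDiff ℝ 1 u) :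
    Continuous (planeCurl u) := by
  have : Continuous (fderiv ℝ u) := hu.continuous_fderiv one_ne_zero
  unfold planeCurl partialDeriv
  fun_prop

/-- A divergence-free field of zero mean on the torus is recovered from its curl. -/
theorem biotSavart_planeCurl {u : Plane → Plane} (hper : TorusPeriodic u) (hu : ContDiff ℝ 1 u)
    (hdiv : ∀ x, planeDiv u x = 0) (hmean : ∀ j, ∫ x in torusCell, u x j = 0) (x : Plane) :
    biotSavart (planeCurl u) x = u x := by
  obtain ⟨B, hB0, hB⟩ := hper.planeCurl.exists_norm_le (continuous_planeCurl hu)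
  have hint := integrableOn_perpHeat hper.planeCurl (continuous_planeCurl hu) hB x
  rw [biotSavart_eq_integral_perpHeat hper.planeCurl (continuous_planeCurl hu) hB]
  ext j
  have hc := (contDiff_coord hu j).continuous
  obtain ⟨M, hM0, hM⟩ := (hper.comp (fun v : Plane => v j)).exists_norm_le hc
  have h1 : (∫ t in Ioi 0, perpHeat t (planeCurl u) x) j
      = ∫ t in Ioi 0, perpHeat t (planeCurl u) x j :=
    ((coordForm j).integral_comp_comm hint).symm
  have hlim := tendsto_heatMean_atTop (hper.comp (fun v : Plane => v j)) hc hM x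
  rw [hmean j, mul_zero] at hlim
  -- The heat flow runs from `u_j` at `t = 0` to the mean of `u_j`, which is zero, so `u_j` is minus
  -- the integral of its time derivative.
  have h2 := integral_Ioi_of_hasDerivAt_of_tendsto (a := 0)
    (continuous_heatMean hc hM x).continuousWithinAt
    (fun t ht => hasDerivAt_heatMean_coord hper hu hdiv x ht j)
    (((coordForm j).integrable_comp hint).neg) hlim
  rw [integral_neg, heatMean_zero] at h2
  rw [h1]
  linarith

/-! ### Mild form of the Kolmogorov equation of a jump process of rate `1/ε` -/

section Mild

variable {F : Type*} [NormedAddCommGroup F] [NormedSpace ℝ F]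

/-- The mild solution at time `s` of `-y' = -y/ε + B`, `y(T) = b`. -/
def mild (ε T : ℝ) (b : F) (B : ℝ → F) (s : ℝ) : F :=
  Real.exp (-(T - s) / ε) • b + ∫ r in s..T, Real.exp (-(r - s) / ε) • B r

/-- The derivative of `exp (-(r - s)/ε) • y r` is minus the integrand of `mild`; integrate it over
`[s,T]`. -/
lemma mild_of_hasDerivAt [CompleteSpace F] {ε s T : ℝ} (hs : s ≤ T) {y z : ℝ → F}
    (hy : ContinuousOn y (Icc s T)) (hd : ∀ r ∈ Ioo s T, HasDerivAt y (-(z r)) r)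
    (hz : ContinuousOn z (Icc s T)) :
    mild ε T (y T) (fun r => ε⁻¹ • y r + z r) s = y s := by
  have hG : ∀ r ∈ Ioo s T, HasDerivAt (fun r => Real.exp (-(r - s) / ε) • y r)
      (-(Real.exp (-(r - s) / ε) • (ε⁻¹ • y r + z r))) r := by
    intro r hr
    have h1 : HasDerivAt (fun r => Real.exp (-(r - s) / ε))
        (Real.exp (-(r - s) / ε) * (-1 / ε)) r :=
      ((((hasDerivAt_id r).sub_const s).neg).div_const ε).exp
    refine (h1.smul (hd r hr)).congr_deriv ?_
    rw [smul_add, smul_neg, neg_add, smul_smul]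
    rw [show -1 / ε = -ε⁻¹ by ring, mul_neg, neg_smul, add_comm]
  have hE : Continuous fun r => Real.exp (-(r - s) / ε) := by fun_prop
  have h := intervalIntegral.integral_eq_sub_of_hasDerivAt_of_le hs (hE.continuousOn.smul hy) hG
    (ContinuousOn.intervalIntegrable_of_Icc hs
      (hE.continuousOn.smul ((hy.const_smul _).add hz)).neg)
  rw [intervalIntegral.integral_neg] at h
  unfold mild
  rw [neg_eq_iff_eq_neg.1 h]
  simp

/-- A comparison principle: the weights of `mild` are positive, so a scalar `y` with dominating data
dominates the solution. It plays the role of Gronwall's inequality; each growth bound is an explicit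
choice of `y`. -/
lemma norm_mild_le {ε s T : ℝ} (hs : s ≤ T) {y z : ℝ → ℝ}
    (hy : ContinuousOn y (Icc s T)) (hd : ∀ r ∈ Ioo s T, HasDerivAt y (-(z r)) r)
    (hz : ContinuousOn z (Icc s T)) {b : F} {B : ℝ → F} (hb : ‖b‖ ≤ y T)
    (hB : ∀ r ∈ Icc s T, ‖B r‖ ≤ ε⁻¹ * y r + z r) : ‖mild ε T b B s‖ ≤ y s := by
  rw [← mild_of_hasDerivAt (ε := ε) hs hy hd hz]
  have hE : Continuous fun r => Real.exp (-(r - s) / ε) := by fun_prop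
  refine (norm_add_le _ _).trans (add_le_add ?_ ?_)
  · rw [norm_smul, Real.norm_of_nonneg (Real.exp_pos _).le, smul_eq_mul]
    gcongr
  · have hyz : ContinuousOn (fun r => ε⁻¹ • y r + z r) (Icc s T) := by fun_prop
    refine intervalIntegral.norm_integral_le_of_norm_le hs (ae_of_all _ fun r hr => ?_)
      (ContinuousOn.intervalIntegrable_of_Icc hs (hE.continuousOn.smul hyz))
    rw [norm_smul, Real.norm_of_nonneg (Real.exp_pos _).le]
    exact mul_le_mul_of_nonneg_left (hB r (Ioc_subset_Icc_self hr)) (Real.exp_pos _).le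

lemma norm_mild_le_const {ε s T M : ℝ} (hs : s ≤ T) {b : F} {B : ℝ → F} (hb : ‖b‖ ≤ M)
    (hB : ∀ r ∈ Icc s T, ‖B r‖ ≤ ε⁻¹ * M) : ‖mild ε T b B s‖ ≤ M :=
  norm_mild_le (y := fun _ => M) (z := fun _ => 0) hs continuousOn_const
    (fun r _ => by simpa using hasDerivAt_const r M) continuousOn_const hb (by simpa using hB)

lemma hasDerivAt_mul_exp (m l T r : ℝ) :
    HasDerivAt (fun r => m * Real.exp (l * (T - r))) (-(l * (m * Real.exp (l * (T - r))))) r := by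
  have h := ((((hasDerivAt_id r).const_sub T).const_mul l).exp).const_mul m
  refine h.congr_deriv ?_
  simp; ring

lemma norm_mild_le_exp {ε s T m l : ℝ} (hs : s ≤ T) {b : F} {B : ℝ → F}
    (hb : ‖b‖ ≤ m)
    (hB : ∀ r ∈ Icc s T, ‖B r‖ ≤ (ε⁻¹ + l) * (m * Real.exp (l * (T - r)))) :
    ‖mild ε T b B s‖ ≤ m * Real.exp (l * (T - s)) :=
  norm_mild_le (y := fun r => m * Real.exp (l * (T - r)))
    (z := fun r => l * (m * Real.exp (l * (T - r)))) hs (by fun_prop)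
    (fun r _ => hasDerivAt_mul_exp m l T r) (by fun_prop) (by simpa using hb)
    (fun r hr => (hB r hr).trans (le_of_eq (by ring)))

lemma mild_sub {ε s T : ℝ} {b b' : F} {B B' : ℝ → F} (hB : Continuous B) (hB' : Continuous B') :
    mild ε T b B s - mild ε T b' B' s = mild ε T (b - b') (fun r => B r - B' r) s := by
  unfold mild
  have i1 : IntervalIntegrable (fun r => Real.exp (-(r - s) / ε) • B r) volume s T :=
    Continuous.intervalIntegrable (by fun_prop) _ _
  have i2 : IntervalIntegrable (fun r => Real.exp (-(r - s) / ε) • B' r) volume s T :=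
    Continuous.intervalIntegrable (by fun_prop) _ _
  simp only [smul_sub]
  rw [intervalIntegral.integral_sub i1 i2]
  abel

lemma continuous_mild {X : Type*} [TopologicalSpace X] [FirstCountableTopology X]
    [LocallyCompactSpace X] {ε T : ℝ}
    {b : X → F} (hb : Continuous b) {B : ℝ → X → F} (hB : Continuous (Function.uncurry B))
    {c : X → ℝ} (hc : Continuous c) : Continuous (fun p => mild ε T (b p) (fun r => B r p) (c p)) := by
  unfold mild
  refine Continuous.add (by fun_prop) ?_
  have h : Continuous (Function.uncurry fun (p : X) (r : ℝ) =>
      Real.exp (-(r - c p) / ε) • B r p) := by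
    have h1 : Continuous fun q : X × ℝ => B q.2 q.1 := hB.comp (continuous_snd.prodMk continuous_fst)
    simp only [Function.uncurry_def]
    fun_prop
  simp only [intervalIntegral.integral_symm T]
  exact (intervalIntegral.continuous_parametric_intervalIntegral_of_continuous h hc).neg

lemma hasFDerivAt_mild {E : Type*} [NormedAddCommGroup E] [NormedSpace ℝ E] [ProperSpace E]
    {ε s T : ℝ} (hε : 0 < ε) (hs : s ≤ T) {b : E → F} {b' : E → E →L[ℝ] F} {B : ℝ → E → F}
    {B' : ℝ → E → E →L[ℝ] F} {K : ℝ} (hb : ∀ x, HasFDerivAt b (b' x) x)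
    (hB : Continuous (Function.uncurry B)) (hB' : Continuous (Function.uncurry B'))
    (hd : ∀ r x, HasFDerivAt (B r) (B' r x) x) (hK : ∀ r x, ‖B' r x‖ ≤ K) (x : E) :
    HasFDerivAt (fun x => mild ε T (b x) (fun r => B r x) s)
      (mild ε T (b' x) (fun r => B' r x) s) x := by
  unfold mild
  refine ((hb x).const_smul _).add ?_
  have hBx : ∀ x, Continuous fun r => Real.exp (-(r - s) / ε) • B r x := fun x => by
    have : Continuous fun r => B r x := hB.comp (by fun_prop : Continuous fun r => (r, x))
    fun_prop
  have hB'x : Continuous fun r => Real.exp (-(r - s) / ε) • B' r x := by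
    have : Continuous fun r => B' r x := hB'.comp (by fun_prop : Continuous fun r => (r, x))
    fun_prop
  refine (intervalIntegral.hasFDerivAt_integral_of_dominated_of_fderiv_le (s := univ)
    (bound := fun _ => K) (F' := fun x r => Real.exp (-(r - s) / ε) • B' r x)
    univ_mem (Eventually.of_forall fun x => (hBx x).aestronglyMeasurable)
    ((hBx x).intervalIntegrable _ _) hB'x.aestronglyMeasurable (ae_of_all _ fun r hr x _ => ?_)
    intervalIntegrable_const (ae_of_all _ fun r _ x _ => (hd r x).const_smul _))
  rw [uIoc_of_le hs] at hr
  rw [norm_smul, Real.norm_of_nonneg (Real.exp_pos _).le]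
  have h1 : Real.exp (-(r - s) / ε) ≤ 1 := by
    rw [Real.exp_le_one_iff]
    exact div_nonpos_of_nonpos_of_nonneg (by linarith [hr.1]) hε.le
  calc _ ≤ 1 * ‖B' r x‖ := by gcongr
    _ ≤ K := by rw [one_mul]; exact hK r x

end Mild

/-! ### Averages over one step of the random walk -/

section Step

variable {F : Type*} [NormedAddCommGroup F] [NormedSpace ℝ F]

/-- The average of `f` over the four points at distance `h` from `p`. -/
def stepMean (h : ℝ) (f : Plane → F) (p : Plane) : F :=
  (4⁻¹ : ℝ) • ∑ i, (f (p + h • planeBasis i) + f (p + h • -planeBasis i))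

lemma stepMean_sub (h : ℝ) (f f' : Plane → F) (p p' : Plane) {m : ℝ}
    (hm : ∀ e, ‖f (p + e) - f' (p' + e)‖ ≤ m) : ‖stepMean h f p - stepMean h f' p'‖ ≤ m := by
  unfold stepMean
  rw [← smul_sub, norm_smul, Fin.sum_univ_two, Fin.sum_univ_two]
  have e : ∀ a b c d a' b' c' d' : F, a + b + (c + d) - (a' + b' + (c' + d')) =
    (a - a') + (b - b') + ((c - c') + (d - d')) := fun _ _ _ _ _ _ _ _ => by abel
  rw [e]
  have h1 := hm (h • planeBasis 0)
  have h2 := hm (h • -planeBasis 0)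
  have h3 := hm (h • planeBasis 1)
  have h4 := hm (h • -planeBasis 1)
  have h5 := norm_add_le_of_le (norm_add_le_of_le h1 h2) (norm_add_le_of_le h3 h4)
  rw [Real.norm_of_nonneg (by norm_num)]
  linarith

lemma norm_stepMean_le (h : ℝ) {f : Plane → F} {m : ℝ} (hm : ∀ x, ‖f x‖ ≤ m) (p : Plane) :
    ‖stepMean h f p‖ ≤ m := by
  have := stepMean_sub h f 0 p p (m := m) (fun e => by simpa using hm _)
  simpa [stepMean] using this

lemma TorusPeriodic.stepMean {f : Plane → F} (hf : TorusPeriodic f) (h : ℝ) :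
    TorusPeriodic (stepMean h f) := by
  intro x m
  simp only [_root_.stepMean, add_right_comm x (latticePoint m), hf _ m]

lemma hasFDerivAt_stepMean (h : ℝ) {f : Plane → F} {f' : Plane → Plane →L[ℝ] F}
    (hf : ∀ x, HasFDerivAt f (f' x) x) (x : Plane) :
    HasFDerivAt (stepMean h f) (stepMean h f' x) x := by
  unfold stepMean
  refine HasFDerivAt.const_smul (HasFDerivAt.fun_sum fun i _ => ?_) _
  have h1 : ∀ c, HasFDerivAt (fun x => f (x + c)) (f' (x + c)) x := fun c => by
    have := (hf (x + c)).comp x ((hasFDerivAt_id x).add_const c)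
    rwa [ContinuousLinearMap.comp_id] at this
  exact (h1 _).add (h1 _)

lemma continuous_stepMean (h : ℝ) {X : Type*} [TopologicalSpace X] {f : X → Plane → F}
    (hf : Continuous (Function.uncurry f)) {p : X → Plane} (hp : Continuous p) :
    Continuous fun a => stepMean h (f a) (p a) := by
  unfold stepMean
  refine Continuous.const_smul (continuous_finsetSum _ fun i _ => ?_) _
  have h1 : ∀ c, Continuous fun a => f a (p a + c) := fun c =>
    hf.comp (by fun_prop : Continuous fun a => (a, p a + c))
  exact (h1 _).add (h1 _)

end Step

/-! ### Lipschitz bounds and the extension of time beyond `[0, T]` -/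

lemma norm_sub_le_of_hasFDerivAt {F : Type*} [NormedAddCommGroup F] [NormedSpace ℝ F]
    {f : Plane → F} {f' : Plane → Plane →L[ℝ] F}
    (hf : ∀ x, HasFDerivAt f (f' x) x) {K : ℝ} (hK : ∀ x, ‖f' x‖ ≤ K) (x y : Plane) :
    ‖f x - f y‖ ≤ K * ‖x - y‖ :=
  convex_univ.norm_image_sub_le_of_norm_hasFDerivWithin_le
    (fun x _ => (hf x).hasFDerivWithinAt) (fun x _ => hK x) (mem_univ y) (mem_univ x)

/-- Moving the point amounts to translating `g`, so Lipschitz bounds pass through the convolution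
without differentiating the kernel. -/
lemma norm_biotSavartDeriv_sub_point_le {g : Plane → Plane →L[ℝ] ℝ} (hc : Continuous g) {M Z : ℝ}
    (hM : ∀ x, ‖g x‖ ≤ M) (hZ : ∀ x y, ‖g x - g y‖ ≤ Z * ‖x - y‖) (x y : Plane) :
    ‖biotSavartDeriv g x - biotSavartDeriv g y‖ ≤ kernelMass * (Z * ‖x - y‖) := by
  have e : biotSavartDeriv g y = biotSavartDeriv (fun z => g (z + (y - x))) x := by
    unfold biotSavartDeriv
    congr 1; funext z
    simp only [show x - z + (y - x) = y - z by abel]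
  rw [e]
  refine norm_biotSavartDeriv_sub_le hc (by fun_prop) hM (fun z => hM _) (fun z => ?_) x
  refine (hZ _ _).trans (le_of_eq ?_)
  congr 2; abel

/-- The time `s` projected onto `[0, T]`. -/
def clampTime (T s : ℝ) : ℝ := max 0 (min s T)

lemma clampTime_of_mem {T s : ℝ} (hs : s ∈ Icc 0 T) : clampTime T s = s := by
  rw [clampTime, min_eq_left hs.2, max_eq_right hs.1]

lemma clampTime_mem {T : ℝ} (hT : 0 ≤ T) (s : ℝ) : clampTime T s ∈ Icc 0 T :=
  ⟨le_max_left _ _, max_le hT (min_le_right _ _)⟩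

lemma continuous_clampTime (T : ℝ) : Continuous (clampTime T) := by
  unfold clampTime; fun_prop

/-! ### Existence for the vorticity equation of the scheme, by Picard iteration -/

section Picard

/-- The position after a jump, except for the random step. -/
def drift (ε : ℝ) (w : Plane → ℝ) (x : Plane) : Plane := x + ε • biotSavart w x

/-- The derivative of `drift`, when `g` is the derivative of `w`. -/
def driftDeriv (ε : ℝ) (g : Plane → Plane →L[ℝ] ℝ) (x : Plane) : Plane →L[ℝ] Plane :=
  ContinuousLinearMap.id ℝ Plane + ε • biotSavartDeriv g x

/-- The right-hand side of the mild equation of the vorticity. -/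
def picardRhs (ε h : ℝ) (w : Plane → ℝ) (x : Plane) : ℝ := ε⁻¹ • stepMean h w (drift ε w x)

/-- The derivative of `picardRhs`. -/
def picardRhsDeriv (ε h : ℝ) (g : Plane → Plane →L[ℝ] ℝ) (w : Plane → ℝ) (x : Plane) :
    Plane →L[ℝ] ℝ :=
  ε⁻¹ • (stepMean h g (drift ε w x)).comp (driftDeriv ε g x)

/-- The map whose fixed point is the vorticity of the scheme. -/
def picardMap (ε T h : ℝ) (w₀ : Plane → ℝ) (w : ℝ → Plane → ℝ) (s : ℝ) (x : Plane) : ℝ :=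
  mild ε T (w₀ x) (fun r => picardRhs ε h (w r) x) (clampTime T s)

/-- The derivative of `picardMap`. -/
def picardMapDeriv (ε T h : ℝ) (g₀ : Plane → Plane →L[ℝ] ℝ) (g : ℝ → Plane → Plane →L[ℝ] ℝ)
    (w : ℝ → Plane → ℝ) (s : ℝ) (x : Plane) : Plane →L[ℝ] ℝ :=
  mild ε T (g₀ x) (fun r => picardRhsDeriv ε h (g r) (w r) x) (clampTime T s)

/-- Scalar fields `w` with derivative `g`, with bounds `|w| ≤ M`, `|g| ≤ Y`, `Lip g ≤ Z`
depending on time. -/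
structure VorticityClass (T M : ℝ) (Y Z : ℝ → ℝ) (w : ℝ → Plane → ℝ)
    (g : ℝ → Plane → Plane →L[ℝ] ℝ) : Prop where
  continuous_fun : Continuous (Function.uncurry w)
  continuous_deriv : Continuous (Function.uncurry g)
  periodic_fun : ∀ s, TorusPeriodic (w s)
  periodic_deriv : ∀ s, TorusPeriodic (g s)
  hasFDerivAt : ∀ s x, HasFDerivAt (w s) (g s x) x
  bound_fun : ∀ s x, |w s x| ≤ M
  bound_deriv : ∀ s x, ‖g s x‖ ≤ Y (clampTime T s)
  lip_deriv : ∀ s x y, ‖g s x - g s y‖ ≤ Z (clampTime T s) * ‖x - y‖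

lemma norm_smul_sub_smul_le {F : Type*} [NormedAddCommGroup F] [NormedSpace ℝ F] {c m : ℝ}
    (hc : 0 ≤ c) {a b : F} (h : ‖a - b‖ ≤ m) : ‖c • a - c • b‖ ≤ c * m := by
  rw [← smul_sub, norm_smul, Real.norm_of_nonneg hc]
  gcongr

lemma norm_comp_sub_comp_le {P P' : Plane →L[ℝ] ℝ} {Q Q' : Plane →L[ℝ] Plane} {a b c d : ℝ}
    (h1 : ‖P - P'‖ ≤ a) (h2 : ‖Q - Q'‖ ≤ b) (h3 : ‖Q‖ ≤ c) (h4 : ‖P'‖ ≤ d) :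
    ‖P.comp Q - P'.comp Q'‖ ≤ a * c + d * b := by
  have e : P.comp Q - P'.comp Q' = (P - P').comp Q + P'.comp (Q - Q') := by
    ext v; simp
  have ha := (norm_nonneg _).trans h1
  have hd := (norm_nonneg _).trans h4
  rw [e]
  refine (norm_add_le _ _).trans (add_le_add ?_ ?_)
  · exact (ContinuousLinearMap.opNorm_comp_le _ _).trans (by gcongr)
  · exact (ContinuousLinearMap.opNorm_comp_le _ _).trans (by gcongr)

variable {ε T h M C A μ Z₀ : ℝ}

/-- The exponent in the bound of the vorticity gradient. -/
def gradExponent (C M A T r : ℝ) : ℝ := A * Real.exp (C * (1 + M) * (T - r))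

/-- The bound of the vorticity gradient. -/
def gradBound (C M A T r : ℝ) : ℝ := Real.exp (gradExponent C M A T r - 1)

/-- The bound of the velocity gradient. -/
def velocityGradBound (C M A T r : ℝ) : ℝ := C * (1 + M) * gradExponent C M A T r

/-- The equation behind it is `-Y' = C (1 + M) (1 + log Y) Y`. It is linear in `1 + log Y =
gradExponent`, so `Y` is a double exponential that never blows up: the logarithm in the gradient
estimate is what allows arbitrary `T`. -/
lemma hasDerivAt_gradBound (r : ℝ) :
    HasDerivAt (gradBound C M A T)
      (-(velocityGradBound C M A T r * gradBound C M A T r)) r := by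
  have h := ((hasDerivAt_mul_exp A (C * (1 + M)) T r).sub_const 1).exp
  refine h.congr_deriv ?_
  simp only [gradBound, velocityGradBound, gradExponent]; ring

lemma one_le_gradExponent (hC : 0 ≤ C) (hM : 0 ≤ M) (hA : 1 ≤ A) {r : ℝ} (hr : r ≤ T) :
    1 ≤ gradExponent C M A T r := by
  have : 1 ≤ Real.exp (C * (1 + M) * (T - r)) :=
    Real.one_le_exp (mul_nonneg (by positivity) (by linarith))
  exact one_le_mul_of_one_le_of_one_le hA this

lemma gradExponent_le (hC : 0 ≤ C) (hM : 0 ≤ M) (hA : 1 ≤ A) {r : ℝ} (hr : 0 ≤ r) :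
    gradExponent C M A T r ≤ gradExponent C M A T 0 := by
  unfold gradExponent
  have : 0 ≤ C * (1 + M) := by positivity
  gcongr

variable {w w' : ℝ → Plane → ℝ} {g g' : ℝ → Plane → Plane →L[ℝ] ℝ}
  {w₀ : Plane → ℝ} {g₀ : Plane → Plane →L[ℝ] ℝ} {Y Z : ℝ → ℝ}

lemma VorticityClass.continuous_slice (hw : VorticityClass T M Y Z w g) (s : ℝ) :
    Continuous (w s) :=
  hw.continuous_fun.comp (by fun_prop : Continuous fun x => (s, x))

lemma VorticityClass.continuous_deriv_slice (hw : VorticityClass T M Y Z w g) (s : ℝ) :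
    Continuous (g s) :=
  hw.continuous_deriv.comp (by fun_prop : Continuous fun x => (s, x))

lemma VorticityClass.continuous_drift (hw : VorticityClass T M Y Z w g) :
    Continuous (fun p : ℝ × Plane => drift ε (w p.1) p.2) := by
  have := continuous_biotSavart hw.continuous_fun hw.bound_fun
  unfold drift; fun_prop

lemma hasFDerivAt_drift {w : Plane → ℝ} {g : Plane → Plane →L[ℝ] ℝ}
    (hw : ∀ x, HasFDerivAt w (g x) x) (hg : Continuous g) {M M' : ℝ}
    (hM : ∀ x, |w x| ≤ M) (hM' : ∀ x, ‖g x‖ ≤ M') (x : Plane) :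
    HasFDerivAt (drift ε w) (driftDeriv ε g x) x :=
  (hasFDerivAt_id x).add ((hasFDerivAt_biotSavart hw hg hM hM' x).const_smul ε)

lemma hasFDerivAt_picardRhs {w : Plane → ℝ} {g : Plane → Plane →L[ℝ] ℝ}
    (hw : ∀ x, HasFDerivAt w (g x) x) (hg : Continuous g) {M M' : ℝ}
    (hM : ∀ x, |w x| ≤ M) (hM' : ∀ x, ‖g x‖ ≤ M') (x : Plane) :
    HasFDerivAt (picardRhs ε h w) (picardRhsDeriv ε h g w x) x :=
  (((hasFDerivAt_stepMean h hw (drift ε w x)).comp x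
    (hasFDerivAt_drift hw hg hM hM' x)).const_smul ε⁻¹)

lemma VorticityClass.continuous_picardRhs (hw : VorticityClass T M Y Z w g) :
    Continuous (fun p : ℝ × Plane => picardRhs ε h (w p.1) p.2) := by
  have h1 := continuous_stepMean h (X := ℝ × Plane) (f := fun p => w p.1)
    (hw.continuous_fun.comp (by fun_prop :
      Continuous fun q : (ℝ × Plane) × Plane => (q.1.1, q.2))) (hw.continuous_drift (ε := ε))
  exact h1.const_smul ε⁻¹

lemma norm_driftDeriv_le {g : Plane → Plane →L[ℝ] ℝ} {x : Plane} {b : ℝ} (hε : 0 ≤ ε)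
    (hb : ‖biotSavartDeriv g x‖ ≤ b) : ‖driftDeriv ε g x‖ ≤ 1 + ε * b := by
  refine (norm_add_le _ _).trans (add_le_add ContinuousLinearMap.norm_id_le ?_)
  rw [norm_smul, Real.norm_of_nonneg hε]
  gcongr

/-- The chain rule gives a factor `1 + ε b` from the drift; against the rate `ε⁻¹` it leaves the
growth rate `b`, independent of `ε`. -/
lemma norm_picardRhsDeriv_le {g : Plane → Plane →L[ℝ] ℝ} {w : Plane → ℝ} {x : Plane} {b y : ℝ}
    (hε : 0 < ε) (hb : ‖biotSavartDeriv g x‖ ≤ b) (hy : ∀ x, ‖g x‖ ≤ y) :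
    ‖picardRhsDeriv ε h g w x‖ ≤ ε⁻¹ * y + b * y := by
  have hy0 : 0 ≤ y := (norm_nonneg _).trans (hy 0)
  unfold picardRhsDeriv
  rw [norm_smul, Real.norm_of_nonneg (by positivity)]
  calc _ ≤ ε⁻¹ * (y * (1 + ε * b)) := by
        gcongr
        refine (ContinuousLinearMap.opNorm_comp_le _ _).trans ?_
        gcongr
        · exact norm_stepMean_le h hy _
        · exact norm_driftDeriv_le hε.le hb
    _ = _ := by field_simp

lemma VorticityClass.continuous_picardRhsDeriv (hw : VorticityClass T M Y Z w g) {Yb : ℝ}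
    (hY : ∀ s, Y (clampTime T s) ≤ Yb) :
    Continuous (fun p : ℝ × Plane => picardRhsDeriv ε h (g p.1) (w p.1) p.2) := by
  have h1 := continuous_stepMean h (X := ℝ × Plane) (f := fun p => g p.1)
    (hw.continuous_deriv.comp (by fun_prop :
      Continuous fun q : (ℝ × Plane) × Plane => (q.1.1, q.2))) (hw.continuous_drift (ε := ε))
  have h2 := continuous_biotSavartDeriv hw.continuous_deriv
    (fun s x => (hw.bound_deriv s x).trans (hY s))
  refine (h1.clm_comp (?_ : Continuous fun p : ℝ × Plane => driftDeriv ε (g p.1) p.2)).const_smul ε⁻¹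
  unfold driftDeriv
  fun_prop

set_option maxHeartbeats 400000 in
/-- The bounds of the class are preserved by the Picard map. -/
lemma vorticityClass_picardMap (hε : 0 < ε) (hε1 : ε ≤ 1) (hT : 0 ≤ T) (hM : 0 ≤ M)
    (hC : 0 ≤ C) (hA : 1 ≤ A) (hZ₀ : 0 ≤ Z₀)
    (hlog : ∀ (w : Plane → ℝ) (g : Plane → Plane →L[ℝ] ℝ) (M Y : ℝ), TorusPeriodic g →
      (∀ x, HasFDerivAt w (g x) x) → Continuous g → (∀ x, |w x| ≤ M) → (∀ x, ‖g x‖ ≤ Y) →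
      1 ≤ Y → ∀ x, ‖biotSavartDeriv g x‖ ≤ C * (1 + M) * (1 + Real.log Y))
    (hμ : 2 * velocityGradBound C M A T 0 + velocityGradBound C M A T 0 ^ 2 +
      gradBound C M A T 0 * kernelMass ≤ μ)
    (hw₀d : ∀ x, HasFDerivAt w₀ (g₀ x) x) (hg₀c : Continuous g₀) (hw₀p : TorusPeriodic w₀)
    (hg₀p : TorusPeriodic g₀) (hw₀M : ∀ x, |w₀ x| ≤ M) (hg₀A : ∀ x, ‖g₀ x‖ ≤ Real.exp (A - 1))
    (hg₀Z : ∀ x y, ‖g₀ x - g₀ y‖ ≤ Z₀ * ‖x - y‖)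
    (hw : VorticityClass T M (gradBound C M A T) (fun r => Z₀ * Real.exp (μ * (T - r))) w g) :
    VorticityClass T M (gradBound C M A T) (fun r => Z₀ * Real.exp (μ * (T - r)))
      (picardMap ε T h w₀ w) (picardMapDeriv ε T h g₀ g w) := by
  have hmem := clampTime_mem hT
  have hw₀c : Continuous w₀ := continuous_iff_continuousAt.2 fun x => (hw₀d x).continuousAt
  set Yb := gradBound C M A T 0
  set bb := velocityGradBound C M A T 0
  have hYb : ∀ r, 0 ≤ r → gradBound C M A T r ≤ Yb := fun r hr =>
    Real.exp_le_exp.2 (sub_le_sub_right (gradExponent_le hC hM hA hr) 1)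
  have hbb : ∀ r, 0 ≤ r → velocityGradBound C M A T r ≤ bb := fun r hr =>
    mul_le_mul_of_nonneg_left (gradExponent_le hC hM hA hr) (by positivity)
  -- Since `1 + log (gradBound) = gradExponent`, the logarithmic estimate yields exactly the rate in
  -- the equation solved by `gradBound`, which closes the induction on the iterates.
  have hb : ∀ r x, ‖biotSavartDeriv (g r) x‖ ≤ velocityGradBound C M A T (clampTime T r) := by
    intro r x
    have h1 := hlog (w r) (g r) M (gradBound C M A T (clampTime T r)) (hw.periodic_deriv r)
      (hw.hasFDerivAt r) (hw.continuous_deriv_slice r) (hw.bound_fun r) (hw.bound_deriv r)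
      (Real.one_le_exp (by linarith [one_le_gradExponent hC hM hA (hmem r).2])) x
    rw [gradBound, Real.log_exp] at h1
    refine h1.trans (le_of_eq ?_)
    unfold velocityGradBound; ring
  have hYs : ∀ s, gradBound C M A T (clampTime T s) ≤ Yb := fun s => hYb _ (hmem s).1
  have hcB := hw.continuous_picardRhs (ε := ε) (h := h)
  have hcB' := hw.continuous_picardRhsDeriv (ε := ε) (h := h) hYs
  have hbb0 : 0 ≤ bb := (norm_nonneg _).trans ((hb 0 0).trans (hbb _ (hmem 0).1))
  have hYb0 : 0 < Yb := Real.exp_pos _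
  have hB'bound : ∀ r x, ‖picardRhsDeriv ε h (g r) (w r) x‖ ≤ ε⁻¹ * Yb + bb * Yb := fun r x =>
    norm_picardRhsDeriv_le hε ((hb r x).trans (hbb _ (hmem r).1))
      fun x => (hw.bound_deriv r x).trans (hYs r)
  refine ⟨?_, ?_, fun s x m => ?_, fun s x m => ?_, fun s x => ?_, fun s x => ?_, fun s x => ?_,
    fun s x y => ?_⟩
  · have hq : Continuous fun q : ℝ × (ℝ × Plane) => (q.1, q.2.2) := by fun_prop
    have hc := hcB.comp hq
    exact continuous_mild (X := ℝ × Plane) (b := fun p => w₀ p.2)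
      (B := fun r p => picardRhs ε h (w r) p.2) (hw₀c.comp continuous_snd) hc
      ((continuous_clampTime T).comp continuous_fst)
  · have hq : Continuous fun q : ℝ × (ℝ × Plane) => (q.1, q.2.2) := by fun_prop
    have hc := hcB'.comp hq
    exact continuous_mild (X := ℝ × Plane) (b := fun p => g₀ p.2)
      (B := fun r p => picardRhsDeriv ε h (g r) (w r) p.2) (hg₀c.comp continuous_snd) hc
      ((continuous_clampTime T).comp continuous_fst)
  · have e : ∀ r, picardRhs ε h (w r) (x + latticePoint m) = picardRhs ε h (w r) x := fun r => by
      unfold picardRhs drift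
      rw [(hw.periodic_fun r).biotSavart, add_right_comm, (hw.periodic_fun r).stepMean]
    simp only [picardMap, e, hw₀p x m]
  · have e : ∀ r, picardRhsDeriv ε h (g r) (w r) (x + latticePoint m)
        = picardRhsDeriv ε h (g r) (w r) x := fun r => by
      have e2 : biotSavartDeriv (g r) (x + latticePoint m) = biotSavartDeriv (g r) x := by
        unfold biotSavartDeriv
        congr 1; funext y
        rw [add_sub_right_comm, hw.periodic_deriv r]
      unfold picardRhsDeriv drift driftDeriv
      rw [(hw.periodic_fun r).biotSavart, add_right_comm, (hw.periodic_deriv r).stepMean, e2]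
    simp only [picardMapDeriv, e, hg₀p x m]
  · exact hasFDerivAt_mild (B := fun r => picardRhs ε h (w r))
      (B' := fun r => picardRhsDeriv ε h (g r) (w r)) hε (hmem s).2 hw₀d hcB hcB' (fun r x => hasFDerivAt_picardRhs
      (hw.hasFDerivAt r) (hw.continuous_deriv_slice r) (hw.bound_fun r)
      (fun x => (hw.bound_deriv r x).trans (hYs r)) x) hB'bound x
  · refine norm_mild_le_const (b := w₀ x) (M := M) (hmem s).2 (hw₀M x) fun r _ => ?_
    unfold picardRhs
    rw [norm_smul, Real.norm_of_nonneg (by positivity)]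
    gcongr
    exact norm_stepMean_le h (hw.bound_fun r) _
  · have hyc : Continuous (gradBound C M A T) := by unfold gradBound gradExponent; fun_prop
    refine norm_mild_le (y := gradBound C M A T)
      (z := fun r => velocityGradBound C M A T r * gradBound C M A T r) (hmem s).2
      hyc.continuousOn (fun r _ => hasDerivAt_gradBound r)
      (by unfold velocityGradBound gradExponent; fun_prop) ?_ fun r hr => ?_
    · simpa [gradBound, gradExponent] using hg₀A x
    · have hr' : clampTime T r = r := clampTime_of_mem ⟨(hmem s).1.trans hr.1, hr.2⟩
      have h1 := hb r x
      have h2 := hw.bound_deriv r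
      rw [hr'] at h1 h2
      exact norm_picardRhsDeriv_le hε h1 h2
  · have hcx : ∀ x, Continuous fun r => picardRhsDeriv ε h (g r) (w r) x := fun x => by
      have hq : Continuous fun r : ℝ => (r, x) := by fun_prop
      have := hcB'.comp hq
      exact this
    simp only [picardMapDeriv]
    rw [mild_sub (hcx x) (hcx y)]
    have e : Z₀ * Real.exp (μ * (T - clampTime T s)) * ‖x - y‖
      = (Z₀ * ‖x - y‖) * Real.exp (μ * (T - clampTime T s)) := by ring
    rw [e]
    refine norm_mild_le_exp (hmem s).2 (hg₀Z x y) fun r hr => ?_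
    have hr0 : 0 ≤ r := (hmem s).1.trans hr.1
    have hr' : clampTime T r = r := clampTime_of_mem ⟨hr0, hr.2⟩
    set Zr := Z₀ * Real.exp (μ * (T - r))
    have hZr0 : 0 ≤ Zr := by positivity
    have hbr : ∀ x, ‖biotSavartDeriv (g r) x‖ ≤ bb := fun x => (hb r x).trans (hbb _ (hmem r).1)
    have hgr : ∀ x, ‖g r x‖ ≤ Yb := fun x => (hw.bound_deriv r x).trans (hYs r)
    have hlip : ∀ x y, ‖g r x - g r y‖ ≤ Zr * ‖x - y‖ := fun x y => by
      have := hw.lip_deriv r x y; rwa [hr'] at this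
    have hdl : ∀ x y, ‖drift ε (w r) x - drift ε (w r) y‖ ≤ (1 + ε * bb) * ‖x - y‖ :=
      norm_sub_le_of_hasFDerivAt (hasFDerivAt_drift (hw.hasFDerivAt r)
        (hw.continuous_deriv_slice r) (hw.bound_fun r) hgr)
        (fun x => norm_driftDeriv_le hε.le (hbr x))
    have h1 : ‖stepMean h (g r) (drift ε (w r) x) - stepMean h (g r) (drift ε (w r) y)‖
        ≤ Zr * ((1 + ε * bb) * ‖x - y‖) := by
      refine stepMean_sub h _ _ _ _ fun e => (hlip _ _).trans ?_
      rw [add_sub_add_right_eq_sub]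
      gcongr
      exact hdl x y
    have h2 : ‖driftDeriv ε (g r) x - driftDeriv ε (g r) y‖
        ≤ ε * (kernelMass * (Zr * ‖x - y‖)) := by
      unfold driftDeriv
      rw [add_sub_add_left_eq_sub]
      exact norm_smul_sub_smul_le hε.le
        (norm_biotSavartDeriv_sub_point_le (hw.continuous_deriv_slice r) hgr hlip x y)
    have h3 := norm_driftDeriv_le hε.le (hbr x)
    have h4 : ‖stepMean h (g r) (drift ε (w r) y)‖ ≤ Yb := norm_stepMean_le h hgr _
    unfold picardRhsDeriv
    have hk := kernelMass_nonneg
    have h5 := norm_comp_sub_comp_le h1 h2 h3 h4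
    refine (norm_smul_sub_smul_le (by positivity) h5).trans ?_
    -- The terms `2 bb + ε bb²` come from the factor `(1 + ε bb)²` (the drift moves the points and
    -- its derivative multiplies), and `Yb * kernelMass` from the variation of the derivative of the
    -- drift. `ε ≤ 1` makes the rate uniform.
    calc _ = (ε⁻¹ + (2 * bb + ε * bb ^ 2 + Yb * kernelMass)) * (Zr * ‖x - y‖) := by
          field_simp; ring
      _ ≤ (ε⁻¹ + μ) * (Zr * ‖x - y‖) := by
          gcongr
          refine le_trans ?_ hμ
          have : ε * bb ^ 2 ≤ 1 * bb ^ 2 := by gcongr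
          linarith
      _ = _ := by ring

end Picard

/-! ### Contraction of the Picard map and its fixed point -/

section PicardLimit

variable {ε T h M : ℝ} {w w' : ℝ → Plane → ℝ} {g g' : ℝ → Plane → Plane →L[ℝ] ℝ}
  {w₀ : Plane → ℝ} {g₀ : Plane → Plane →L[ℝ] ℝ} {Y Z : ℝ → ℝ}

/-- The rate for which the Picard map is a contraction. -/
def picardRate (ε Yb Zb : ℝ) : ℝ :=
  ε⁻¹ + 2 * (kernelMass * Yb + Zb * kernelMass * (1 + kernelMass * Yb) + Yb * kernelMass)

/-- The Picard map is a contraction for a weighted norm. -/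
lemma picardMap_sub_le (hε : 0 < ε) (hε1 : ε ≤ 1) (hT : 0 ≤ T)
    (hw : VorticityClass T M Y Z w g) (hw' : VorticityClass T M Y Z w' g') {Yb Zb m : ℝ}
    (hY : ∀ s, Y (clampTime T s) ≤ Yb) (hZ : ∀ s, Z (clampTime T s) ≤ Zb) (hZb : 0 ≤ Zb)
    (hm : 0 ≤ m)
    (h1 : ∀ s x, |w s x - w' s x| ≤ m * Real.exp (picardRate ε Yb Zb * (T - clampTime T s)))
    (h2 : ∀ s x, ‖g s x - g' s x‖ ≤ m * Real.exp (picardRate ε Yb Zb * (T - clampTime T s))) :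
    (∀ s x, |picardMap ε T h w₀ w s x - picardMap ε T h w₀ w' s x| ≤
      m / 2 * Real.exp (picardRate ε Yb Zb * (T - clampTime T s))) ∧
    ∀ s x, ‖picardMapDeriv ε T h g₀ g w s x - picardMapDeriv ε T h g₀ g' w' s x‖ ≤
      m / 2 * Real.exp (picardRate ε Yb Zb * (T - clampTime T s)) := by
  have hk := kernelMass_nonneg
  have hmem := clampTime_mem hT
  have hg : ∀ r x, ‖g r x‖ ≤ Yb := fun r x => (hw.bound_deriv r x).trans (hY r)
  have hg' : ∀ r x, ‖g' r x‖ ≤ Yb := fun r x => (hw'.bound_deriv r x).trans (hY r)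
  have hYb : 0 ≤ Yb := (norm_nonneg _).trans (hg 0 0)
  have hlip : ∀ r x y, ‖g r x - g r y‖ ≤ Zb * ‖x - y‖ := fun r x y =>
    (hw.lip_deriv r x y).trans (by gcongr; exact hZ r)
  have hdrift : ∀ r x a, (∀ x, |w r x - w' r x| ≤ a) →
      ‖drift ε (w r) x - drift ε (w' r) x‖ ≤ ε * (kernelMass * a) := by
    intro r x a ha
    unfold drift
    rw [add_sub_add_left_eq_sub]
    exact norm_smul_sub_smul_le hε.le (norm_biotSavart_sub_le (hw.continuous_slice r)
      (hw'.continuous_slice r) (hw.bound_fun r) (hw'.bound_fun r) ha x)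
  have hc1 := hw.continuous_picardRhs (ε := ε) (h := h)
  have hc1' := hw'.continuous_picardRhs (ε := ε) (h := h)
  have hc2 := hw.continuous_picardRhsDeriv (ε := ε) (h := h) hY
  have hc2' := hw'.continuous_picardRhsDeriv (ε := ε) (h := h) hY
  set l := picardRate ε Yb Zb
  have hclamp : ∀ s, ∀ r ∈ Icc (clampTime T s) T, clampTime T r = r := fun s r hr =>
    clampTime_of_mem ⟨(hmem s).1.trans hr.1, hr.2⟩
  refine ⟨fun s x => ?_, fun s x => ?_⟩
  · have hq : Continuous fun r : ℝ => (r, x) := by fun_prop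
    have d1 := hc1.comp hq
    have d2 := hc1'.comp hq
    simp only [Function.comp_def] at d1 d2
    unfold picardMap
    rw [mild_sub d1 d2, sub_self]
    refine norm_mild_le_exp (b := (0 : ℝ)) (hmem s).2 (by simpa using (by positivity : 0 ≤ m / 2))
      fun r hr => ?_
    have e1 := h1 r
    rw [hclamp s r hr] at e1
    set a := m * Real.exp (l * (T - r))
    have ha : 0 ≤ a := by positivity
    have hstep : ‖stepMean h (w r) (drift ε (w r) x) - stepMean h (w' r) (drift ε (w' r) x)‖
        ≤ Yb * (ε * (kernelMass * a)) + a := by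
      refine stepMean_sub h _ _ _ _ fun e => ?_
      have e2 := norm_sub_le_of_hasFDerivAt (hw.hasFDerivAt r) (hg r)
        (drift ε (w r) x + e) (drift ε (w' r) x + e)
      rw [add_sub_add_right_eq_sub] at e2
      have e3 := e1 (drift ε (w' r) x + e)
      have e4 := hdrift r x a e1
      calc _ = ‖(w r (drift ε (w r) x + e) - w r (drift ε (w' r) x + e)) +
            (w r (drift ε (w' r) x + e) - w' r (drift ε (w' r) x + e))‖ := by
            congr 1; abel
        _ ≤ _ := norm_add_le_of_le (e2.trans (by gcongr)) e3
    refine (norm_smul_sub_smul_le (by positivity) hstep).trans ?_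
    -- `picardRate` is chosen so that `(ε⁻¹ + l)/2` is `ε⁻¹` plus the constants of both estimates;
    -- this produces the contraction factor `1/2`.
    have : l = ε⁻¹ + 2 * (kernelMass * Yb + Zb * kernelMass * (1 + kernelMass * Yb)
      + Yb * kernelMass) := rfl
    have e5 : (ε⁻¹ + l) * (m / 2 * Real.exp (l * (T - r))) = (ε⁻¹ + l) / 2 * a := by
      simp only [a]; ring
    rw [e5, this]
    have e6 : ε⁻¹ * (Yb * (ε * (kernelMass * a)) + a) = (ε⁻¹ + Yb * kernelMass) * a := by
      field_simp; ring
    rw [e6]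
    have p1 : 0 ≤ kernelMass * Yb := by positivity
    have p2 : 0 ≤ Zb * kernelMass * (1 + kernelMass * Yb) := by positivity
    gcongr
    linarith
  · have hq : Continuous fun r : ℝ => (r, x) := by fun_prop
    have d1 := hc2.comp hq
    have d2 := hc2'.comp hq
    simp only [Function.comp_def] at d1 d2
    unfold picardMapDeriv
    rw [mild_sub d1 d2, sub_self]
    refine norm_mild_le_exp (b := (0 : Plane →L[ℝ] ℝ)) (hmem s).2
      (by simpa using (by positivity : 0 ≤ m / 2)) fun r hr => ?_
    have e1 := h1 r
    have e2 := h2 r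
    rw [hclamp s r hr] at e1 e2
    set a := m * Real.exp (l * (T - r))
    have ha : 0 ≤ a := by positivity
    have hstep : ‖stepMean h (g r) (drift ε (w r) x) - stepMean h (g' r) (drift ε (w' r) x)‖
        ≤ Zb * (ε * (kernelMass * a)) + a := by
      -- The gradients are evaluated after two different drifts. Here the Lipschitz bound on the
      -- gradient is indispensable, which is why the iteration lives in `C^{1,1}` although it
      -- contracts only in `C¹`.
      refine stepMean_sub h _ _ _ _ fun e => ?_
      have e2' := hlip r (drift ε (w r) x + e) (drift ε (w' r) x + e)
      rw [add_sub_add_right_eq_sub] at e2'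
      have e3 := e2 (drift ε (w' r) x + e)
      have e4 := hdrift r x a e1
      calc _ = ‖(g r (drift ε (w r) x + e) - g r (drift ε (w' r) x + e)) +
            (g r (drift ε (w' r) x + e) - g' r (drift ε (w' r) x + e))‖ := by
            congr 1; abel
        _ ≤ _ := norm_add_le_of_le (e2'.trans (by gcongr)) e3
    have hQ : ‖driftDeriv ε (g r) x - driftDeriv ε (g' r) x‖ ≤ ε * (kernelMass * a) := by
      unfold driftDeriv
      rw [add_sub_add_left_eq_sub]
      exact norm_smul_sub_smul_le hε.le (norm_biotSavartDeriv_sub_le (hw.continuous_deriv_slice r)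
        (hw'.continuous_deriv_slice r) (hg r) (hg' r) e2 x)
    have h3 : ‖driftDeriv ε (g r) x‖ ≤ 1 + ε * (kernelMass * Yb) :=
      norm_driftDeriv_le hε.le (norm_biotSavartDeriv_le (hg r) x)
    have h4 : ‖stepMean h (g' r) (drift ε (w' r) x)‖ ≤ Yb := norm_stepMean_le h (hg' r) _
    refine (norm_smul_sub_smul_le (by positivity) (norm_comp_sub_comp_le hstep hQ h3 h4)).trans ?_
    have : l = ε⁻¹ + 2 * (kernelMass * Yb + Zb * kernelMass * (1 + kernelMass * Yb)
      + Yb * kernelMass) := rfl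
    have e5 : (ε⁻¹ + l) * (m / 2 * Real.exp (l * (T - r))) = (ε⁻¹ + l) / 2 * a := by
      simp only [a]; ring
    have e6 : ε⁻¹ * ((Zb * (ε * (kernelMass * a)) + a) * (1 + ε * (kernelMass * Yb)) +
        Yb * (ε * (kernelMass * a))) =
        (ε⁻¹ + (kernelMass * Yb + Zb * kernelMass * (1 + ε * (kernelMass * Yb))
          + Yb * kernelMass)) * a := by
      field_simp; ring
    rw [e5, e6, this]
    have p3 : Zb * kernelMass * (1 + ε * (kernelMass * Yb))
        ≤ Zb * kernelMass * (1 + kernelMass * Yb) := by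
      have : ε * (kernelMass * Yb) ≤ 1 * (kernelMass * Yb) := by gcongr
      have : 0 ≤ Zb * kernelMass := by positivity
      nlinarith
    gcongr
    linarith

lemma exists_limit_of_dist_le_geometric {X F : Type*} [NormedAddCommGroup F] [CompleteSpace F]
    {f : ℕ → X → F} {D : ℝ} (hf : ∀ n x, ‖f (n + 1) x - f n x‖ ≤ D * (1 / 2) ^ n) :
    ∃ F : X → F, ∀ n x, ‖f n x - F x‖ ≤ 2 * D * (1 / 2) ^ n := by
  have hd : ∀ x n, dist (f n x) (f (n + 1) x) ≤ D * (1 / 2) ^ n := fun x n => by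
    rw [dist_comm, dist_eq_norm]; exact hf n x
  choose F hF using fun x =>
    cauchySeq_tendsto_of_complete (cauchySeq_of_le_geometric _ _ (by norm_num) (hd x))
  refine ⟨F, fun n x => ?_⟩
  have := dist_le_of_le_geometric_of_tendsto _ _ (by norm_num) (hd x) (hF x) n
  rw [dist_eq_norm] at this
  refine this.trans (le_of_eq ?_)
  ring

lemma tendsto_const_mul_half_pow (D : ℝ) : Tendsto (fun n : ℕ => D * (1 / 2 : ℝ) ^ n) atTop (𝓝 0) := by
  simpa using (tendsto_pow_atTop_nhds_zero_of_lt_one (r := (1 / 2 : ℝ)) (by norm_num)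
    (by norm_num)).const_mul D

lemma tendstoUniformly_of_norm_le_geometric {X F : Type*} [NormedAddCommGroup F]
    {f : ℕ → X → F} {G : X → F} {D : ℝ} (hf : ∀ n x, ‖f n x - G x‖ ≤ D * (1 / 2) ^ n) :
    TendstoUniformly f G atTop := by
  rw [Metric.tendstoUniformly_iff]
  intro e he
  filter_upwards [(tendsto_const_mul_half_pow D).eventually (gt_mem_nhds he)] with n hn x
  rw [dist_comm, dist_eq_norm]
  exact (hf n x).trans_lt hn

/-- The class is stable under uniform limits. -/
lemma VorticityClass.of_limit {wn : ℕ → ℝ → Plane → ℝ} {gn : ℕ → ℝ → Plane → Plane →L[ℝ] ℝ}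
    (hn : ∀ n, VorticityClass T M Y Z (wn n) (gn n)) {D : ℝ}
    (h1 : ∀ n s x, ‖wn n s x - w s x‖ ≤ D * (1 / 2) ^ n)
    (h2 : ∀ n s x, ‖gn n s x - g s x‖ ≤ D * (1 / 2) ^ n) : VorticityClass T M Y Z w g := by
  have u1 : TendstoUniformly (fun n => Function.uncurry (wn n)) (Function.uncurry w) atTop :=
    tendstoUniformly_of_norm_le_geometric fun n p => h1 n p.1 p.2
  have u2 : TendstoUniformly (fun n => Function.uncurry (gn n)) (Function.uncurry g) atTop :=
    tendstoUniformly_of_norm_le_geometric fun n p => h2 n p.1 p.2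
  have t1 : ∀ s x, Tendsto (fun n => wn n s x) atTop (𝓝 (w s x)) := fun s x =>
    u1.tendsto_at (s, x)
  have t2 : ∀ s x, Tendsto (fun n => gn n s x) atTop (𝓝 (g s x)) := fun s x =>
    u2.tendsto_at (s, x)
  refine ⟨u1.continuous (Frequently.of_forall fun n => (hn n).continuous_fun),
    u2.continuous (Frequently.of_forall fun n => (hn n).continuous_deriv), fun s x m => ?_,
    fun s x m => ?_, fun s x => ?_, fun s x => ?_, fun s x => ?_, fun s x y => ?_⟩
  · exact tendsto_nhds_unique (t1 _ _) (by simpa only [(hn _).periodic_fun s x m] using t1 s x)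
  · exact tendsto_nhds_unique (t2 _ _) (by simpa only [(hn _).periodic_deriv s x m] using t2 s x)
  · exact hasFDerivAt_of_tendstoUniformly
      (tendstoUniformly_of_norm_le_geometric fun n x => h2 n s x)
      (fun n x => (hn n).hasFDerivAt s x) (t1 s) x
  · exact le_of_tendsto (t1 s x).abs (Eventually.of_forall fun n => (hn n).bound_fun s x)
  · exact le_of_tendsto (t2 s x).norm (Eventually.of_forall fun n => (hn n).bound_deriv s x)
  · exact le_of_tendsto ((t2 s x).sub (t2 s y)).norm
      (Eventually.of_forall fun n => (hn n).lip_deriv s x y)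

/-- Existence of a solution of the mild vorticity equation of the scheme. -/
theorem exists_mild_vorticity (hε : 0 < ε) (hε1 : ε ≤ 1) (hT : 0 ≤ T) (h : ℝ)
    (hw₀ : ContDiff ℝ 2 w₀) (hp : TorusPeriodic w₀) :
    ∃ (M Yb : ℝ) (Z : ℝ → ℝ) (w : ℝ → Plane → ℝ) (g : ℝ → Plane → Plane →L[ℝ] ℝ),
      VorticityClass T M (fun _ => Yb) Z w g ∧ ∀ s ∈ Icc 0 T, ∀ x,
        w s x = mild ε T (w₀ x) (fun r => picardRhs ε h (w r) x) s := by
  obtain ⟨C, hC, hlog⟩ := exists_norm_biotSavartDeriv_le_log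
  set g₀ := fderiv ℝ w₀
  have hg₀cd : ContDiff ℝ 1 g₀ := hw₀.fderiv_right (by norm_num)
  have hd₀ : ∀ x, HasFDerivAt w₀ (g₀ x) x := fun x =>
    (hw₀.differentiable (by norm_num) x).hasFDerivAt
  have hd₁ : ∀ x, HasFDerivAt g₀ (fderiv ℝ g₀ x) x := fun x =>
    (hg₀cd.differentiable (by norm_num) x).hasFDerivAt
  obtain ⟨M, hM0, hM⟩ := hp.exists_norm_le hw₀.continuous
  obtain ⟨B, hB0, hB⟩ := hp.fderiv.exists_norm_le hg₀cd.continuous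
  obtain ⟨Z₀, hZ0, hZ₀⟩ := hp.fderiv.fderiv.exists_norm_le (hg₀cd.continuous_fderiv one_ne_zero)
  -- Then `exp (A - 1) = exp B ≥ B`, so the terminal gradient lies below the terminal value of
  -- `gradBound`, and `A ≥ 1`.
  set A := 1 + B
  have hA : 1 ≤ A := by simp only [A]; linarith
  have hgA : ∀ x, ‖g₀ x‖ ≤ Real.exp (A - 1) := fun x => (hB x).trans (by
    have := Real.add_one_le_exp B
    simp only [A, add_sub_cancel_left]; linarith)
  set Yb := gradBound C M A T 0
  set μ := 2 * velocityGradBound C M A T 0 + velocityGradBound C M A T 0 ^ 2 + Yb * kernelMass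
  set Z : ℝ → ℝ := fun r => Z₀ * Real.exp (μ * (T - r))
  set Zb := Z₀ * Real.exp (μ * T)
  have hmem := clampTime_mem hT
  have hb0 : 0 ≤ velocityGradBound C M A T 0 := by
    unfold velocityGradBound gradExponent; positivity
  have hμ0 : 0 ≤ μ := by
    have : 0 < Yb := Real.exp_pos _
    have := kernelMass_nonneg
    positivity
  have hY : ∀ s, gradBound C M A T (clampTime T s) ≤ Yb := fun s =>
    Real.exp_le_exp.2 (sub_le_sub_right (gradExponent_le hC.le hM0 hA (hmem s).1) 1)
  have hZ : ∀ s, Z (clampTime T s) ≤ Zb := fun s => by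
    simp only [Z, Zb]; gcongr; linarith [(hmem s).1]
  have hZle : ∀ s, Z₀ ≤ Z (clampTime T s) := fun s => by
    have : 1 ≤ Real.exp (μ * (T - clampTime T s)) :=
      Real.one_le_exp (mul_nonneg hμ0 (by linarith [(hmem s).2]))
    simp only [Z]; nlinarith
  have hYle : ∀ s, Real.exp (A - 1) ≤ gradBound C M A T (clampTime T s) := fun s => by
    refine Real.exp_le_exp.2 (sub_le_sub_right ?_ 1)
    have : 1 ≤ Real.exp (C * (1 + M) * (T - clampTime T s)) :=
      Real.one_le_exp (mul_nonneg (by positivity) (by linarith [(hmem s).2]))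
    unfold gradExponent; nlinarith
  -- The derivative is iterated along with the function, starting from the time-independent pair, so
  -- that both have uniform limits.
  set it : ℕ → (ℝ → Plane → ℝ) × (ℝ → Plane → Plane →L[ℝ] ℝ) := fun n =>
    (fun q => (picardMap ε T h w₀ q.1, picardMapDeriv ε T h g₀ q.2 q.1))^[n]
      (fun _ => w₀, fun _ => g₀)
  have hsucc : ∀ n, it (n + 1) = (picardMap ε T h w₀ (it n).1,
      picardMapDeriv ε T h g₀ (it n).2 (it n).1) := fun n => by
    simp only [it, Function.iterate_succ_apply']
  have hs1 : ∀ n, (it (n + 1)).1 = picardMap ε T h w₀ (it n).1 := fun n => by rw [hsucc]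
  have hs2 : ∀ n, (it (n + 1)).2 = picardMapDeriv ε T h g₀ (it n).2 (it n).1 := fun n => by
    rw [hsucc]
  have hclass : ∀ n, VorticityClass T M (gradBound C M A T) Z (it n).1 (it n).2 := by
    intro n
    induction n with
    | zero =>
      refine ⟨hw₀.continuous.comp continuous_snd, hg₀cd.continuous.comp continuous_snd,
        fun _ => hp, fun _ => hp.fderiv, fun _ => hd₀, fun _ => hM,
        fun s x => (hgA x).trans (hYle s), fun s x y => ?_⟩
      refine (norm_sub_le_of_hasFDerivAt hd₁ hZ₀ x y).trans ?_
      gcongr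
      exact hZle s
    | succ n ih =>
      rw [hsucc]
      exact vorticityClass_picardMap hε hε1 hT hM0 hC.le hA hZ0 hlog le_rfl hd₀ hg₀cd.continuous
        hp hp.fderiv hM hgA (fun x y => norm_sub_le_of_hasFDerivAt hd₁ hZ₀ x y) ih
  set l := picardRate ε Yb Zb
  have hZb0 : 0 ≤ Zb := by positivity
  have hYb0 : 0 < Yb := Real.exp_pos _
  have hl : 0 ≤ l := by
    have := kernelMass_nonneg
    simp only [l, picardRate]; positivity
  set m := 2 * M + 2 * Yb
  have hm : 0 ≤ m := by positivity
  have hE : ∀ s, 1 ≤ Real.exp (l * (T - clampTime T s)) := fun s =>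
    Real.one_le_exp (mul_nonneg hl (by linarith [(hmem s).2]))
  have hE' : ∀ s, Real.exp (l * (T - clampTime T s)) ≤ Real.exp (l * T) := fun s => by
    gcongr; linarith [(hmem s).1]
  have hdiff : ∀ n, (∀ s x, |(it (n + 1)).1 s x - (it n).1 s x| ≤
        m * (1 / 2) ^ n * Real.exp (l * (T - clampTime T s))) ∧
      ∀ s x, ‖(it (n + 1)).2 s x - (it n).2 s x‖ ≤
        m * (1 / 2) ^ n * Real.exp (l * (T - clampTime T s)) := by
    intro n
    induction n with
    | zero =>
      refine ⟨fun s x => ?_, fun s x => ?_⟩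
      · have := (abs_sub _ _).trans (add_le_add ((hclass 1).bound_fun s x) ((hclass 0).bound_fun s x))
        have h2 := hE s
        rw [pow_zero, mul_one]
        have : m * 1 ≤ m * Real.exp (l * (T - clampTime T s)) := by gcongr
        simp only [m] at *
        linarith
      · have := norm_sub_le_of_le (((hclass 1).bound_deriv s x).trans (hY s))
          (((hclass 0).bound_deriv s x).trans (hY s))
        have h2 := hE s
        rw [pow_zero, mul_one]
        have : m * 1 ≤ m * Real.exp (l * (T - clampTime T s)) := by gcongr
        simp only [m] at *
        linarith
    | succ n ih =>
      have := picardMap_sub_le (h := h) (w₀ := w₀) (g₀ := g₀) hε hε1 hT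
        (hclass (n + 1)) (hclass n) hY hZ hZb0 (by positivity) ih.1 ih.2
      rw [← hs1 (n + 1), ← hs2 (n + 1), ← hs1 n, ← hs2 n] at this
      rw [pow_succ, show m * ((1 / 2) ^ n * (1 / 2)) = m * (1 / 2) ^ n / 2 by ring]
      exact this
  set D := m * Real.exp (l * T)
  obtain ⟨w, hw⟩ := exists_limit_of_dist_le_geometric
    (f := fun n (p : ℝ × Plane) => (it n).1 p.1 p.2) (D := D) (fun n p =>
      ((hdiff n).1 p.1 p.2).trans (by
        simp only [D]
        calc _ ≤ m * (1 / 2) ^ n * Real.exp (l * T) := by gcongr; linarith [(hmem p.1).1]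
          _ = _ := by ring))
  obtain ⟨g, hg⟩ := exists_limit_of_dist_le_geometric
    (f := fun n (p : ℝ × Plane) => (it n).2 p.1 p.2) (D := D) (fun n p =>
      ((hdiff n).2 p.1 p.2).trans (by
        simp only [D]
        calc _ ≤ m * (1 / 2) ^ n * Real.exp (l * T) := by gcongr; linarith [(hmem p.1).1]
          _ = _ := by ring))
  have hlimit : VorticityClass T M (gradBound C M A T) Z (fun s x => w (s, x)) (fun s x => g (s, x)) :=
    VorticityClass.of_limit hclass (fun n s x => hw n (s, x)) (fun n s x => hg n (s, x))
  have hD0 : 0 ≤ D := by positivity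
  -- With `Φ` the Picard map, `w - Φ w = (w - w_{n+1}) + (Φ w_n - Φ w)`, and both differences are
  -- `O(2⁻ⁿ)`.
  have hfix : ∀ s x, w (s, x) = picardMap ε T h w₀ (fun s x => w (s, x)) s x := by
    intro s x
    rw [← sub_eq_zero, ← norm_le_zero_iff]
    have hlim := tendsto_const_mul_half_pow (2 * D + D * Real.exp (l * T))
    refine ge_of_tendsto hlim (Eventually.of_forall fun n => ?_)
    have h1 := hw (n + 1) (s, x)
    have h2 := (picardMap_sub_le (h := h) (w₀ := w₀) (g₀ := g₀) hε hε1 hT (hclass n) hlimit hY hZ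
      hZb0 (m := 2 * D * (1 / 2) ^ n) (by positivity)
      (fun s x => (hw n (s, x)).trans (le_mul_of_one_le_right (by positivity) (hE s)))
      (fun s x => (hg n (s, x)).trans (le_mul_of_one_le_right (by positivity) (hE s)))).1 s x
    simp only [hsucc] at h1
    have h3 := hE' s
    have h4 : 2 * D * (1 / 2) ^ n / 2 * Real.exp (l * (T - clampTime T s))
        ≤ 2 * D * (1 / 2) ^ n / 2 * Real.exp (l * T) := by gcongr
    rw [pow_succ] at h1
    have h5 : (0 : ℝ) ≤ (1 / 2) ^ n := by positivity
    rw [← Real.norm_eq_abs] at h2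
    rw [norm_sub_rev] at h1
    have h6 := norm_add_le_of_le h1 (h2.trans h4)
    rw [sub_add_sub_cancel] at h6
    refine h6.trans ?_
    have : 0 ≤ D * (1 / 2) ^ n := by positivity
    nlinarith
  refine ⟨M, Yb, Z, fun s x => w (s, x), fun s x => g (s, x), ?_, fun s hs x => ?_⟩
  · exact { hlimit with bound_deriv := fun s x => (hlimit.bound_deriv s x).trans (hY s) }
  · simp only
    rw [hfix s x, picardMap, clampTime_of_mem hs]

end PicardLimit

/-! ### The laws of the driving sequences -/

lemma integral_expMeasure_one (f : ℝ → ℝ) :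
    ∫ t, f t ∂(expMeasure 1) = ∫ t in Ioi (0 : ℝ), Real.exp (-t) * f t := by
  have h : expMeasure 1 = volume.withDensity (exponentialPDF 1) := rfl
  rw [h, integral_withDensity_eq_integral_toReal_smul
    (f := exponentialPDF 1) (measurable_exponentialPDFReal 1).ennreal_ofReal
    (ae_of_all _ fun x => ENNReal.ofReal_lt_top), ← integral_Ici_eq_integral_Ioi,
    ← integral_indicator measurableSet_Ici]
  congr 1; funext x
  rw [exponentialPDF_eq]
  by_cases hx : 0 ≤ x
  · rw [if_pos hx, indicator_of_mem (mem_Ici.2 hx), ENNReal.toReal_ofReal (by positivity)]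
    simp
  · rw [if_neg hx, indicator_of_notMem (by simpa using hx)]
    simp

/-- The expectation after one waiting time, started at time `σ`, of a function which is `a` up to
time `s`, `b` on `(s,T]`, and `c` afterwards. -/
lemma integral_jump_eq_mild {ε s σ T a c : ℝ} {b : ℝ → ℝ} (hε : 0 < ε) (hs : s ≤ T) (hσ : σ < T)
    (hb : Continuous b) :
    ∫ t, (if σ + ε * t ∈ Ioc s T then b (σ + ε * t) else if σ + ε * t ≤ s then a else c)
        ∂(expMeasure 1)
      = (1 - Real.exp (-(max s σ - σ) / ε)) * a
        + Real.exp (-(max s σ - σ) / ε) * mild ε T c (fun r => ε⁻¹ • b r) (max s σ) := by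
  set σ' := max s σ with hσ'
  have h1 : σ ≤ σ' := le_max_right _ _
  have h2 : σ' ≤ T := max_le hs hσ.le
  -- The waiting time is cut where the jump would fall at `σ' = max s σ` and at `T`. By the loss of
  -- memory, the part after `t₁` is `exp (-t₁)` times the mild expression started at `σ'`.
  set t₁ := (σ' - σ) / ε with ht₁
  set t₂ := (T - σ) / ε with ht₂
  have h01 : 0 ≤ t₁ := div_nonneg (by linarith) hε.le
  have h12 : t₁ ≤ t₂ := by rw [ht₁, ht₂]; gcongr
  have e1 : σ + ε * t₁ = σ' := by rw [ht₁]; field_simp; ring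
  have e2 : σ + ε * t₂ = T := by rw [ht₂]; field_simp; ring
  set F : ℝ → ℝ := fun t => Real.exp (-t) *
    (if σ + ε * t ∈ Ioc s T then b (σ + ε * t) else if σ + ε * t ≤ s then a else c) with hF
  have f1 : EqOn F (fun t => Real.exp (-t) * a) (Ioc 0 t₁) := by
    intro t ht
    have k1 : σ + ε * t ≤ σ' := by rw [← e1]; gcongr; exact ht.2
    have k2 : σ < σ + ε * t := by linarith [mul_pos hε ht.1]
    have k3 : σ + ε * t ≤ s := by
      rcases le_total s σ with h | h
      · rw [hσ', max_eq_right h] at k1; linarith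
      · rwa [hσ', max_eq_left h] at k1
    simp only [hF, mem_Ioc, not_lt.2 k3, false_and, if_false, if_pos k3]
  have f2 : EqOn F (fun t => Real.exp (-t) * b (σ + ε * t)) (Ioc t₁ t₂) := by
    intro t ht
    have k1 : σ' < σ + ε * t := by rw [← e1]; gcongr; exact ht.1
    have k2 : σ + ε * t ≤ T := by rw [← e2]; gcongr; exact ht.2
    simp only [hF, mem_Ioc, (le_max_left s σ).trans_lt k1, k2, true_and, if_true]
  have f3 : EqOn F (fun t => Real.exp (-t) * c) (Ioi t₂) := by
    intro t ht
    have k1 : T < σ + ε * t := by rw [← e2]; gcongr; exact ht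
    simp only [hF, mem_Ioc, not_le.2 k1, and_false, if_false, not_le.2 (hs.trans_lt k1)]
  have i1 : IntegrableOn F (Ioc 0 t₁) :=
    (Continuous.integrableOn_Ioc (by fun_prop)).congr_fun f1.symm measurableSet_Ioc
  have i2 : IntegrableOn F (Ioc t₁ t₂) :=
    (Continuous.integrableOn_Ioc (by fun_prop)).congr_fun f2.symm measurableSet_Ioc
  have i3 : IntegrableOn F (Ioi t₂) :=
    IntegrableOn.congr_fun ((integrableOn_exp_neg_Ioi t₂).mul_const c) f3.symm measurableSet_Ioi
  rw [integral_expMeasure_one]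
  change ∫ t in Ioi (0 : ℝ), F t = _
  rw [← Ioc_union_Ioi_eq_Ioi h01, setIntegral_union (Ioc_disjoint_Ioi le_rfl) measurableSet_Ioi i1
    (by rw [← Ioc_union_Ioi_eq_Ioi h12]; exact i2.union i3), ← Ioc_union_Ioi_eq_Ioi h12,
    setIntegral_union (Ioc_disjoint_Ioi le_rfl) measurableSet_Ioi i2 i3,
    setIntegral_congr_fun measurableSet_Ioc f1, setIntegral_congr_fun measurableSet_Ioc f2,
    setIntegral_congr_fun measurableSet_Ioi f3, integral_mul_const, integral_mul_const,
    integral_exp_neg_Ioi, ← intervalIntegral.integral_of_le h01,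
    ← intervalIntegral.integral_of_le h12]
  have g1 : ∫ t in (0 : ℝ)..t₁, Real.exp (-t) = 1 - Real.exp (-t₁) := by
    rw [intervalIntegral.integral_comp_neg (fun t => Real.exp t), integral_exp]; simp
  have g2 : ∫ t in t₁..t₂, Real.exp (-t) * b (σ + ε * t)
      = Real.exp (-t₁) * ∫ r in σ'..T, Real.exp (-(r - σ') / ε) • ε⁻¹ • b r := by
    have := intervalIntegral.integral_comp_add_mul (a := t₁) (b := t₂)
      (fun r => Real.exp (-(r - σ) / ε) * b r) hε.ne' σ
    rw [e1, e2] at this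
    rw [← intervalIntegral.integral_const_mul]
    calc _ = ∫ t in t₁..t₂, Real.exp (-((σ + ε * t) - σ) / ε) * b (σ + ε * t) := by
          congr 1; funext t; congr 2; field_simp; ring
      _ = _ := by
          rw [this, smul_eq_mul, ← intervalIntegral.integral_const_mul]
          congr 1; funext r
          rw [show -(r - σ) / ε = -t₁ + -(r - σ') / ε by rw [ht₁]; ring, Real.exp_add]
          simp only [smul_eq_mul]; ring
  have g3 : Real.exp (-t₂) = Real.exp (-t₁) * Real.exp (-(T - σ') / ε) := by
    rw [← Real.exp_add]; congr 1; rw [ht₁, ht₂]; ring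
  rw [g1, g2, g3, show -(σ' - σ) / ε = -t₁ by rw [ht₁]; ring]
  unfold mild
  simp only [smul_eq_mul]
  ring

/-! ### Independence and almost sure behaviour of the driving sequences -/

section Driver

variable {Ω : Type*} {mΩ : MeasurableSpace Ω} {P : Measure Ω}
  {τ : ℕ → Ω → ℝ} {ξ : ℕ → Ω → Plane}

/-- The σ-algebras of all waiting times and steps. -/
@[reducible] def driverAlgebra (τ : ℕ → Ω → ℝ) (ξ : ℕ → Ω → Plane) : ℕ ⊕ ℕ → MeasurableSpace Ω :=
  Sum.elim (fun k => MeasurableSpace.comap (τ k) inferInstance)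
    (fun k => MeasurableSpace.comap (ξ k) inferInstance)

lemma IsPoissonDriver.driverAlgebra_le (hd : IsPoissonDriver P τ ξ) (i : ℕ ⊕ ℕ) :
    driverAlgebra τ ξ i ≤ mΩ := by
  rcases i with k | k
  · exact (hd.measurable_wait k).comap_le
  · exact (hd.measurable_step k).comap_le

/-- Independence is given inside each sequence and between the two. Splitting a finite index set
into waiting times and steps combines the three product formulas into joint independence. -/
lemma IsPoissonDriver.iIndep_driverAlgebra (hd : IsPoissonDriver P τ ξ) :
    iIndep (driverAlgebra τ ξ) P := by
  rw [iIndep_iff]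
  intro s f hf
  have hl : ∀ k ∈ s.toLeft, MeasurableSet[MeasurableSpace.comap (τ k) inferInstance] (f (.inl k)) :=
    fun k hk => hf (.inl k) (by simpa using hk)
  have hr : ∀ k ∈ s.toRight, MeasurableSet[MeasurableSpace.comap (ξ k) inferInstance] (f (.inr k)) :=
    fun k hk => hf (.inr k) (by simpa using hk)
  have e : ⋂ i ∈ s, f i = (⋂ k ∈ s.toLeft, f (.inl k)) ∩ (⋂ k ∈ s.toRight, f (.inr k)) := by
    ext ω; simp
  have ml : MeasurableSet[MeasurableSpace.comap (fun ω k => τ k ω) inferInstance]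
      (⋂ k ∈ s.toLeft, f (.inl k)) := by
    refine MeasurableSet.biInter (Finset.countable_toSet _) fun k hk => ?_
    obtain ⟨A, hA, h⟩ := hl k hk
    exact ⟨(fun g => g k) ⁻¹' A, measurable_pi_apply k hA, h⟩
  have mr : MeasurableSet[MeasurableSpace.comap (fun ω k => ξ k ω) inferInstance]
      (⋂ k ∈ s.toRight, f (.inr k)) := by
    refine MeasurableSet.biInter (Finset.countable_toSet _) fun k hk => ?_
    obtain ⟨A, hA, h⟩ := hr k hk
    exact ⟨(fun g => g k) ⁻¹' A, measurable_pi_apply k hA, h⟩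
  rw [e, (Indep_iff _ _ _).1 ((IndepFun_iff_Indep _ _ _).1 hd.indep_wait_step) _ _ ml mr,
    hd.indep_wait.meas_biInter hl, hd.indep_step.meas_biInter hr,
    Finset.prod_sum_eq_prod_toLeft_mul_prod_toRight]

/-- The σ-algebra of the first `n` waiting times and steps. -/
@[reducible] def driverPast (τ : ℕ → Ω → ℝ) (ξ : ℕ → Ω → Plane) (n : ℕ) : MeasurableSpace Ω :=
  ⨆ i ∈ {i : ℕ ⊕ ℕ | Sum.elim id id i < n}, driverAlgebra τ ξ i


lemma driverPast_mono {m n : ℕ} (h : m ≤ n) : driverPast τ ξ m ≤ driverPast τ ξ n :=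
  biSup_mono fun _ hi => lt_of_lt_of_le hi h

lemma measurable_wait_driverPast {k n : ℕ} (h : k < n) : Measurable[driverPast τ ξ n] (τ k) :=
  Measurable.mono (comap_measurable (τ k))
    (le_biSup (driverAlgebra τ ξ) (i := Sum.inl k) h) le_rfl

lemma measurable_step_driverPast {k n : ℕ} (h : k < n) : Measurable[driverPast τ ξ n] (ξ k) :=
  Measurable.mono (comap_measurable (ξ k))
    (le_biSup (driverAlgebra τ ξ) (i := Sum.inr k) h) le_rfl

lemma measurable_arrivalTime_driverPast {k n : ℕ} (h : k ≤ n) :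
    Measurable[driverPast τ ξ n] (arrivalTime τ k) := by
  unfold arrivalTime
  exact Finset.measurable_sum _ fun i hi =>
    measurable_wait_driverPast ((Finset.mem_range.1 hi).trans_le h)

lemma IsPoissonDriver.driverPast_le (hd : IsPoissonDriver P τ ξ) (n : ℕ) :
    driverPast τ ξ n ≤ mΩ := iSup₂_le fun i _ => hd.driverAlgebra_le i

lemma IsPoissonDriver.measurable_arrivalTime (hd : IsPoissonDriver P τ ξ) (n : ℕ) :
    Measurable (arrivalTime τ n) :=
  (measurable_arrivalTime_driverPast (ξ := ξ) le_rfl).mono (hd.driverPast_le n) le_rfl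

/-- The past is independent of the next waiting time and step. -/
lemma IsPoissonDriver.indepFun_next (hd : IsPoissonDriver P τ ξ) {E : Type*} [MeasurableSpace E]
    {n : ℕ} {p : Ω → E} (hp : Measurable[driverPast τ ξ n] p) :
    IndepFun p (fun ω => (τ n ω, ξ n ω)) P := by
  have hdis : Disjoint {i : ℕ ⊕ ℕ | Sum.elim id id i < n} {Sum.inl n, Sum.inr n} := by
    rw [Set.disjoint_left]
    rintro (i | i) hi <;> simp at hi ⊢ <;> omega
  have h := indep_iSup_of_disjoint hd.driverAlgebra_le hd.iIndep_driverAlgebra hdis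
  have h1 : Measurable[⨆ i ∈ ({Sum.inl n, Sum.inr n} : Set (ℕ ⊕ ℕ)), driverAlgebra τ ξ i] (τ n) :=
    Measurable.mono (comap_measurable (τ n))
      (le_biSup (driverAlgebra τ ξ) (i := Sum.inl n) (by simp)) le_rfl
  have h2 : Measurable[⨆ i ∈ ({Sum.inl n, Sum.inr n} : Set (ℕ ⊕ ℕ)), driverAlgebra τ ξ i] (ξ n) :=
    Measurable.mono (comap_measurable (ξ n))
      (le_biSup (driverAlgebra τ ξ) (i := Sum.inr n) (by simp)) le_rfl
  exact (IndepFun_iff_Indep _ _ _).2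
    (indep_of_indep_of_le h hp.comap_le (h1.prodMk h2).comap_le)

lemma planeBasis_injective : Function.Injective planeBasis := by
  intro i j h
  have := congrArg (fun v : Plane => v i) h
  by_contra hne
  simp [planeBasis, hne] at this

lemma planeBasis_ne_neg (i j : Fin 2) : planeBasis i ≠ -planeBasis j := by
  intro h
  have := congrArg (fun v : Plane => v i) h
  by_cases hij : i = j
  · subst hij
    simp [planeBasis] at this
    norm_num at this
  · simp [planeBasis, hij] at this

/-- The four prescribed atoms are distinct and have total mass one, so the law has no other part. -/
lemma IsPoissonDriver.integral_map_step [IsProbabilityMeasure P] (hd : IsPoissonDriver P τ ξ) (n : ℕ) (f : Plane → ℝ) :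
    ∫ e, f e ∂(P.map (ξ n)) = 4⁻¹ * ∑ i, (f (planeBasis i) + f (-planeBasis i)) := by
  set S : Finset Plane := {planeBasis 0, -planeBasis 0, planeBasis 1, -planeBasis 1} with hS
  have n01 : planeBasis 0 ≠ planeBasis 1 := fun h => by simpa using planeBasis_injective h
  have m1 : planeBasis 0 ∉ ({-planeBasis 0, planeBasis 1, -planeBasis 1} : Finset Plane) := by
    simp [planeBasis_ne_neg, n01]
  have m2 : -planeBasis 0 ∉ ({planeBasis 1, -planeBasis 1} : Finset Plane) := by
    simp [n01, (planeBasis_ne_neg 1 0).symm]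
  have m3 : planeBasis 1 ∉ ({-planeBasis 1} : Finset Plane) := by
    simp [planeBasis_ne_neg]
  have hm := hd.measurable_step n
  have : IsProbabilityMeasure (P.map (ξ n)) := Measure.isProbabilityMeasure_map hm.aemeasurable
  have hp : ∀ i, P.map (ξ n) {planeBasis i} = 1 / 4 := fun i => by
    rw [Measure.map_apply hm (measurableSet_singleton _)]; exact hd.law_step_pos n i
  have hn : ∀ i, P.map (ξ n) {-planeBasis i} = 1 / 4 := fun i => by
    rw [Measure.map_apply hm (measurableSet_singleton _)]; exact hd.law_step_neg n i
  have hone : P.map (ξ n) S = 1 := by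
    rw [← sum_measure_singleton, hS, Finset.sum_insert m1, Finset.sum_insert m2,
      Finset.sum_insert m3, Finset.sum_singleton, hp, hp, hn, hn,
      ← ENNReal.toReal_eq_one_iff]
    simp [ENNReal.toReal_add]
    norm_num
  have hae : ∀ᵐ e ∂(P.map (ξ n)), e ∈ (S : Set Plane) := by
    rw [← prob_compl_eq_zero_iff S.measurableSet] at hone
    exact hone
  rw [← Measure.restrict_eq_self_of_ae_mem hae, setIntegral_finset S ?_]
  · rw [hS, Finset.sum_insert m1, Finset.sum_insert m2, Finset.sum_insert m3,
      Finset.sum_singleton, Fin.sum_univ_two]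
    simp only [Measure.real, hp, hn, smul_eq_mul]
    norm_num
    ring
  · exact IntegrableOn.finset

lemma IsPoissonDriver.wait_pos (hd : IsPoissonDriver P τ ξ) (k : ℕ) : ∀ᵐ ω ∂P, 0 < τ k ω := by
  have h := isProbabilityMeasure_expMeasure (r := 1) one_pos
  have : P (τ k ⁻¹' Iic 0) = 0 := by
    rw [← Measure.map_apply (hd.measurable_wait k) measurableSet_Iic, hd.law_wait k,
      ← ofReal_cdf, cdf_expMeasure_eq one_pos]
    simp
  rw [ae_iff]
  convert this using 2
  ext ω; simp

/-- The second Borel–Cantelli lemma for independent events of common probability `e⁻¹`; together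
with positivity it makes the arrival times diverge. -/
lemma IsPoissonDriver.frequently_one_lt_wait [IsProbabilityMeasure P] (hd : IsPoissonDriver P τ ξ) :
    ∀ᵐ ω ∂P, ∃ᶠ k in atTop, 1 < τ k ω := by
  have h := isProbabilityMeasure_expMeasure (r := 1) one_pos
  have hm : ∀ k, MeasurableSet (τ k ⁻¹' Ioi 1) := fun k => hd.measurable_wait k measurableSet_Ioi
  have hP : ∀ k, P (τ k ⁻¹' Ioi 1) = ENNReal.ofReal (Real.exp (-1)) := fun k => by
    rw [← Measure.map_apply (hd.measurable_wait k) measurableSet_Ioi, hd.law_wait k,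
      ← compl_Iic, prob_compl_eq_one_sub measurableSet_Iic, ← ofReal_cdf, cdf_expMeasure_eq one_pos,
      ← ENNReal.ofReal_one, ← ENNReal.ofReal_sub _ (by simp)]
    simp
  have hlim : P (limsup (fun k => τ k ⁻¹' Ioi 1) atTop) = 1 := by
    refine measure_limsup_eq_one hm ?_ ?_
    · rw [iIndepSet_iff_meas_biInter hm]
      intro s
      exact hd.indep_wait.measure_inter_preimage_eq_mul s fun i _ => measurableSet_Ioi
    · simp only [hP]
      refine ENNReal.tsum_const_eq_top_of_ne_zero ?_
      simp [Real.exp_pos]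
  have := (prob_compl_eq_zero_iff (MeasurableSet.measurableSet_limsup hm)).2 hlim
  rw [ae_iff]
  convert this using 2
  ext ω
  simp [mem_limsup_iff_frequently_mem]

/-- On this event the jump times increase strictly and only finitely many lie before `T`; the
pathwise analysis takes place there. -/
lemma IsPoissonDriver.ae_good [IsProbabilityMeasure P] (hd : IsPoissonDriver P τ ξ) :
    ∀ᵐ ω ∂P, (∀ k, 0 < τ k ω) ∧ Tendsto (fun n => arrivalTime τ n ω) atTop atTop := by
  filter_upwards [ae_all_iff.2 hd.wait_pos, hd.frequently_one_lt_wait] with ω h1 h2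
  refine ⟨h1, ?_⟩
  have hmono : Monotone fun n => arrivalTime τ n ω := monotone_nat_of_le_succ fun n => by
    unfold arrivalTime
    rw [Finset.sum_range_succ]
    linarith [h1 n]
  have hub : ∀ m : ℕ, ∃ n, (m : ℝ) ≤ arrivalTime τ n ω := by
    intro m
    induction m with
    | zero => exact ⟨0, by simp [arrivalTime]⟩
    | succ m ih =>
      obtain ⟨n, hn⟩ := ih
      obtain ⟨k, hk, hk1⟩ := frequently_atTop.1 h2 n
      refine ⟨k + 1, ?_⟩
      have := hmono hk
      have e : arrivalTime τ (k + 1) ω = arrivalTime τ k ω + τ k ω := Finset.sum_range_succ _ _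
      push_cast
      simp only at this
      linarith
  refine tendsto_atTop_atTop_of_monotone hmono fun b => ?_
  obtain ⟨m, hm⟩ := exists_nat_ge b
  obtain ⟨n, hn⟩ := hub m
  exact ⟨n, hm.trans hn⟩

end Driver

/-! ### The embedded Markov chain and its comparison with mild solutions -/

section Chain

variable {Ω : Type*} {mΩ : MeasurableSpace Ω} {P : Measure Ω}
  {τ : ℕ → Ω → ℝ} {ξ : ℕ → Ω → Plane} {ε s T h : ℝ} {v : ℝ → Plane → Plane}

/-- The increment at a jump at time `r` from `z` with step `e`; only jumps in `(s,T]` count. -/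
def jumpStep (ε s T h : ℝ) (v : ℝ → Plane → Plane) (r : ℝ) (z e : Plane) : Plane :=
  z + if r ∈ Ioc s T then ε • v r z + h • e else 0

/-- The positions after the jumps at the times `ε S_n`, started at `x`. -/
def jumpChain {Ω : Type*} (τ : ℕ → Ω → ℝ) (ξ : ℕ → Ω → Plane) (ε s T h : ℝ)
    (v : ℝ → Plane → Plane) (x : Plane) : ℕ → Ω → Plane
  | 0, _ => x
  | n + 1, ω => jumpStep ε s T h v (ε * arrivalTime τ (n + 1) ω)
      (jumpChain τ ξ ε s T h v x n ω) (ξ n ω)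

lemma measurable_jumpStep (hv : Continuous (Function.uncurry v)) :
    Measurable fun q : ℝ × Plane × Plane => jumpStep ε s T h v q.1 q.2.1 q.2.2 := by
  unfold jumpStep
  refine Measurable.add (by fun_prop) (Measurable.ite (measurableSet_Ioc.preimage measurable_fst) ?_
    measurable_const)
  have : Continuous fun q : ℝ × Plane × Plane => v q.1 q.2.1 :=
    hv.comp (by fun_prop : Continuous fun q : ℝ × Plane × Plane => (q.1, q.2.1))
  exact Continuous.measurable (by fun_prop)

lemma measurable_jumpChain_driverPast (hv : Continuous (Function.uncurry v)) (x : Plane) (n : ℕ) :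
    Measurable[driverPast τ ξ n] (jumpChain τ ξ ε s T h v x n) := by
  induction n with
  | zero => exact measurable_const
  | succ n ih =>
    have h1 := (measurable_arrivalTime_driverPast (τ := τ) (ξ := ξ) (le_refl (n + 1))).const_mul ε
    have h2 := measurable_step_driverPast (τ := τ) (ξ := ξ) (Nat.lt_succ_self n)
    have h3 := ih.mono (driverPast_mono (τ := τ) (ξ := ξ) (Nat.le_succ n)) le_rfl
    exact (measurable_jumpStep hv).comp (h1.prodMk (h3.prodMk h2))

/-- The Markov property for one step: the next waiting time and step are independent of the past and
of each other, so Fubini replaces them by their laws. -/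
lemma IsPoissonDriver.integral_next [IsProbabilityMeasure P] (hd : IsPoissonDriver P τ ξ)
    {E : Type*} [MeasurableSpace E] {n : ℕ} {p : Ω → E} (hp : Measurable[driverPast τ ξ n] p)
    {G : E × ℝ × Plane → ℝ} (hG : Measurable G) {M : ℝ} (hM : ∀ q, |G q| ≤ M) :
    Integrable (fun q => ∫ t, 4⁻¹ * ∑ i, (G (q, t, planeBasis i) + G (q, t, -planeBasis i))
        ∂(expMeasure 1)) (P.map p) ∧
    ∫ ω, G (p ω, τ n ω, ξ n ω) ∂P
      = ∫ q, (∫ t, 4⁻¹ * ∑ i, (G (q, t, planeBasis i) + G (q, t, -planeBasis i))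
          ∂(expMeasure 1)) ∂(P.map p) := by
  have hpm : Measurable p := hp.mono (hd.driverPast_le n) le_rfl
  have hτ := hd.measurable_wait n
  have hξ := hd.measurable_step n
  have i1 := (indepFun_iff_map_prod_eq_prod_map_map hpm.aemeasurable
    (hτ.prodMk hξ).aemeasurable).1 (hd.indepFun_next hp)
  have i2 := (indepFun_iff_map_prod_eq_prod_map_map hτ.aemeasurable hξ.aemeasurable).1
    (hd.indep_wait_step.comp (measurable_pi_apply n) (measurable_pi_apply n))
  rw [hd.law_wait n] at i2
  rw [i2] at i1
  have := isProbabilityMeasure_expMeasure (r := 1) one_pos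
  have := Measure.isProbabilityMeasure_map (μ := P) hpm.aemeasurable
  have := Measure.isProbabilityMeasure_map (μ := P) hξ.aemeasurable
  have hint : Integrable G ((P.map p).prod ((expMeasure 1).prod (P.map (ξ n)))) :=
    Integrable.of_bound hG.aestronglyMeasurable M (ae_of_all _ hM)
  have hinner : ∀ q, ∫ z, G (q, z) ∂((expMeasure 1).prod (P.map (ξ n)))
      = ∫ t, 4⁻¹ * ∑ i, (G (q, t, planeBasis i) + G (q, t, -planeBasis i)) ∂(expMeasure 1) := by
    intro q
    have hq : Integrable (fun z => G (q, z)) ((expMeasure 1).prod (P.map (ξ n))) :=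
      Integrable.of_bound (hG.comp (by fun_prop)).aestronglyMeasurable M (ae_of_all _ fun z => hM _)
    rw [integral_prod _ hq]
    congr 1; funext t
    exact hd.integral_map_step n _
  constructor
  · have := hint.integral_prod_left
    simpa only [hinner] using this
  · have e : ∫ ω, G (p ω, τ n ω, ξ n ω) ∂P
        = ∫ z, G z ∂(P.map fun ω => (p ω, τ n ω, ξ n ω)) :=
      (integral_map (hpm.prodMk (hτ.prodMk hξ)).aemeasurable hG.aestronglyMeasurable).symm
    rw [e, i1, integral_prod _ hint]
    simp only [hinner]

/-- The comparison of `V` at time `s` with the expectation of `V T` along the chain, when `V` solves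
the mild equation of the chain up to the error of which `y` is a mild supersolution. -/
lemma IsPoissonDriver.abs_sub_integral_le [IsProbabilityMeasure P] (hd : IsPoissonDriver P τ ξ)
    (hε : 0 < ε) (hs : 0 ≤ s) (hsT : s ≤ T) (hv : Continuous (Function.uncurry v))
    {V : ℝ → Plane → ℝ} (hV : Continuous (Function.uncurry V)) {M : ℝ} (hM : ∀ r z, |V r z| ≤ M)
    {y : ℝ → ℝ} (hy : Continuous y) (hy0 : ∀ r, 0 ≤ y r)
    (hcmp : ∀ r ∈ Icc s T, ∀ z,
      |V r z - mild ε T (V T z) (fun q => ε⁻¹ • stepMean h (V q) (z + ε • v q z)) r|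
        ≤ y r - mild ε T (y T) (fun q => ε⁻¹ • y q) r)
    (x : Plane) {Z : Ω → Plane}
    (hZ : ∀ᵐ ω ∂P, ∀ᶠ n in atTop, jumpChain τ ξ ε s T h v x n ω = Z ω) :
    |V s x - ∫ ω, V T (Z ω) ∂P| ≤ y s := by
  -- Only jumps in `(s,T]` move the chain, so the observable `W` freezes the time of `V` at `s`
  -- before and at `T` after.
  set c : ℝ → ℝ := fun r => max s (min r T) with hc
  have hcc : Continuous c := by fun_prop
  have hcm : ∀ r, c r ∈ Icc s T := fun r => ⟨le_max_left _ _, max_le hsT (min_le_right _ _)⟩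
  have hcT : ∀ r, T ≤ r → c r = T := fun r hr => by
    simp only [hc, min_eq_right hr, max_eq_right hsT]
  have hcs : ∀ r, r ≤ s → c r = s := fun r hr => by
    simp only [hc, min_eq_left (hr.trans hsT), max_eq_left hr]
  have hcr : ∀ r ∈ Icc s T, c r = r := fun r hr => by
    simp only [hc, min_eq_left hr.2, max_eq_right hr.1]
  obtain ⟨N, hN⟩ : ∃ N, ∀ r, |y (c r)| ≤ N := by
    obtain ⟨N, hN⟩ := isCompact_Icc.exists_bound_of_continuousOn (hy.continuousOn (s := Icc s T))
    exact ⟨N, fun r => hN _ (hcm r)⟩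
  set Y := jumpChain τ ξ ε s T h v x with hY
  set p : ℕ → Ω → ℝ × Plane := fun n ω => (ε * arrivalTime τ n ω, Y n ω) with hp
  have hpm : ∀ n, Measurable[driverPast τ ξ n] (p n) := fun n =>
    ((measurable_arrivalTime_driverPast (τ := τ) (ξ := ξ) le_rfl).const_mul ε).prodMk
      (measurable_jumpChain_driverPast hv x n)
  have hpm' : ∀ n, Measurable (p n) := fun n => (hpm n).mono (hd.driverPast_le n) le_rfl
  have hprob : ∀ n, IsProbabilityMeasure (P.map (p n)) := fun n =>
    Measure.isProbabilityMeasure_map (hpm' n).aemeasurable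
  set W : ℝ × Plane → ℝ := fun q => V (c q.1) q.2 with hW
  have hWc : Continuous W := hV.comp (by fun_prop : Continuous fun q : ℝ × Plane => (c q.1, q.2))
  set G : (ℝ × Plane) × ℝ × Plane → ℝ := fun q =>
    W (q.1.1 + ε * q.2.1, jumpStep ε s T h v (q.1.1 + ε * q.2.1) q.1.2 q.2.2) with hG
  have hGm : Measurable G := by
    refine hWc.measurable.comp (Measurable.prodMk (by fun_prop) ?_)
    exact (measurable_jumpStep hv).comp (Measurable.prodMk (by fun_prop)
      (Measurable.prodMk (by fun_prop) (by fun_prop)))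
  set G' : (ℝ × Plane) × ℝ × Plane → ℝ := fun q => y (c (q.1.1 + ε * q.2.1)) with hG'
  have hGm' : Measurable G' := Continuous.measurable (by fun_prop)
  -- The one-step defect of `W` from being harmonic for the chain is bounded by the one-step
  -- decrease of `y ∘ c`. Averaging over one jump turns both into defects of mild equations, where
  -- `hcmp` applies.
  have hstep : ∀ q : ℝ × Plane,
      |W q - ∫ t, 4⁻¹ * ∑ i, (G (q, t, planeBasis i) + G (q, t, -planeBasis i)) ∂(expMeasure 1)|
        ≤ y (c q.1) - ∫ t, 4⁻¹ * ∑ i, (G' (q, t, planeBasis i) + G' (q, t, -planeBasis i))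
          ∂(expMeasure 1) := by
    rintro ⟨σ, z⟩
    set b : ℝ → ℝ := fun r => stepMean h (V r) (z + ε • v r z) with hb
    have hbc : Continuous b := by
      refine continuous_stepMean h hV ?_
      have : Continuous fun r => v r z := hv.comp (by fun_prop : Continuous fun r => (r, z))
      fun_prop
    have e1 : ∀ t, 4⁻¹ * ∑ i, (G ((σ, z), t, planeBasis i) + G ((σ, z), t, -planeBasis i))
        = if σ + ε * t ∈ Ioc s T then b (σ + ε * t) else if σ + ε * t ≤ s then V s z else V T z := by
      intro t
      simp only [hG, hW]
      by_cases h1 : σ + ε * t ∈ Ioc s T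
      · simp only [jumpStep, if_pos h1, hb, stepMean, hcr _ (Ioc_subset_Icc_self h1), smul_eq_mul,
          add_assoc]
      · simp only [jumpStep, if_neg h1, add_zero, Fin.sum_univ_two]
        by_cases h2 : σ + ε * t ≤ s
        · rw [if_pos h2, hcs _ h2]; ring
        · rw [if_neg h2, hcT _ (by
            by_contra h3
            exact h1 ⟨not_le.1 h2, (not_le.1 h3).le⟩)]; ring
    have e2 : ∀ t, 4⁻¹ * ∑ i : Fin 2, (G' ((σ, z), t, planeBasis i) + G' ((σ, z), t, -planeBasis i))
        = if σ + ε * t ∈ Ioc s T then y (σ + ε * t) else if σ + ε * t ≤ s then y s else y T := by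
      intro t
      simp only [hG', Fin.sum_univ_two]
      by_cases h1 : σ + ε * t ∈ Ioc s T
      · rw [if_pos h1, hcr _ (Ioc_subset_Icc_self h1)]; ring
      · rw [if_neg h1]
        by_cases h2 : σ + ε * t ≤ s
        · rw [if_pos h2, hcs _ h2]; ring
        · rw [if_neg h2, hcT _ (by
            by_contra h3
            exact h1 ⟨not_le.1 h2, (not_le.1 h3).le⟩)]; ring
    simp only [e1, e2]
    rcases lt_or_ge σ T with hσ | hσ
    · rw [integral_jump_eq_mild hε hsT hσ hbc, integral_jump_eq_mild hε hsT hσ hy]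
      have hcσ : c σ = max s σ := by simp only [hc, min_eq_left hσ.le]
      set α := Real.exp (-(max s σ - σ) / ε) with hα
      have hα0 : 0 ≤ α := (Real.exp_pos _).le
      -- Either `σ ≤ s`, and both times equal `s`, or `σ ≥ s`, and `α = 1`.
      have key : ∀ u : ℝ → ℝ, u (c σ) = (1 - α) * u s + α * u (max s σ) := by
        intro u
        rw [hcσ]
        rcases le_total s σ with h1 | h1
        · rw [hα, max_eq_right h1]; simp
        · rw [max_eq_left h1]; ring
      have k1 := key (fun r => V r z)
      have k2 := key y
      have h3 := hcmp (max s σ) ⟨le_max_left _ _, max_le hsT hσ.le⟩ z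
      simp only [hW]
      rw [k1, k2]
      calc _ = |α * (V (max s σ) z - mild ε T (V T z)
              (fun q => ε⁻¹ • stepMean h (V q) (z + ε • v q z)) (max s σ))| := by
            congr 1; ring
        _ ≤ α * (y (max s σ) - mild ε T (y T) (fun q => ε⁻¹ • y q) (max s σ)) := by
            rw [abs_mul, abs_of_nonneg hα0]; gcongr
        _ = _ := by ring
    -- From `T` on nothing moves any more, and both defects vanish.
    · have hpos : ∀ᵐ t ∂(expMeasure 1), 0 < t := by
        have h0 := (hd.wait_pos 0)
        rw [← hd.law_wait 0]
        exact (ae_map_iff (hd.measurable_wait 0).aemeasurable measurableSet_Ioi).2 h0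
      have hone := isProbabilityMeasure_expMeasure (r := 1) one_pos
      have key : ∀ (u : ℝ → ℝ) (A B : ℝ), ∫ t, (if σ + ε * t ∈ Ioc s T then u (σ + ε * t)
          else if σ + ε * t ≤ s then A else B) ∂(expMeasure 1) = B := by
        intro u A B
        have : ∀ᵐ t ∂(expMeasure 1), (if σ + ε * t ∈ Ioc s T then u (σ + ε * t)
          else if σ + ε * t ≤ s then A else B) = B := by
          filter_upwards [hpos] with t ht
          have : T < σ + ε * t := by linarith [mul_pos hε ht]
          rw [if_neg (fun h => absurd h.2 (not_le.2 this)), if_neg (by linarith)]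
        rw [integral_congr_ae this]
        simp
      rw [key, key]
      simp only [hW, hcT σ hσ, sub_self, abs_zero, le_refl]
  have hint : ∀ n, Integrable W (P.map (p n)) := fun n =>
    Integrable.of_bound hWc.aestronglyMeasurable M (ae_of_all _ fun q => hM _ _)
  have hint' : ∀ n, Integrable (fun q : ℝ × Plane => y (c q.1)) (P.map (p n)) := fun n =>
    Integrable.of_bound (Continuous.aestronglyMeasurable (by fun_prop)) N (ae_of_all _ fun q => hN _)
  have htime : ∀ n ω, ε * arrivalTime τ n ω + ε * τ n ω = ε * arrivalTime τ (n + 1) ω := by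
    intro n ω
    unfold arrivalTime
    rw [Finset.sum_range_succ, mul_add]
  have hone : ∀ n, |∫ q, W q ∂(P.map (p n)) - ∫ q, W q ∂(P.map (p (n + 1)))|
      ≤ ∫ q, y (c q.1) ∂(P.map (p n)) - ∫ q, y (c q.1) ∂(P.map (p (n + 1))) := by
    intro n
    obtain ⟨a1, a2⟩ := hd.integral_next (hpm n) hGm (M := M) (fun q => hM _ _)
    obtain ⟨b1, b2⟩ := hd.integral_next (hpm n) hGm' (M := N) (fun q => hN _)
    have c1 : ∫ q, W q ∂(P.map (p (n + 1))) = ∫ ω, G (p n ω, τ n ω, ξ n ω) ∂P := by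
      rw [integral_map (hpm' _).aemeasurable hWc.aestronglyMeasurable]
      congr 1; funext ω
      simp only [hG, hp, htime, hY, jumpChain]
    have c2 : ∫ q, y (c q.1) ∂(P.map (p (n + 1))) = ∫ ω, G' (p n ω, τ n ω, ξ n ω) ∂P := by
      rw [integral_map (hpm' _).aemeasurable (Continuous.aestronglyMeasurable (by fun_prop))]
      congr 1; funext ω
      simp only [hG', hp, htime]
    rw [c1, c2, a2, b2, ← integral_sub (hint n) a1, ← integral_sub (hint' n) b1]
    refine (abs_integral_le_integral_abs).trans (integral_mono (((hint n).sub a1).abs)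
      ((hint' n).sub b1) hstep)
  -- The decreases of `y ∘ c` telescope; since `y ≥ 0`, their sum never exceeds `y s`, whatever the
  -- number of jumps.
  have htel : ∀ n, |∫ q, W q ∂(P.map (p 0)) - ∫ q, W q ∂(P.map (p n))|
      ≤ ∫ q, y (c q.1) ∂(P.map (p 0)) - ∫ q, y (c q.1) ∂(P.map (p n)) := by
    intro n
    induction n with
    | zero => simp
    | succ n ih =>
      have := hone n
      rw [abs_le] at *
      constructor <;> linarith [this.1, this.2, ih.1, ih.2]
  have hp0 : ∀ ω, p 0 ω = (0, x) := fun ω => by simp [hp, hY, jumpChain, arrivalTime]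
  have w0 : ∫ q, W q ∂(P.map (p 0)) = V s x := by
    rw [integral_map (hpm' _).aemeasurable hWc.aestronglyMeasurable]
    simp [hp0, hW, hcs 0 hs]
  have y0 : ∫ q, y (c q.1) ∂(P.map (p 0)) = y s := by
    rw [integral_map (hpm' _).aemeasurable (Continuous.aestronglyMeasurable (by fun_prop))]
    simp [hp0, hcs 0 hs]
  -- Almost surely the times eventually exceed `T` and the chain has stopped at `Z`, so `W` is
  -- eventually equal to `V T Z`.
  have hlim : Tendsto (fun n => ∫ q, W q ∂(P.map (p n))) atTop (𝓝 (∫ ω, V T (Z ω) ∂P)) := by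
    have e : ∀ n, ∫ q, W q ∂(P.map (p n)) = ∫ ω, W (p n ω) ∂P := fun n =>
      integral_map (hpm' _).aemeasurable hWc.aestronglyMeasurable
    simp only [e]
    refine tendsto_integral_of_dominated_convergence (fun _ => M)
      (fun n => (hWc.measurable.comp (hpm' n)).aestronglyMeasurable) (integrable_const _)
      (fun n => ae_of_all _ fun ω => hM _ _) ?_
    filter_upwards [hZ, hd.ae_good] with ω h1 h2
    refine tendsto_const_nhds.congr' ?_
    have h3 := (h2.2.const_mul_atTop hε).eventually_ge_atTop T
    filter_upwards [h1, h3] with n h4 h5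
    simp only [hW, hp, hcT _ h5, h4]
  have hfin : ∀ n, |V s x - ∫ q, W q ∂(P.map (p n))| ≤ y s := by
    intro n
    have h1 := htel n
    have h2 : 0 ≤ ∫ q, y (c q.1) ∂(P.map (p n)) := integral_nonneg fun q => hy0 _
    rw [w0, y0] at h1
    linarith
  exact le_of_tendsto ((tendsto_const_nhds.sub hlim).abs) (Eventually.of_forall hfin)

end Chain

/-! ### The paths of the scheme -/

section Paths

variable {Ω : Type*} {mΩ : MeasurableSpace Ω} {P : Measure Ω}
  {τ : ℕ → Ω → ℝ} {ξ : ℕ → Ω → Plane} {ε s t T h : ℝ} {ω : Ω}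

lemma strictMono_arrivalTime (h0 : ∀ k, 0 < τ k ω) : StrictMono fun n => arrivalTime τ n ω :=
  strictMono_nat_of_lt_succ fun n => by
    unfold arrivalTime
    rw [Finset.sum_range_succ]
    linarith [h0 n]

/-- On the good event the arrival times increase to infinity, so the set under `sSup` is bounded and
its supremum is attained; `t ≥ 0` puts `0` into it. The path arguments use the counting process
through this equivalence. -/
lemma le_poissonCountEps_iff (hg : (∀ k, 0 < τ k ω) ∧ Tendsto (fun n => arrivalTime τ n ω) atTop atTop)
    (hε : 0 < ε) (ht : 0 ≤ t) {n : ℕ} :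
    n ≤ poissonCountEps τ ε t ω ↔ ε * arrivalTime τ n ω ≤ t := by
  have hm := (strictMono_arrivalTime hg.1).monotone
  have hb : BddAbove {n : ℕ | arrivalTime τ n ω ≤ t / ε} := by
    obtain ⟨N, hN⟩ := (hg.2.eventually_gt_atTop (t / ε)).exists
    refine ⟨N, fun n hn => ?_⟩
    by_contra hlt
    exact absurd ((hm (not_le.1 hlt).le).trans hn) (not_le.2 hN)
  have hne : {n : ℕ | arrivalTime τ n ω ≤ t / ε}.Nonempty :=
    ⟨0, by simpa [arrivalTime] using div_nonneg ht hε.le⟩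
  rw [mul_comm, ← le_div_iff₀ hε]
  unfold poissonCountEps poissonCount
  constructor
  · intro hn
    exact (hm hn).trans (Nat.sSup_mem hne hb)
  · intro hn
    exact le_csSup hb hn

lemma poissonCountEps_mono (hg : (∀ k, 0 < τ k ω) ∧ Tendsto (fun n => arrivalTime τ n ω) atTop atTop)
    (hε : 0 < ε) (hs : 0 ≤ s) (hst : s ≤ t) :
    poissonCountEps τ ε s ω ≤ poissonCountEps τ ε t ω :=
  (le_poissonCountEps_iff hg hε (hs.trans hst)).2
    (((le_poissonCountEps_iff hg hε hs).1 le_rfl).trans hst)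

/-- The left limit at a jump time of a path which only depends on the number of jumps. -/
lemma leftLim_at_jump (hg : (∀ k, 0 < τ k ω) ∧ Tendsto (fun n => arrivalTime τ n ω) atTop atTop)
    (hε : 0 < ε) (hs : 0 ≤ s) {X : ℝ → Plane} {f : ℕ → Plane}
    (hX : ∀ q ∈ Icc s T, X q = f (poissonCountEps τ ε q ω)) {n : ℕ}
    (hn : poissonCountEps τ ε s ω ≤ n) (hn' : ε * arrivalTime τ (n + 1) ω ≤ T) :
    Function.leftLim X (ε * arrivalTime τ (n + 1) ω) = f n := by
  have h1 : s < ε * arrivalTime τ (n + 1) ω := by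
    by_contra hle
    have := (le_poissonCountEps_iff hg hε hs).2 (not_lt.1 hle)
    omega
  have h2 : ε * arrivalTime τ n ω < ε * arrivalTime τ (n + 1) ω :=
    mul_lt_mul_of_pos_left (strictMono_arrivalTime hg.1 (Nat.lt_succ_self n)) hε
  refine leftLim_eq_of_tendsto ?_
  refine tendsto_const_nhds.congr' ?_
  filter_upwards [Ioo_mem_nhdsLT (max_lt h1 h2)] with q hq
  have hq1 : s ≤ q := (le_max_left _ _).trans hq.1.le
  rw [hX q ⟨hq1, hq.2.le.trans hn'⟩]
  congr 1
  refine le_antisymm ((le_poissonCountEps_iff hg hε (hs.trans hq1)).2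
    ((le_max_right _ _).trans hq.1.le)) ?_
  by_contra hlt
  have := (le_poissonCountEps_iff hg hε (hs.trans hq1)).1 (not_le.1 hlt)
  exact absurd hq.2 (not_lt.2 this)

lemma jumpChain_eq_of_ge (hg : (∀ k, 0 < τ k ω) ∧ Tendsto (fun n => arrivalTime τ n ω) atTop atTop)
    (hε : 0 < ε) (hT : 0 ≤ T) {v : ℝ → Plane → Plane} {x : Plane} {n : ℕ}
    (hn : poissonCountEps τ ε T ω ≤ n) :
    jumpChain τ ξ ε s T h v x n ω = jumpChain τ ξ ε s T h v x (poissonCountEps τ ε T ω) ω := by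
  induction n, hn using Nat.le_induction with
  | base => rfl
  | succ n hn ih =>
    rw [jumpChain, jumpStep, if_neg, add_zero, ih]
    intro hmem
    have := (le_poissonCountEps_iff hg hε hT).2 hmem.2
    omega

lemma jumpChain_eq_start (hg : (∀ k, 0 < τ k ω) ∧ Tendsto (fun n => arrivalTime τ n ω) atTop atTop)
    (hε : 0 < ε) (hs : 0 ≤ s) {v : ℝ → Plane → Plane} {x : Plane} {n : ℕ}
    (hn : n ≤ poissonCountEps τ ε s ω) : jumpChain τ ξ ε s T h v x n ω = x := by
  induction n with
  | zero => rfl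
  | succ n ih =>
    rw [jumpChain, jumpStep, if_neg, add_zero, ih (by omega)]
    intro hmem
    exact absurd hmem.1 (not_lt.2 ((le_poissonCountEps_iff hg hε hs).1 hn))

lemma sum_range_sub_sum_range_succ {f : ℕ → Plane} {m n : ℕ} :
    (∑ k ∈ Finset.range (n + 1), f k - ∑ k ∈ Finset.range m, f k)
      = (∑ k ∈ Finset.range n, f k - ∑ k ∈ Finset.range m, f k) + f n := by
  rw [Finset.sum_range_succ]; abel

/-- A path solves the stochastic equation iff it is read off from the chain of its jumps. -/
lemma flow_eq_iff (hg : (∀ k, 0 < τ k ω) ∧ Tendsto (fun n => arrivalTime τ n ω) atTop atTop)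
    (hε : 0 < ε) (hs : 0 ≤ s) (hsT : s ≤ T) {u v : ℝ → Plane → Plane}
    (huv : ∀ r ∈ Icc s T, v r = u r) {x : Plane} {X : ℝ → Plane} :
    (∀ t ∈ Icc s T, X t = x
      + ε • poissonIntegral τ ε s t (fun r => u r (Function.leftLim X r)) ω
      + h • (compoundPoisson τ ξ ε t ω - compoundPoisson τ ξ ε s ω)) ↔
    ∀ t ∈ Icc s T, X t = jumpChain τ ξ ε s T h v x (poissonCountEps τ ε t ω) ω := by
  set N := fun t => poissonCountEps τ ε t ω with hN
  set Y := fun n => jumpChain τ ξ ε s T h v x n ω with hY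
  -- `B n` is the right-hand side of the stochastic equation after `n` jumps in all. Either side of
  -- the equivalence says that `X` is a function `f` of the number of jumps, with `f = B` or `f =
  -- Y`. Its left limit at jump `n + 1` is then `f n`, so `B` obeys the recursion of `Y`, and one
  -- induction serves both directions.
  set B := fun n => x
      + ε • ∑ k ∈ Finset.Ioc (N s) n, u (ε * arrivalTime τ k ω)
        (Function.leftLim X (ε * arrivalTime τ k ω))
      + h • (∑ k ∈ Finset.range n, ξ k ω - ∑ k ∈ Finset.range (N s), ξ k ω) with hB
  have key : ∀ f : ℕ → Plane, (f = B ∨ f = Y) → (∀ t ∈ Icc s T, X t = f (N t)) →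
      ∀ n, N s ≤ n → n ≤ N T → B n = Y n := by
    intro f hf hX n hn
    induction n, hn using Nat.le_induction with
    | base =>
      intro _
      have : Y (N s) = x := jumpChain_eq_start hg hε hs le_rfl
      rw [this]
      simp [hB]
    | succ n hn ih =>
      intro hnT
      have hnT' := ih (by omega)
      have hle : ε * arrivalTime τ (n + 1) ω ≤ T :=
        (le_poissonCountEps_iff hg hε (hs.trans hsT)).1 hnT
      have hlt : s < ε * arrivalTime τ (n + 1) ω := by
        by_contra hle
        have := (le_poissonCountEps_iff hg hε hs).2 (not_lt.1 hle)
        simp only [hN] at hn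
        omega
      have hl := leftLim_at_jump hg hε hs hX hn hle
      have hfn : f n = Y n := by
        rcases hf with hf | hf
        · rw [hf, hnT']
        · rw [hf]
      -- Jump number `n + 1` carries the step `ξ n`, because the steps are indexed from `0`.
      have hYs : Y (n + 1) = Y n + (ε • u (ε * arrivalTime τ (n + 1) ω) (Y n) + h • ξ n ω) := by
        simp only [hY]
        rw [jumpChain, jumpStep, if_pos ⟨hlt, hle⟩, huv _ ⟨hlt.le, hle⟩]
      have hBs : B (n + 1) = B n + (ε • u (ε * arrivalTime τ (n + 1) ω) (f n) + h • ξ n ω) := by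
        simp only [hB]
        rw [← Finset.insert_Ioc_right_eq_Ioc_add_one (by omega), Finset.sum_insert (by simp), hl,
          sum_range_sub_sum_range_succ, smul_add, smul_add]
        abel
      rw [hBs, hYs, hfn, hnT']
  have hNt : ∀ t ∈ Icc s T, N s ≤ N t ∧ N t ≤ N T := fun t ht =>
    ⟨poissonCountEps_mono hg hε hs ht.1, poissonCountEps_mono hg hε (hs.trans ht.1) ht.2⟩
  constructor
  · intro hX t ht
    rw [hX t ht]
    exact key B (.inl rfl) hX (N t) (hNt t ht).1 (hNt t ht).2
  · intro hX t ht
    rw [hX t ht]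
    exact (key Y (.inr rfl) hX (N t) (hNt t ht).1 (hNt t ht).2).symm

lemma IsPoissonDriver.measurable_poissonCountEps (hd : IsPoissonDriver P τ ξ) (ε t : ℝ) :
    Measurable (poissonCountEps τ ε t) := by
  refine measurable_of_Ici fun n => ?_
  rcases Nat.eq_zero_or_pos n with hn | hn
  · subst hn
    convert MeasurableSet.univ using 1
    ext ω; simp
  have hm : ∀ m, MeasurableSet {ω | arrivalTime τ m ω ≤ t / ε} := fun m =>
    measurableSet_le (hd.measurable_arrivalTime m) measurable_const
  -- The supremum of an unbounded set of naturals is `0` by convention. For `n ≥ 1` the event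
  -- therefore requires the set to be bounded as well as to have an element at least `n`.
  have e : poissonCountEps τ ε t ⁻¹' Ici n
      = (⋃ b : ℕ, ⋂ m : ℕ, ({ω | arrivalTime τ m ω ≤ t / ε}ᶜ ∪ {_ω | m ≤ b}))
        ∩ ⋃ m : ℕ, ({ω | arrivalTime τ m ω ≤ t / ε} ∩ {_ω | n ≤ m}) := by
    ext ω
    set A := {m : ℕ | arrivalTime τ m ω ≤ t / ε} with hA
    have h1 : (ω ∈ ⋃ b : ℕ, ⋂ m : ℕ, ({ω | arrivalTime τ m ω ≤ t / ε}ᶜ ∪ {_ω | m ≤ b}))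
        ↔ BddAbove A := by
      simp only [mem_iUnion, mem_iInter, mem_union, mem_compl_iff, Set.mem_ofPred_eq, BddAbove,
        Set.Nonempty, mem_upperBounds, hA, imp_iff_not_or]
    have h2 : (ω ∈ ⋃ m : ℕ, ({ω | arrivalTime τ m ω ≤ t / ε} ∩ {_ω | n ≤ m})) ↔ ∃ m ∈ A, n ≤ m := by
      simp [hA]
    rw [mem_inter_iff, h1, h2, mem_preimage, mem_Ici]
    change n ≤ sSup A ↔ _
    constructor
    · intro hle
      by_cases hb : BddAbove A
      · refine ⟨hb, sSup A, Nat.sSup_mem ?_ hb, hle⟩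
        by_contra hne
        rw [not_nonempty_iff_eq_empty.1 hne] at hle
        simp at hle
        omega
      · rw [Nat.sSup_of_not_bddAbove hb] at hle
        omega
    · rintro ⟨hb, m, hm, hnm⟩
      exact hnm.trans (le_csSup hb hm)
  rw [e]
  refine MeasurableSet.inter (MeasurableSet.iUnion fun b => MeasurableSet.iInter fun m =>
    (hm m).compl.union (MeasurableSet.const _)) (MeasurableSet.iUnion fun m =>
    (hm m).inter (MeasurableSet.const _))

/-- The path of the scheme with velocity `v`. -/
def chainFlow {Ω : Type*} (τ : ℕ → Ω → ℝ) (ξ : ℕ → Ω → Plane) (ε T h : ℝ)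
    (v : ℝ → Plane → Plane) (s t : ℝ) (x : Plane) (ω : Ω) : Plane :=
  jumpChain τ ξ ε s T h v x (poissonCountEps τ ε t ω) ω

lemma IsPoissonDriver.measurable_chainFlow (hd : IsPoissonDriver P τ ξ) {v : ℝ → Plane → Plane}
    (hv : Continuous (Function.uncurry v)) (x : Plane) :
    Measurable (chainFlow τ ξ ε T h v s t x) := by
  have h1 : Measurable fun q : Ω × ℕ => jumpChain τ ξ ε s T h v x q.2 q.1 :=
    measurable_from_prod_countable_left fun n =>
      (measurable_jumpChain_driverPast hv x n).mono (hd.driverPast_le n) le_rfl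
  exact h1.comp (measurable_id.prodMk (hd.measurable_poissonCountEps ε t))

lemma IsPoissonDriver.eventually_jumpChain_eq [IsProbabilityMeasure P] (hd : IsPoissonDriver P τ ξ)
    (hε : 0 < ε) (hT : 0 ≤ T) (v : ℝ → Plane → Plane) (x : Plane) :
    ∀ᵐ ω ∂P, ∀ᶠ n in atTop, jumpChain τ ξ ε s T h v x n ω = chainFlow τ ξ ε T h v s T x ω := by
  filter_upwards [hd.ae_good] with ω hg
  filter_upwards [eventually_ge_atTop (poissonCountEps τ ε T ω)] with n hn
  exact jumpChain_eq_of_ge hg hε hT hn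

/-- The velocity of a vorticity, extended to all times. -/
def clampVelocity (T : ℝ) (w : ℝ → Plane → ℝ) (r : ℝ) : Plane → Plane :=
  biotSavart (w (clampTime T r))

/-- Pathwise uniqueness for a given vorticity: the equation determines the path jump by jump. -/
lemma IsSchemeSolution.ae_eq_chainFlow [IsProbabilityMeasure P] (hd : IsPoissonDriver P τ ξ)
    (hε : 0 < ε) {ν : ℝ} {w₀ : Plane → ℝ} {X : ℝ → ℝ → Plane → Ω → Plane} {w : ℝ → Plane → ℝ}
    (hX : IsSchemeSolution P τ ξ ν T w₀ ε X w) (hs : s ∈ Icc 0 T) (x : Plane) :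
    ∀ᵐ ω ∂P, ∀ t ∈ Icc s T,
      X s t x ω = chainFlow τ ξ ε T (2 * √(ε * ν)) (clampVelocity T w) s t x ω := by
  filter_upwards [hd.ae_good, hX.flow_eq s hs x] with ω hg h1
  refine (flow_eq_iff (X := fun q => X s q x ω) (u := fun r => biotSavart (w r)) hg hε hs.1 hs.2
    (fun r hr => ?_)).1 h1
  simp only [clampVelocity, clampTime_of_mem (Icc_subset_Icc_left hs.1 hr)]

/-- The chain satisfies the stochastic equation by construction; what existence still requires is
the consistency `hE` of `w` with its own flow. -/
lemma IsSchemeSolution.of_chainFlow [IsProbabilityMeasure P] (hd : IsPoissonDriver P τ ξ)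
    (hε : 0 < ε) {ν : ℝ} {w₀ : Plane → ℝ} {w : ℝ → Plane → ℝ} (hw : ContTimeCk 1 T w)
    (hv : Continuous (Function.uncurry (clampVelocity T w)))
    (hE : ∀ s ∈ Icc 0 T, ∀ x, w s x =
      ∫ ω, w₀ (chainFlow τ ξ ε T (2 * √(ε * ν)) (clampVelocity T w) s T x ω) ∂P) :
    IsSchemeSolution P τ ξ ν T w₀ ε
      (chainFlow τ ξ ε T (2 * √(ε * ν)) (clampVelocity T w)) w where
  measurable_flow _ _ _ _ x := hd.measurable_chainFlow hv x
  flow_eq s hs x := by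
    filter_upwards [hd.ae_good] with ω hg
    refine (flow_eq_iff (u := fun r => biotSavart (w r)) hg hε hs.1 hs.2 (fun r hr => ?_)).2
      (fun t _ => rfl)
    simp only [clampVelocity, clampTime_of_mem (Icc_subset_Icc_left hs.1 hr)]
  vorticity_eq := hE
  vorticity_regular := hw

end Paths

/-! ### The space `C([0,T]; C^k(𝕋²))` -/

section ContTime

variable {F G : Type*} [NormedAddCommGroup F] [NormedSpace ℝ F] [NormedAddCommGroup G]
  [NormedSpace ℝ G] {k : ℕ} {T : ℝ} {f : ℝ → Plane → F}

lemma ContTimeCk.tendstoUniformly (hf : ContTimeCk k T f) {s₀ : ℝ} (hs : s₀ ∈ Icc 0 T) :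
    TendstoUniformly f (f s₀) (𝓝[Icc 0 T] s₀) := by
  have h := (continuousMultilinearCurryFin0 ℝ Plane F).isometry.uniformContinuous.comp_tendstoUniformly
    (hf.2 0 (Nat.zero_le _) s₀ hs)
  have e : ∀ g : Plane → F, (continuousMultilinearCurryFin0 ℝ Plane F) ∘ iteratedFDeriv ℝ 0 g = g := by
    intro g
    rw [iteratedFDeriv_zero_eq_comp]
    ext x; simp
  simp only [e] at h
  exact h

/-- Uniform convergence in time and continuity in space combine into joint continuity; clamping
extends it to all times. -/
lemma ContTimeCk.continuous (hT : 0 ≤ T) (hf : ContTimeCk k T f) :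
    Continuous fun p : ℝ × Plane => f (clampTime T p.1) p.2 := by
  rw [continuous_iff_continuousAt]
  rintro ⟨s, x⟩
  have h1 : Tendsto (fun p : ℝ × Plane => clampTime T p.1) (𝓝 (s, x))
      (𝓝[Icc 0 T] (clampTime T s)) :=
    tendsto_nhdsWithin_iff.2 ⟨((continuous_clampTime T).comp continuous_fst).continuousAt,
      Eventually.of_forall fun p => clampTime_mem hT _⟩
  have h2 : TendstoUniformly (fun p : ℝ × Plane => f (clampTime T p.1)) (f (clampTime T s))
      (𝓝 (s, x)) := fun u hu => h1.eventually (hf.tendstoUniformly (clampTime_mem hT s) u hu)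
  exact h2.tendsto_comp ((hf.1 _ (clampTime_mem hT s)).2.continuous.continuousAt)
    (continuous_snd.tendsto (s, x))

lemma exists_norm_le_of_continuous_periodic {F : Type*} [NormedAddCommGroup F]
    {f : ℝ → Plane → F} (hT : 0 ≤ T)
    (hf : ∀ s ∈ Icc 0 T, TorusPeriodic (f s))
    (hc : Continuous fun p : ℝ × Plane => f (clampTime T p.1) p.2) :
    ∃ M, 0 ≤ M ∧ ∀ r x, ‖f (clampTime T r) x‖ ≤ M := by
  obtain ⟨M, hM⟩ := (isCompact_Icc.prod isCompact_torusCell).exists_bound_of_continuousOn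
    (hc.continuousOn (s := Icc 0 T ×ˢ torusCell))
  refine ⟨max M 0, le_max_right _ _, fun r x => ?_⟩
  obtain ⟨m, hm⟩ := exists_add_latticePoint_mem x
  have h1 := hM (clampTime T r, x + latticePoint m) ⟨clampTime_mem hT r, hm⟩
  simp only [clampTime_of_mem (clampTime_mem hT r), hf _ (clampTime_mem hT r) x m] at h1
  exact h1.trans (le_max_left _ _)

lemma ContTimeCk.exists_norm_le (hT : 0 ≤ T) (hf : ContTimeCk k T f) :
    ∃ M, 0 ≤ M ∧ ∀ r x, ‖f (clampTime T r) x‖ ≤ M :=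
  exists_norm_le_of_continuous_periodic hT (fun s hs => (hf.1 s hs).1) (hf.continuous hT)

lemma ContTimeCk.fderiv (hf : ContTimeCk (k + 1) T f) :
    ContTimeCk k T fun s => fderiv ℝ (f s) := by
  refine ⟨fun s hs => ⟨(hf.1 s hs).1.fderiv, ?_⟩, fun j hj s hs => ?_⟩
  · exact (hf.1 s hs).2.fderiv_right (by norm_cast)
  · have e : ∀ g : Plane → F, (continuousMultilinearCurryRightEquiv' ℝ j Plane F).symm.symm ∘
        iteratedFDeriv ℝ (j + 1) g = iteratedFDeriv ℝ j (_root_.fderiv ℝ g) := by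
      intro g
      ext1 x
      rw [Function.comp_apply, iteratedFDeriv_succ_eq_comp_right, Function.comp_apply,
        LinearIsometryEquiv.symm_symm, LinearIsometryEquiv.apply_symm_apply]
    have h := (continuousMultilinearCurryRightEquiv' ℝ j Plane F).symm.symm.isometry.uniformContinuous.comp_tendstoUniformly
      (hf.2 (j + 1) (by omega) s hs)
    simp only [e] at h
    exact h

lemma ContTimeCk.clm_comp (hf : ContTimeCk k T f) (L : F →L[ℝ] G) :
    ContTimeCk k T fun s x => L (f s x) := by
  refine ⟨fun s hs => ⟨fun x m => by simp only [(hf.1 s hs).1 x m],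
    L.contDiff.comp (hf.1 s hs).2⟩, fun j hj s hs => ?_⟩
  have h := (ContinuousLinearMap.uniformContinuous
    (ContinuousLinearMap.compContinuousMultilinearMapL ℝ (fun _ : Fin j => Plane) F G L)).comp_tendstoUniformly
      (hf.2 j hj s hs)
  have e : ∀ r ∈ Icc 0 T, iteratedFDeriv ℝ j (fun x => L (f r x)) =
      ContinuousLinearMap.compContinuousMultilinearMapL ℝ (fun _ : Fin j => Plane) F G L ∘
        iteratedFDeriv ℝ j (f r) := by
    intro r hr
    ext1 x
    exact L.iteratedFDeriv_comp_left (hf.1 r hr).2.contDiffAt (by exact_mod_cast hj)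
  rw [e s hs]
  intro u hu
  filter_upwards [h u hu, self_mem_nhdsWithin] with r hr hrT
  rw [e r hrT]
  exact hr

/-- Compactness of the cell turns joint continuity into uniform convergence there, and periodicity
spreads it over the plane. -/
lemma tendstoUniformly_of_continuous_periodic {F : Type*} [NormedAddCommGroup F]
    {f : ℝ → Plane → F} (hc : Continuous (Function.uncurry f))
    (hp : ∀ s, TorusPeriodic (f s)) (s : ℝ) : TendstoUniformly f (f s) (𝓝 s) := by
  have : CompactSpace torusCell := isCompact_iff_compactSpace.1 isCompact_torusCell
  have h : TendstoUniformly (fun (r : ℝ) (x : torusCell) => f r x) (fun x => f s x) (𝓝 s) := by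
    refine Continuous.tendstoUniformly (fun (r : ℝ) (x : torusCell) => f r x) ?_ s
    have := hc.comp (by fun_prop : Continuous fun p : ℝ × torusCell => (p.1, (p.2 : Plane)))
    exact this
  intro u hu
  filter_upwards [h u hu] with r hr x
  obtain ⟨m, hm⟩ := exists_add_latticePoint_mem x
  have := hr ⟨_, hm⟩
  simpa only [hp _ x m] using this

lemma contTimeCk_one {g : ℝ → Plane → Plane →L[ℝ] F} (hf : Continuous (Function.uncurry f))
    (hg : Continuous (Function.uncurry g)) (hd : ∀ s x, HasFDerivAt (f s) (g s x) x)
    (hpf : ∀ s, TorusPeriodic (f s)) (hpg : ∀ s, TorusPeriodic (g s)) : ContTimeCk 1 T f := by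
  have hfd : ∀ s, fderiv ℝ (f s) = g s := fun s => funext fun x => (hd s x).fderiv
  refine ⟨fun s _ => ⟨hpf s, ?_⟩, fun j hj s hs => ?_⟩
  · rw [Nat.cast_one, contDiff_one_iff_fderiv, hfd]
    exact ⟨fun x => (hd s x).differentiableAt, hg.comp (by fun_prop : Continuous fun x => (s, x))⟩
  · have h0 : ∀ {H : Type _} [NormedAddCommGroup H] [NormedSpace ℝ H] {q : ℝ → Plane → H},
        TendstoUniformly q (q s) (𝓝 s) →
        TendstoUniformly (fun s => iteratedFDeriv ℝ 0 (q s)) (iteratedFDeriv ℝ 0 (q s)) (𝓝 s) := by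
      intro H _ _ q hq
      simp only [iteratedFDeriv_zero_eq_comp]
      exact (continuousMultilinearCurryFin0 ℝ Plane H).symm.isometry.uniformContinuous.comp_tendstoUniformly hq
    suffices h : TendstoUniformly (fun s => iteratedFDeriv ℝ j (f s)) (iteratedFDeriv ℝ j (f s))
        (𝓝 s) from fun u hu => nhdsWithin_le_nhds (h u hu)
    interval_cases j
    · exact h0 (tendstoUniformly_of_continuous_periodic hf hpf s)
    · have h1 := h0 (tendstoUniformly_of_continuous_periodic hg hpg s)
      have := (continuousMultilinearCurryRightEquiv' ℝ 0 Plane F).symm.isometry.uniformContinuous.comp_tendstoUniformly h1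
      have e : ∀ r, (continuousMultilinearCurryRightEquiv' ℝ 0 Plane F).symm ∘
          iteratedFDeriv ℝ 0 (g r) = iteratedFDeriv ℝ (0 + 1) (f r) := by
        intro r
        ext1 x
        rw [iteratedFDeriv_succ_eq_comp_right, ← hfd]
      simp only [e] at this
      exact this

end ContTime

/-! ### Comparison of the scheme with a mild solution -/

section Comparison

variable {Ω : Type*} {mΩ : MeasurableSpace Ω} {P : Measure Ω} [IsProbabilityMeasure P]
  {τ : ℕ → Ω → ℝ} {ξ : ℕ → Ω → Plane} {ε ν s T h M : ℝ} {w₀ : Plane → ℝ}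

/-- If `V` solves a mild equation with right-hand side `B`, and `B` differs from the right-hand side
of the chain with velocity `v` by at most `l a exp (l (T - r))`, then `V s x` differs from the
expectation of `V T` along the chain by at most `a exp (l (T - s))`. -/
lemma IsPoissonDriver.abs_sub_integral_chainFlow_le (hd : IsPoissonDriver P τ ξ) (hε : 0 < ε)
    (hs : s ∈ Icc 0 T) {v : ℝ → Plane → Plane} (hv : Continuous (Function.uncurry v))
    {V : ℝ → Plane → ℝ} (hV : Continuous (Function.uncurry V)) (hM : ∀ r z, |V r z| ≤ M)
    {B : ℝ → Plane → ℝ} (hB : Continuous (Function.uncurry B))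
    (hVB : ∀ r ∈ Icc 0 T, ∀ z, V r z = mild ε T (V T z) (fun q => B q z) r) {a l : ℝ} (ha : 0 ≤ a)
    (hcmp : ∀ q ∈ Icc 0 T, ∀ z,
      |B q z - ε⁻¹ • stepMean h (V q) (z + ε • v q z)| ≤ l * (a * Real.exp (l * (T - q))))
    (x : Plane) :
    |V s x - ∫ ω, V T (chainFlow τ ξ ε T h v s T x ω) ∂P| ≤ a * Real.exp (l * (T - s)) := by
  refine hd.abs_sub_integral_le (y := fun r => a * Real.exp (l * (T - r))) hε hs.1 hs.2 hv hV hM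
    (by fun_prop) (fun r => by positivity) (fun r hr z => ?_) x
    (hd.eventually_jumpChain_eq hε (hs.1.trans hs.2) v x)
  have hr0 : r ∈ Icc 0 T := ⟨hs.1.trans hr.1, hr.2⟩
  have hBz : Continuous fun q => B q z := hB.comp (by fun_prop : Continuous fun q => (q, z))
  have hvz : Continuous fun q => z + ε • v q z := by
    have : Continuous fun q => v q z := hv.comp (by fun_prop : Continuous fun q => (q, z))
    fun_prop
  have hCz : Continuous fun q => ε⁻¹ • stepMean h (V q) (z + ε • v q z) := by
    have := (continuous_stepMean h hV hvz).const_smul ε⁻¹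
    exact this
  have hyc : Continuous fun q => a * Real.exp (l * (T - q)) := by fun_prop
  -- For `y = a exp (l (T - r))` the supersolution defect is the integral of `exp (-(q - r)/ε) l
  -- y(q)`. It dominates the corresponding integral of `B` minus the right-hand side of the chain.
  have h1 : mild ε T (a * Real.exp (l * (T - T)))
      (fun q => ε⁻¹ • (a * Real.exp (l * (T - q))) + l * (a * Real.exp (l * (T - q)))) r
        = a * Real.exp (l * (T - r)) :=
    mild_of_hasDerivAt (y := fun r => a * Real.exp (l * (T - r)))
      (z := fun r => l * (a * Real.exp (l * (T - r)))) hr.2 hyc.continuousOn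
      (fun q _ => hasDerivAt_mul_exp a l T q) (by fun_prop)
  conv_rhs => rw [← h1]
  rw [hVB r hr0, mild_sub hBz hCz, mild_sub (by fun_prop) (by fun_prop), sub_self, sub_self]
  unfold mild
  simp only [smul_zero, zero_add]
  rw [← Real.norm_eq_abs]
  refine intervalIntegral.norm_integral_le_of_norm_le hr.2 (ae_of_all _ fun q hq => ?_)
    (Continuous.intervalIntegrable (by fun_prop) _ _)
  rw [norm_smul, Real.norm_of_nonneg (Real.exp_pos _).le, smul_eq_mul, add_sub_cancel_left]
  exact mul_le_mul_of_nonneg_left (hcmp q ⟨hr0.1.trans hq.1.le, hq.2⟩ z) (Real.exp_pos _).le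

lemma continuous_clampVelocity (hT : 0 ≤ T) {k : ℕ} {w : ℝ → Plane → ℝ} (hw : ContTimeCk k T w) :
    Continuous (Function.uncurry (clampVelocity T w)) := by
  obtain ⟨M, -, hM⟩ := hw.exists_norm_le hT
  exact continuous_biotSavart (w := fun r => w (clampTime T r)) (hw.continuous hT) hM

/-- The stability estimate: the vorticity of the scheme is close to any mild solution `V` of its
equation up to an error `E`. -/
lemma IsSchemeSolution.abs_vorticity_sub_le (hd : IsPoissonDriver P τ ξ) (hε : 0 < ε)
    {X : ℝ → ℝ → Plane → Ω → Plane} {w : ℝ → Plane → ℝ}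
    (hX : IsSchemeSolution P τ ξ ν T w₀ ε X w)
    {V : ℝ → Plane → ℝ} (hV : Continuous (Function.uncurry V)) (hM : ∀ r z, |V r z| ≤ M)
    (hVT : V T = w₀) {B : ℝ → Plane → ℝ} (hB : Continuous (Function.uncurry B))
    (hVB : ∀ r ∈ Icc 0 T, ∀ z, V r z = mild ε T (V T z) (fun q => B q z) r) {E K : ℝ} (hE : 0 ≤ E)
    (hK : 0 ≤ K)
    (hcmp : ∀ q ∈ Icc 0 T, ∀ z b, ‖b‖ ≤ kernelMass * M →
      |B q z - ε⁻¹ • stepMean (2 * √(ε * ν)) (V q) (z + ε • b)|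
        ≤ E + K * ‖b - biotSavart (V q) z‖)
    (hs : s ∈ Icc 0 T) (x : Plane) :
    |V s x - w s x| ≤ 2 * E * Real.exp ((2 * K * kernelMass + 1) * (T - s)) := by
  have hT : 0 ≤ T := hs.1.trans hs.2
  have hM0 : 0 ≤ M := (abs_nonneg _).trans (hM 0 0)
  have hk := kernelMass_nonneg
  -- The summand `2 K kernelMass` halves the feedback of the velocity error and the summand `1`
  -- absorbs `E`, so that `E + K kernelMass m ≤ l (E + m/2)`.
  set l := 2 * K * kernelMass + 1 with hl
  have hl1 : 1 ≤ l := by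
    have : 0 ≤ 2 * K * kernelMass := by positivity
    linarith
  -- The vorticity is an average of `w₀`, so its velocity is bounded by `kernelMass * M`, the range
  -- of `b` in `hcmp`.
  have hwM : ∀ r ∈ Icc 0 T, ∀ z, |w r z| ≤ M := by
    intro r hr z
    rw [hX.vorticity_eq r hr z, ← Real.norm_eq_abs]
    have := norm_integral_le_of_norm_le_const (μ := P) (f := fun ω => w₀ (X r T z ω)) (C := M)
      (ae_of_all _ fun ω => by rw [← hVT]; exact hM _ _)
    simpa using this
  have hcw : ∀ r ∈ Icc 0 T, Continuous (w r) := fun r hr => (hX.vorticity_regular.1 r hr).2.continuous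
  have hcV : ∀ r, Continuous (V r) := fun r => hV.comp (by fun_prop : Continuous fun x => (r, x))
  have hE0 : ∀ r ∈ Icc 0 T, 1 ≤ Real.exp (l * (T - r)) := fun r hr =>
    Real.one_le_exp (mul_nonneg (by linarith) (by linarith [hr.2]))
  -- A bound `m` on the weighted error improves to `E + m/2`. Iterating from `2E + 2M` drives it to
  -- the fixed point `2E`, without using any derivative of `w`.
  have hstep : ∀ m, 0 ≤ m →
      (∀ r ∈ Icc 0 T, ∀ z, |V r z - w r z| ≤ m * Real.exp (l * (T - r))) →
      ∀ r ∈ Icc 0 T, ∀ z, |V r z - w r z| ≤ (E + m / 2) * Real.exp (l * (T - r)) := by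
    intro m hm hmw r hr z
    have h1 : w r z = ∫ ω, V T (chainFlow τ ξ ε T (2 * √(ε * ν)) (clampVelocity T w) r T z ω) ∂P := by
      rw [hX.vorticity_eq r hr z, hVT]
      refine integral_congr_ae ?_
      filter_upwards [hX.ae_eq_chainFlow hd hε hr z] with ω hω
      rw [hω T ⟨hr.2, le_rfl⟩]
    rw [h1]
    refine hd.abs_sub_integral_chainFlow_le hε hr (continuous_clampVelocity hT hX.vorticity_regular)
      hV hM hB hVB (by positivity) (fun q hq y => ?_) z
    simp only [clampVelocity, clampTime_of_mem hq]
    refine (hcmp q hq y _ (norm_biotSavart_le (hwM q hq) y)).trans ?_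
    have h2 : ‖biotSavart (w q) y - biotSavart (V q) y‖
        ≤ kernelMass * (m * Real.exp (l * (T - q))) :=
      norm_biotSavart_sub_le (hcw q hq) (hcV q) (hwM q hq) (hM q)
        (fun y => by rw [abs_sub_comm]; exact hmw q hq y) y
    have h3 := hE0 q hq
    calc E + K * ‖biotSavart (w q) y - biotSavart (V q) y‖
        ≤ E * Real.exp (l * (T - q)) + K * (kernelMass * (m * Real.exp (l * (T - q)))) := by
          gcongr
          exact le_mul_of_one_le_right hE h3
      _ = (E + K * kernelMass * m) * Real.exp (l * (T - q)) := by ring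
      _ ≤ (l * (E + m / 2)) * Real.exp (l * (T - q)) := by
          gcongr
          have h4 : E ≤ l * E := le_mul_of_one_le_left hE hl1
          have h5 : K * kernelMass * m ≤ l * (m / 2) := by rw [hl]; linarith
          linarith
      _ = _ := by ring
  have hall : ∀ n : ℕ, ∀ r ∈ Icc 0 T, ∀ z,
      |V r z - w r z| ≤ (2 * E + 2 * M * (1 / 2) ^ n) * Real.exp (l * (T - r)) := by
    intro n
    induction n with
    | zero =>
      intro r hr z
      have h1 := abs_sub (V r z) (w r z)
      have h2 := hM r z
      have h3 := hwM r hr z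
      have h4 := hE0 r hr
      calc _ ≤ 2 * E + 2 * M * (1 / 2) ^ 0 := by rw [pow_zero]; linarith
        _ ≤ _ := le_mul_of_one_le_right (by positivity) h4
    | succ n ih =>
      intro r hr z
      refine (hstep _ (by positivity) ih r hr z).trans (le_of_eq ?_)
      ring
  have hlim : Tendsto (fun n : ℕ => (2 * E + 2 * M * (1 / 2) ^ n) * Real.exp (l * (T - s))) atTop
      (𝓝 ((2 * E + 0) * Real.exp (l * (T - s)))) :=
    (tendsto_const_nhds.add (tendsto_const_mul_half_pow (2 * M))).mul_const _
  rw [add_zero] at hlim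
  exact ge_of_tendsto hlim (Eventually.of_forall fun n => hall n s hs x)

/-- The vorticity of the scheme, characterised independently of the random inputs. -/
lemma exists_scheme_vorticity (hε : 0 < ε) (hε1 : ε ≤ 1) (hT : 0 ≤ T) (hw₀ : ContDiff ℝ 2 w₀)
    (hp : TorusPeriodic w₀) (hd : IsPoissonDriver P τ ξ) :
    ∃ V, (∃ X, IsSchemeSolution P τ ξ ν T w₀ ε X V) ∧
      ∀ X w, IsSchemeSolution P τ ξ ν T w₀ ε X w → ∀ s ∈ Icc 0 T, w s = V s := by
  obtain ⟨M, Yb, Z, V, g, hV, hmild⟩ := exists_mild_vorticity hε hε1 hT (2 * √(ε * ν)) hw₀ hp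
  have hT' : T ∈ Icc 0 T := ⟨hT, le_rfl⟩
  have hVT : V T = w₀ := by
    funext x
    rw [hmild T hT' x]
    simp [mild]
  have hreg : ContTimeCk 1 T V := contTimeCk_one hV.continuous_fun hV.continuous_deriv hV.hasFDerivAt
    hV.periodic_fun hV.periodic_deriv
  have hB : Continuous (Function.uncurry fun q x => picardRhs ε (2 * √(ε * ν)) (V q) x) :=
    hV.continuous_picardRhs
  have hVB : ∀ r ∈ Icc 0 T, ∀ z, V r z = mild ε T (V T z)
      (fun q => picardRhs ε (2 * √(ε * ν)) (V q) z) r := fun r hr z => by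
    rw [hVT]; exact hmild r hr z
  refine ⟨V, ⟨_, IsSchemeSolution.of_chainFlow hd hε hreg (continuous_clampVelocity hT hreg)
    fun s hs x => ?_⟩, fun X w hX s hs => ?_⟩
  -- With its own velocity `V` solves the equation of the chain exactly, so the comparison has no
  -- defect and is an equality.
  · have h := hd.abs_sub_integral_chainFlow_le (a := 0) (l := 0) hε hs (continuous_clampVelocity hT hreg)
      hV.continuous_fun hV.bound_fun hB hVB le_rfl (h := 2 * √(ε * ν)) (fun q hq z => by
        simp only [clampVelocity, clampTime_of_mem hq, picardRhs, drift, sub_self, abs_zero, zero_mul,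
          le_refl]) x
    rw [zero_mul, hVT] at h
    exact sub_eq_zero.1 (abs_nonpos_iff.1 h)
  · funext x
    have hYb : 0 ≤ Yb := (norm_nonneg _).trans (hV.bound_deriv 0 0)
    -- There is no consistency error; changing the velocity by `δ` moves the argument by `ε δ` and,
    -- after the factor `ε⁻¹`, costs the Lipschitz constant `Yb` of `V`.
    have h := hX.abs_vorticity_sub_le hd hε hV.continuous_fun hV.bound_fun hVT hB hVB (E := 0)
      (K := Yb) le_rfl hYb (fun q hq z b _ => ?_) hs x
    · rw [mul_zero, zero_mul] at h
      exact (sub_eq_zero.1 (abs_nonpos_iff.1 h)).symm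
    · unfold picardRhs drift
      rw [← Real.norm_eq_abs, zero_add]
      have h1 := stepMean_sub (2 * √(ε * ν)) (V q) (V q) (z + ε • biotSavart (V q) z) (z + ε • b)
        (m := Yb * (ε * ‖b - biotSavart (V q) z‖)) (fun e => ?_)
      · refine (norm_smul_sub_smul_le (by positivity) h1).trans (le_of_eq ?_)
        field_simp
      · refine (norm_sub_le_of_hasFDerivAt (hV.hasFDerivAt q) (hV.bound_deriv q) _ _).trans
          (le_of_eq ?_)
        rw [show z + ε • biotSavart (V q) z + e - (z + ε • b + e)
          = -(ε • (b - biotSavart (V q) z)) by rw [smul_sub]; abel, norm_neg, norm_smul,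
          Real.norm_of_nonneg hε.le]

end Comparison

/-! ### Consistency of the generator -/

section Taylor

lemma abs_le_mul_of_hasDerivAt {f f' : ℝ → ℝ} {c h : ℝ} (hf : ∀ t, HasDerivAt f (f' t) t)
    (h0 : f 0 = 0) (hc : ∀ t ∈ Icc 0 h, |f' t| ≤ c) : ∀ t ∈ Icc 0 h, |f t| ≤ c * h := by
  intro t ht
  have hc0 : 0 ≤ c := (abs_nonneg _).trans (hc t ht)
  have := (convex_Icc (0 : ℝ) h).norm_image_sub_le_of_norm_hasDerivWithin_le
    (fun t _ => (hf t).hasDerivWithinAt) hc (x := 0) (y := t) ⟨le_rfl, ht.1.trans ht.2⟩ ht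
  rw [h0, sub_zero, sub_zero, Real.norm_eq_abs, Real.norm_of_nonneg ht.1] at this
  exact this.trans (by gcongr; exact ht.2)

lemma hasDerivAt_comp_line {F : Type*} [NormedAddCommGroup F] [NormedSpace ℝ F] {g : Plane → F}
    {g' : Plane → Plane →L[ℝ] F} (hg : ∀ x, HasFDerivAt g (g' x) x) (p e : Plane) (t : ℝ) :
    HasDerivAt (fun t : ℝ => g (p + t • e)) (g' (p + t • e) e) t := by
  have h : HasDerivAt (fun t : ℝ => p + t • e) ((1 : ℝ) • e) t :=
    ((hasDerivAt_id t).smul_const e).const_add p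
  rw [one_smul] at h
  exact (hg _).comp_hasDerivAt t h

/-- The third derivative `g₃(t) - g₃(-t)` of the even part is at most `2 K h`, and three
integrations from `0` give `h⁴`. A Lipschitz third derivative replaces a fourth one. -/
lemma abs_symm_diff_le {g g₁ g₂ g₃ : ℝ → ℝ} {K : ℝ} (h1 : ∀ t, HasDerivAt g (g₁ t) t)
    (h2 : ∀ t, HasDerivAt g₁ (g₂ t) t) (h3 : ∀ t, HasDerivAt g₂ (g₃ t) t)
    (l3 : ∀ s t, |g₃ s - g₃ t| ≤ K * |s - t|) (hK : 0 ≤ K) {h : ℝ} (hh : 0 ≤ h) :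
    |g h + g (-h) - 2 * g 0 - h ^ 2 * g₂ 0| ≤ 2 * K * h ^ 4 := by
  have neg : ∀ {u u' : ℝ → ℝ}, (∀ t, HasDerivAt u (u' t) t) →
      ∀ t, HasDerivAt (fun t => u (-t)) (-u' (-t)) t := fun hu t => by
    have := (hu (-t)).comp t (hasDerivAt_neg t)
    rw [mul_neg_one] at this
    exact this
  have e3 : ∀ t ∈ Icc 0 h, |g₃ t + -g₃ (-t)| ≤ 2 * K * h := by
    intro t ht
    refine (l3 t (-t)).trans ?_
    rw [sub_neg_eq_add, abs_of_nonneg (by linarith [ht.1])]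
    nlinarith [ht.2]
  have k2 := abs_le_mul_of_hasDerivAt (h := h) (f := fun t => g₂ t + g₂ (-t) - 2 * g₂ 0)
    (fun t => ((h3 t).add (neg h3 t)).sub_const _) (by simp; ring) e3
  have k1 := abs_le_mul_of_hasDerivAt (h := h) (f := fun t => g₁ t + -g₁ (-t) - t * (2 * g₂ 0))
    (fun t => by
      refine (((h2 t).add (neg h2 t).neg).sub ((hasDerivAt_id t).mul_const (2 * g₂ 0))).congr_deriv
        (g' := g₂ t + g₂ (-t) - 2 * g₂ 0) ?_
      ring) (by simp) k2
  have k0 := abs_le_mul_of_hasDerivAt (h := h)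
    (f := fun t => g t + g (-t) - 2 * g 0 - t ^ 2 * g₂ 0)
    (f' := fun t => g₁ t + -g₁ (-t) - t * (2 * g₂ 0))
    (fun t => by
      refine ((((h1 t).add (neg h1 t)).sub_const (2 * g 0)).sub
        ((hasDerivAt_pow 2 t).mul_const (g₂ 0))).congr_deriv ?_
      simp; ring) (by simp; ring) k1
  exact (k0 h ⟨hh, le_rfl⟩).trans (le_of_eq (by ring))

lemma norm_planeBasis_eq_one (i : Fin 2) : ‖planeBasis i‖ = 1 := by simp [planeBasis]

/-- The generator of the chain approximates `νΔ + a·∇`. -/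
lemma abs_generator_sub_le {f : Plane → ℝ} {D₁ : Plane → Plane →L[ℝ] ℝ}
    {D₂ : Plane → Plane →L[ℝ] Plane →L[ℝ] ℝ} {E : Fin 2 → Plane → Plane →L[ℝ] ℝ} {K : ℝ}
    (h1 : ∀ x, HasFDerivAt f (D₁ x) x) (h2 : ∀ x, HasFDerivAt D₁ (D₂ x) x)
    (h3 : ∀ i x, HasFDerivAt (fun x => D₂ x (planeBasis i) (planeBasis i)) (E i x) x)
    (l1 : ∀ x y, ‖D₁ x - D₁ y‖ ≤ K * ‖x - y‖)
    (l2 : ∀ i x y, ‖D₂ x (planeBasis i) (planeBasis i) - D₂ y (planeBasis i) (planeBasis i)‖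
      ≤ K * ‖x - y‖)
    (l3 : ∀ i x y, ‖E i x - E i y‖ ≤ K * ‖x - y‖) (hK : 0 ≤ K) {ε ν : ℝ} (hε : 0 < ε) (hν : 0 ≤ ν)
    (p a : Plane) :
    |(ε⁻¹ • f p + (ν * ∑ i, D₂ p (planeBasis i) (planeBasis i) + D₁ p a))
      - ε⁻¹ • stepMean (2 * √(ε * ν)) f (p + ε • a)|
      ≤ ε * (K * (16 * ν ^ 2 + 2 * ν * ‖a‖ + ‖a‖ ^ 2)) := by
  set h := 2 * √(ε * ν) with hh
  have hh0 : 0 ≤ h := by positivity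
  have hh2 : h ^ 2 = 4 * (ε * ν) := by
    rw [hh, mul_pow, Real.sq_sqrt (by positivity)]; norm_num
  set q := p + ε • a with hq
  have hqp : ‖q - p‖ = ε * ‖a‖ := by
    rw [hq, add_sub_cancel_left, norm_smul, Real.norm_of_nonneg hε.le]
  have hsymm : ∀ i, |f (q + h • planeBasis i) + f (q + h • -planeBasis i) - 2 * f q
      - 4 * (ε * ν) * D₂ q (planeBasis i) (planeBasis i)| ≤ 2 * K * (4 * (ε * ν)) ^ 2 := by
    intro i
    set e := planeBasis i with he
    have d2 : ∀ t, HasDerivAt (fun t : ℝ => D₁ (q + t • e) e) (D₂ (q + t • e) e e) t := fun t => by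
      simpa using (hasDerivAt_comp_line h2 q e t).clm_apply (hasDerivAt_const t e)
    have := abs_symm_diff_le (fun t => hasDerivAt_comp_line h1 q e t) d2
      (fun t => hasDerivAt_comp_line (h3 i) q e t) (K := K) (fun s t => ?_) hK hh0
    · simp only [zero_smul, add_zero, neg_smul] at this
      rw [show h ^ 4 = (h ^ 2) ^ 2 by ring, hh2] at this
      rw [smul_neg]
      exact this
    · have b1 := ContinuousLinearMap.le_opNorm (E i (q + s • e) - E i (q + t • e)) e
      rw [he, norm_planeBasis_eq_one, mul_one, ← he] at b1
      refine b1.trans ((l3 i _ _).trans (le_of_eq ?_))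
      rw [add_sub_add_left_eq_sub, ← sub_smul, norm_smul, he, norm_planeBasis_eq_one, mul_one,
        Real.norm_eq_abs]
  have s0 := hsymm 0
  have s1 := hsymm 1
  have t2 : ∀ i, |D₂ q (planeBasis i) (planeBasis i) - D₂ p (planeBasis i) (planeBasis i)|
      ≤ K * (ε * ‖a‖) := by
    intro i
    have := l2 i q p
    rwa [hqp] at this
  have t1 : |f q - f p - ε * D₁ p a| ≤ K * (ε * ‖a‖) * ‖a‖ * ε := by
    have := abs_le_mul_of_hasDerivAt (h := ε) (c := K * (ε * ‖a‖) * ‖a‖)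
      (f := fun t => f (p + t • a) - f p - t * D₁ p a)
      (f' := fun t => D₁ (p + t • a) a - 1 * D₁ p a)
      (fun t => ((hasDerivAt_comp_line h1 p a t).sub_const (f p)).sub
        ((hasDerivAt_id t).mul_const _)) (by simp) (fun t ht => by
        rw [one_mul, ← Real.norm_eq_abs]
        have b1 := ContinuousLinearMap.le_opNorm (D₁ (p + t • a) - D₁ p) a
        have b2 := l1 (p + t • a) p
        rw [add_sub_cancel_left, norm_smul, Real.norm_of_nonneg ht.1] at b2
        have b3 : K * (t * ‖a‖) ≤ K * (ε * ‖a‖) := by gcongr; exact ht.2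
        exact b1.trans (mul_le_mul_of_nonneg_right (b2.trans b3) (norm_nonneg _)))
    exact this ε ⟨hε.le, le_rfl⟩
  -- Three errors, each `O(ε²)` before the factor `ε⁻¹`: the symmetric differences at `q = p + ε a`,
  -- the move of the second derivatives from `q` to `p`, and the expansion of `f` along the drift.
  -- As `h² = 4εν`, the mean over four points contributes `¼ · 4εν Δ = ενΔ`.
  have key : (ε⁻¹ • f p + (ν * ∑ i, D₂ p (planeBasis i) (planeBasis i) + D₁ p a))
      - ε⁻¹ • stepMean h f q = -(ε⁻¹ * (4⁻¹ * ((f (q + h • planeBasis 0) + f (q + h • -planeBasis 0)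
        - 2 * f q - 4 * (ε * ν) * D₂ q (planeBasis 0) (planeBasis 0))
        + (f (q + h • planeBasis 1) + f (q + h • -planeBasis 1)
        - 2 * f q - 4 * (ε * ν) * D₂ q (planeBasis 1) (planeBasis 1)))
        + ε * ν * ((D₂ q (planeBasis 0) (planeBasis 0) - D₂ p (planeBasis 0) (planeBasis 0))
          + (D₂ q (planeBasis 1) (planeBasis 1) - D₂ p (planeBasis 1) (planeBasis 1)))
        + (f q - f p - ε * D₁ p a))) := by
    simp only [stepMean, Fin.sum_univ_two, smul_eq_mul]
    field_simp
    ring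
  rw [key, abs_neg, abs_mul, abs_of_pos (inv_pos.2 hε), inv_mul_le_iff₀ hε]
  have u0 := t2 0
  have u1 := t2 1
  generalize f (q + h • planeBasis 0) + f (q + h • -planeBasis 0)
        - 2 * f q - 4 * (ε * ν) * D₂ q (planeBasis 0) (planeBasis 0) = A0 at *
  generalize f (q + h • planeBasis 1) + f (q + h • -planeBasis 1)
        - 2 * f q - 4 * (ε * ν) * D₂ q (planeBasis 1) (planeBasis 1) = A1 at *
  generalize D₂ q (planeBasis 0) (planeBasis 0) - D₂ p (planeBasis 0) (planeBasis 0) = B0 at *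
  generalize D₂ q (planeBasis 1) (planeBasis 1) - D₂ p (planeBasis 1) (planeBasis 1) = B1 at *
  generalize f q - f p - ε * D₁ p a = C at *
  have v1 : |4⁻¹ * (A0 + A1)| ≤ 16 * K * (ε * ν) ^ 2 := by
    rw [abs_mul, abs_of_pos (by norm_num : (0 : ℝ) < 4⁻¹)]
    have := abs_add_le A0 A1
    linarith
  have v2 : |ε * ν * (B0 + B1)| ≤ ε * ν * (2 * (K * (ε * ‖a‖))) := by
    rw [abs_mul, abs_of_nonneg (by positivity : 0 ≤ ε * ν)]
    have := abs_add_le B0 B1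
    gcongr
    linarith
  refine (abs_add_le _ _).trans ((add_le_add ((abs_add_le _ _).trans (add_le_add v1 v2)) t1).trans
    (le_of_eq (by ring)))

end Taylor

/-! ### Differentiation under a time integral -/

lemma hasFDerivAt_intervalIntegral {E F : Type*} [NormedAddCommGroup E] [NormedSpace ℝ E]
    [ProperSpace E] [NormedAddCommGroup F] [NormedSpace ℝ F]
    {s T : ℝ} {B : ℝ → E → F} {B' : ℝ → E → E →L[ℝ] F} {K : ℝ}
    (hB : Continuous (Function.uncurry B)) (hB' : Continuous (Function.uncurry B'))
    (hd : ∀ r x, HasFDerivAt (B r) (B' r x) x) (hK : ∀ r x, ‖B' r x‖ ≤ K) (x : E) :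
    HasFDerivAt (fun x => ∫ r in s..T, B r x) (∫ r in s..T, B' r x) x := by
  have hBx : ∀ x, Continuous fun r => B r x := fun x =>
    hB.comp (by fun_prop : Continuous fun r => (r, x))
  have hB'x : Continuous fun r => B' r x := hB'.comp (by fun_prop : Continuous fun r => (r, x))
  exact intervalIntegral.hasFDerivAt_integral_of_dominated_of_fderiv_le (s := univ)
    (bound := fun _ => K) (F' := fun x r => B' r x)
    univ_mem (Eventually.of_forall fun x => (hBx x).aestronglyMeasurable)
    ((hBx x).intervalIntegrable _ _) hB'x.aestronglyMeasurable (ae_of_all _ fun r _ x _ => hK r x)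
    intervalIntegrable_const (ae_of_all _ fun r _ x _ => hd r x)

/-! ### The right-hand side of the Navier–Stokes equation and its curl -/

section Curl

/-- The curl as a linear form of the derivative. -/
def curlForm : (Plane →L[ℝ] Plane) →L[ℝ] ℝ :=
  (coordForm 1).comp (ContinuousLinearMap.apply ℝ Plane (planeBasis 0))
    - (coordForm 0).comp (ContinuousLinearMap.apply ℝ Plane (planeBasis 1))

lemma curlForm_apply (A : Plane →L[ℝ] Plane) :
    curlForm A = A (planeBasis 0) 1 - A (planeBasis 1) 0 := rfl

lemma planeCurl_eq_curlForm (v : Plane → Plane) (x : Plane) :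
    planeCurl v x = curlForm (fderiv ℝ v x) := rfl

variable {F : Type*} [NormedAddCommGroup F] [NormedSpace ℝ F]

lemma hasFDerivAt_fderiv {g : Plane → F} (hg : ContDiff ℝ 2 g) (x : Plane) :
    HasFDerivAt (fderiv ℝ g) (fderiv ℝ (fderiv ℝ g) x) x :=
  ((hg.fderiv_right (m := 1) (by norm_num)).differentiable one_ne_zero x).hasFDerivAt

lemma fderiv_fderiv_symm {g : Plane → F} (hg : ContDiff ℝ 2 g) (x v w : Plane) :
    fderiv ℝ (fderiv ℝ g) x v w = fderiv ℝ (fderiv ℝ g) x w v :=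
  (hg.contDiffAt.isSymmSndFDerivAt (by simp)) v w

lemma hasFDerivAt_fderiv_apply {g : Plane → F} (hg : ContDiff ℝ 2 g) (x e : Plane) :
    HasFDerivAt (fun y => fderiv ℝ g y e) (fderiv ℝ (fderiv ℝ g) x e) x := by
  refine ((hasFDerivAt_fderiv hg x).clm_apply (hasFDerivAt_const e x)).congr_fderiv ?_
  ext1 v
  simp [fderiv_fderiv_symm hg x v e]

lemma fderiv_fderiv_apply {g : Plane → F} (hg : ContDiff ℝ 2 g) (x e : Plane) :
    fderiv ℝ (fun y => fderiv ℝ g y e) x = fderiv ℝ (fderiv ℝ g) x e :=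
  (hasFDerivAt_fderiv_apply hg x e).fderiv

lemma laplacian_eq_sum {g : Plane → F} (x : Plane) :
    Laplacian.laplacian g x
      = ∑ i, fderiv ℝ (fderiv ℝ g) x (planeBasis i) (planeBasis i) := by
  rw [InnerProductSpace.laplacian_eq_iteratedFDeriv_orthonormalBasis g
    (EuclideanSpace.basisFun (Fin 2) ℝ)]
  simp [iteratedFDeriv_two_apply, planeBasis]

lemma contDiff_curl {n : ℕ} {v : Plane → Plane} (hv : ContDiff ℝ (n + 1) v) :
    ContDiff ℝ n (planeCurl v) :=
  curlForm.contDiff.comp (hv.fderiv_right (m := n) le_rfl)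

/-- The curl commutes with directional derivatives. -/
lemma fderiv_planeCurl {v : Plane → Plane} (hv : ContDiff ℝ 2 v) (x e : Plane) :
    fderiv ℝ (planeCurl v) x e = curlForm (fderiv ℝ (fderiv ℝ v) x e) := by
  have h : HasFDerivAt (planeCurl v) (curlForm.comp (fderiv ℝ (fderiv ℝ v) x)) x :=
    curlForm.hasFDerivAt.comp x (hasFDerivAt_fderiv hv x)
  rw [h.fderiv]; rfl

lemma planeCurl_fderiv_apply {v : Plane → Plane} (hv : ContDiff ℝ 2 v) (e : Plane) :
    planeCurl (fun y => fderiv ℝ v y e) = fun x => fderiv ℝ (planeCurl v) x e := by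
  funext x
  rw [fderiv_planeCurl hv, planeCurl_eq_curlForm, fderiv_fderiv_apply hv]

/-- The right-hand side of the Navier–Stokes equation without pressure. -/
def nseRhs (ν : ℝ) (v : Plane → Plane) (x : Plane) : Plane :=
  ν • ∑ i, fderiv ℝ (fderiv ℝ v) x (planeBasis i) (planeBasis i) + fderiv ℝ v x (v x)

/-- The derivative of `nseRhs`. -/
def nseRhsDeriv (ν : ℝ) (v : Plane → Plane) (x : Plane) : Plane →L[ℝ] Plane :=
  ν • ∑ i, fderiv ℝ (fun y => fderiv ℝ (fderiv ℝ v) y (planeBasis i) (planeBasis i)) x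
    + ((fderiv ℝ v x).comp (fderiv ℝ v x) + (fderiv ℝ (fderiv ℝ v) x).flip (v x))

lemma fderiv_fderiv_apply_apply {g : Plane → F} (hg : ContDiff ℝ 2 g) (e : Plane) :
    (fun y => fderiv ℝ (fderiv ℝ g) y e e)
      = fun y => fderiv ℝ (fun z => fderiv ℝ g z e) y e := by
  funext y
  rw [fderiv_fderiv_apply hg]

lemma contDiff_fderiv_apply {n : ℕ} {g : Plane → F} (hg : ContDiff ℝ (n + 1) g) (e : Plane) :
    ContDiff ℝ n fun y => fderiv ℝ g y e :=
  (hg.fderiv_right (m := n) le_rfl).clm_apply contDiff_const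

lemma hasFDerivAt_nseRhs (ν : ℝ) {v : Plane → Plane} (hv : ContDiff ℝ 3 v) (x : Plane) :
    HasFDerivAt (nseRhs ν v) (nseRhsDeriv ν v x) x := by
  have hv2 : ContDiff ℝ 2 v := hv.of_le (by norm_num)
  unfold nseRhs nseRhsDeriv
  refine HasFDerivAt.add (HasFDerivAt.const_smul (HasFDerivAt.fun_sum fun i _ => ?_) ν) ?_
  · rw [fderiv_fderiv_apply_apply hv2]
    have h1 : ContDiff ℝ 2 fun y => fderiv ℝ v y (planeBasis i) := contDiff_fderiv_apply (n := 2) hv _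
    have h2 : ContDiff ℝ 1 fun y => fderiv ℝ (fun z => fderiv ℝ v z (planeBasis i)) y (planeBasis i) :=
      contDiff_fderiv_apply (n := 1) h1 _
    exact (h2.differentiable one_ne_zero x).hasFDerivAt
  · exact (hasFDerivAt_fderiv hv2 x).clm_apply (hv2.differentiable two_ne_zero x).hasFDerivAt

/-- In dimension two `A² = tr(A) A - det(A)`, and the identity has no curl. For a divergence-free
field this is the absence of vortex stretching. -/
lemma curlForm_comp_self (A : Plane →L[ℝ] Plane) :
    curlForm (A.comp A) = (A (planeBasis 0) 0 + A (planeBasis 1) 1) * curlForm A := by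
  simp only [curlForm_apply, ContinuousLinearMap.comp_apply]
  rw [map_plane_eq A (A (planeBasis 0)), map_plane_eq A (A (planeBasis 1))]
  simp only [PiLp.add_apply, PiLp.smul_apply, smul_eq_mul]
  ring

/-- The curl of the right-hand side of the Navier–Stokes equation. -/
lemma curlForm_nseRhsDeriv (ν : ℝ) {v : Plane → Plane} (hv : ContDiff ℝ 3 v) {x : Plane}
    (hdiv : planeDiv v x = 0) :
    curlForm (nseRhsDeriv ν v x)
      = ν * ∑ i, fderiv ℝ (fderiv ℝ (planeCurl v)) x (planeBasis i) (planeBasis i)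
        + fderiv ℝ (planeCurl v) x (v x) := by
  have hv2 : ContDiff ℝ 2 v := hv.of_le (by norm_num)
  have hc2 : ContDiff ℝ 2 (planeCurl v) := contDiff_curl (n := 2) hv
  unfold nseRhsDeriv
  rw [map_add, map_add, map_smul, map_sum, curlForm_comp_self]
  have h0 : fderiv ℝ v x (planeBasis 0) 0 + fderiv ℝ v x (planeBasis 1) 1 = 0 := by
    simpa [planeDiv, partialDeriv, Fin.sum_univ_two] using hdiv
  have h1 : (fderiv ℝ (fderiv ℝ v) x).flip (v x) = fderiv ℝ (fderiv ℝ v) x (v x) := by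
    ext1 w
    exact fderiv_fderiv_symm hv2 x w (v x)
  rw [h0, zero_mul, zero_add, h1, ← fderiv_planeCurl hv2, smul_eq_mul]
  congr 2
  refine Finset.sum_congr rfl fun i _ => ?_
  have h2 : ContDiff ℝ 2 fun y => fderiv ℝ v y (planeBasis i) := contDiff_fderiv_apply (n := 2) hv _
  rw [fderiv_fderiv_apply_apply hv2, ← planeCurl_eq_curlForm, planeCurl_fderiv_apply h2,
    planeCurl_fderiv_apply hv2]
  beta_reduce
  rw [fderiv_fderiv_apply hc2]

/-- The components of the right-hand side are in divergence form. -/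
lemma nseRhs_apply (ν : ℝ) {v : Plane → Plane} {x : Plane} (hdiv : planeDiv v x = 0) (j : Fin 2) :
    nseRhs ν v x j = ∑ i, (ν * fderiv ℝ (fderiv ℝ v) x (planeBasis i) (planeBasis i) j
      + (fderiv ℝ v x (planeBasis i) i * v x j + v x i * fderiv ℝ v x (planeBasis i) j)) := by
  have h0 : fderiv ℝ v x (planeBasis 0) 0 + fderiv ℝ v x (planeBasis 1) 1 = 0 := by
    simpa [planeDiv, partialDeriv, Fin.sum_univ_two] using hdiv
  unfold nseRhs
  rw [map_plane_eq (fderiv ℝ v x) (v x)]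
  simp only [Fin.sum_univ_two, PiLp.add_apply, PiLp.smul_apply, smul_eq_mul]
  linear_combination (-v x j) * h0

lemma TorusPeriodic.nseRhsDeriv (ν : ℝ) {v : Plane → Plane} (hv : TorusPeriodic v) :
    TorusPeriodic (nseRhsDeriv ν v) := by
  intro x m
  have h1 := hv.fderiv
  have h2 := h1.fderiv
  have h3 : ∀ i, TorusPeriodic
      (_root_.fderiv ℝ (fun y => _root_.fderiv ℝ (_root_.fderiv ℝ v) y (planeBasis i) (planeBasis i))) :=
    fun i => TorusPeriodic.fderiv fun x m => by simp only [h2 x m]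
  simp only [_root_.nseRhsDeriv, h1 x m, h2 x m, hv x m, h3 _ x m]

end Curl

/-! ### The vorticity of a solution of the backward Navier–Stokes equation -/

section NSE

variable {ν T : ℝ} {φ : Plane → Plane} {u : ℝ → Plane → Plane} {p : ℝ → Plane → ℝ}

lemma gradient_apply {q : Plane → ℝ} (x : Plane) (j : Fin 2) :
    gradient q x j = fderiv ℝ q x (planeBasis j) := by
  have h := InnerProductSpace.toDual_symm_apply (𝕜 := ℝ) (x := planeBasis j) (y := fderiv ℝ q x)
  rw [← h, gradient, planeBasis, EuclideanSpace.inner_single_right]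
  simp

lemma continuous_nseRhs (hT : 0 ≤ T) (hu : ContTimeCk 5 T u) :
    Continuous fun q : ℝ × Plane => nseRhs ν (u (clampTime T q.1)) q.2 := by
  have c0 := hu.continuous hT
  have c1 := (ContTimeCk.fderiv (k := 4) hu).continuous hT
  have c2 := (ContTimeCk.fderiv (k := 3) (ContTimeCk.fderiv (k := 4) hu)).continuous hT
  have c3 := c1.clm_apply c0
  have c4 : ∀ i, Continuous fun q : ℝ × Plane =>
      fderiv ℝ (fderiv ℝ (u (clampTime T q.1))) q.2 (planeBasis i) (planeBasis i) := fun i =>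
    (c2.clm_apply continuous_const).clm_apply continuous_const
  unfold nseRhs
  exact ((continuous_finsetSum _ fun i _ => c4 i).const_smul ν).add c3

lemma continuous_nseRhsDeriv (hT : 0 ≤ T) (hu : ContTimeCk 5 T u) :
    Continuous fun q : ℝ × Plane => nseRhsDeriv ν (u (clampTime T q.1)) q.2 := by
  have c0 := hu.continuous hT
  have h1 := ContTimeCk.fderiv (k := 4) hu
  have h2 := ContTimeCk.fderiv (k := 3) h1
  have c1 := h1.continuous hT
  have c2 := h2.continuous hT
  have c3 : ∀ i, Continuous fun q : ℝ × Plane => fderiv ℝ (fun y => fderiv ℝ (fderiv ℝ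
      (u (clampTime T q.1))) y (planeBasis i) (planeBasis i)) q.2 := by
    intro i
    have := (ContTimeCk.fderiv (k := 2) (h2.clm_comp
      ((ContinuousLinearMap.apply ℝ Plane (planeBasis i)).comp
        (ContinuousLinearMap.apply ℝ (Plane →L[ℝ] Plane) (planeBasis i))))).continuous hT
    exact this
  have c4 : Continuous fun q : ℝ × Plane => (fderiv ℝ (fderiv ℝ (u (clampTime T q.1))) q.2).flip :=
    (ContinuousLinearMap.flipₗᵢ ℝ Plane Plane Plane).continuous.comp c2
  have c5 : Continuous fun q : ℝ × Plane => (fderiv ℝ (fderiv ℝ (u (clampTime T q.1))) q.2).flip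
      (u (clampTime T q.1) q.2) := c4.clm_apply c0
  have c6 : Continuous fun q : ℝ × Plane => (fderiv ℝ (u (clampTime T q.1)) q.2).comp
      (fderiv ℝ (u (clampTime T q.1)) q.2) := c1.clm_comp c1
  unfold nseRhsDeriv
  exact ((continuous_finsetSum _ fun i _ => c3 i).const_smul ν).add (c6.add c5)

/-- The integrated equation. -/
lemma nse_integral (hT : 0 ≤ T) (hu : ContTimeCk 5 T u) (hp : ContTimeCk 1 T p)
    (heq : ∀ s ∈ Icc 0 T, ∀ x : Plane, HasDerivWithinAt (fun r => u r x)
        (-(ν • Laplacian.laplacian (u s) x + fderiv ℝ (u s) x (u s x) + gradient (p s) x))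
        (Icc 0 T) s) {s : ℝ} (hs : s ∈ Icc 0 T) (x : Plane) (j : Fin 2) :
    u s x j - u T x j - (∫ r in s..T, nseRhs ν (u (clampTime T r)) x) j
      = (∫ r in s..T, fderiv ℝ (p (clampTime T r)) x) (planeBasis j) := by
  have cx : Continuous fun r : ℝ => (r, x) := by fun_prop
  have cR : Continuous fun r : ℝ => nseRhs ν (u (clampTime T r)) x := by
    have := (continuous_nseRhs (ν := ν) hT hu).comp cx
    simp only [Function.comp_def] at this
    exact this
  have cP : Continuous fun r : ℝ => fderiv ℝ (p (clampTime T r)) x := by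
    have := ((ContTimeCk.fderiv (k := 0) hp).continuous hT).comp cx
    simp only [Function.comp_def] at this
    exact this
  have cu : ContinuousOn (fun r => u r x j) (Icc s T) := by
    have : ContinuousOn (fun r => u r x) (Icc s T) := fun r hr =>
      (heq r ⟨hs.1.trans hr.1, hr.2⟩ x).continuousWithinAt.mono (Icc_subset_Icc_left hs.1)
    fun_prop
  have hd : ∀ r ∈ Ioo s T, HasDerivAt (fun r => u r x j)
      (-(nseRhs ν (u (clampTime T r)) x j + fderiv ℝ (p (clampTime T r)) x (planeBasis j))) r := by
    intro r hr
    have hr' : r ∈ Icc 0 T := ⟨hs.1.trans hr.1.le, hr.2.le⟩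
    have h1 := (heq r hr' x).hasDerivAt (Icc_mem_nhds (hs.1.trans_lt hr.1) hr.2)
    have h2 := (coordForm j).hasFDerivAt.comp_hasDerivAt r h1
    refine h2.congr_deriv ?_
    rw [clampTime_of_mem hr', coordForm_apply, laplacian_eq_sum, PiLp.neg_apply, PiLp.add_apply,
      gradient_apply]
    rfl
  have h := intervalIntegral.integral_eq_sub_of_hasDerivAt_of_le hs.2 cu hd
    (Continuous.intervalIntegrable (by fun_prop) _ _)
  rw [intervalIntegral.integral_neg, intervalIntegral.integral_add
    (Continuous.intervalIntegrable (by fun_prop) _ _)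
    (Continuous.intervalIntegrable (by fun_prop) _ _)] at h
  have e1 : (∫ r in s..T, nseRhs ν (u (clampTime T r)) x) j
      = ∫ r in s..T, nseRhs ν (u (clampTime T r)) x j :=
    ((coordForm j).intervalIntegral_comp_comm (cR.intervalIntegrable _ _)).symm
  have e2 : (∫ r in s..T, fderiv ℝ (p (clampTime T r)) x) (planeBasis j)
      = ∫ r in s..T, fderiv ℝ (p (clampTime T r)) x (planeBasis j) :=
    ContinuousLinearMap.intervalIntegral_apply (cP.intervalIntegrable _ _) _
  rw [e1, e2]
  linarith

/-- The vorticity equation, integrated in time. -/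
lemma curl_nse_integral (hT : 0 ≤ T) (hu : ContTimeCk 5 T u) (hp : ContTimeCk 1 T p)
    (heq : ∀ s ∈ Icc 0 T, ∀ x : Plane, HasDerivWithinAt (fun r => u r x)
        (-(ν • Laplacian.laplacian (u s) x + fderiv ℝ (u s) x (u s x) + gradient (p s) x))
        (Icc 0 T) s) {s : ℝ} (hs : s ∈ Icc 0 T) (x : Plane) :
    planeCurl (u s) x = planeCurl (u T) x
      + ∫ r in s..T, curlForm (nseRhsDeriv ν (u (clampTime T r)) x) := by
  have hT' : T ∈ Icc 0 T := ⟨hT, le_rfl⟩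
  have cR' := continuous_nseRhsDeriv (ν := ν) hT hu
  have hp1 := ContTimeCk.fderiv (k := 0) hp
  obtain ⟨K, -, hK⟩ := exists_norm_le_of_continuous_periodic
    (f := fun s => nseRhsDeriv ν (u s)) hT (fun s hs => (hu.1 s hs).1.nseRhsDeriv ν) cR'
  obtain ⟨K', -, hK'⟩ := hp1.exists_norm_le hT
  have hu3 : ∀ r, ContDiff ℝ 3 (u (clampTime T r)) := fun r =>
    (hu.1 _ (clampTime_mem hT r)).2.of_le (by norm_num)
  have hdR := hasFDerivAt_intervalIntegral (s := s) (T := T)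
    (B := fun r => nseRhs ν (u (clampTime T r))) (B' := fun r => nseRhsDeriv ν (u (clampTime T r)))
    (continuous_nseRhs hT hu) cR' (fun r x => hasFDerivAt_nseRhs ν (hu3 r) x) hK
  have hdP := hasFDerivAt_intervalIntegral (s := s) (T := T) (B := fun r => p (clampTime T r))
    (B' := fun r => fderiv ℝ (p (clampTime T r)))
    (hp.continuous hT) (hp1.continuous hT)
    (fun r x => ((hp.1 _ (clampTime_mem hT r)).2.differentiable (by norm_num) x).hasFDerivAt) hK'
  have hdu : ∀ r ∈ Icc 0 T, ∀ y, HasFDerivAt (u r) (fderiv ℝ (u r) y) y := fun r hr y =>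
    ((hu.1 r hr).2.differentiable (by norm_num) y).hasFDerivAt
  -- The pressure is only `C¹`, so `∇p` cannot be differentiated at a fixed time. Integrated over
  -- `[s,T]`, it is the gradient of `∫ p` and equals the differentiable field `F`. The symmetry of
  -- the second derivative of `∫ p` then says that `F` has no curl.
  set F : Plane → Plane := fun y => u s y - u T y - ∫ r in s..T, nseRhs ν (u (clampTime T r)) y with hF
  set F' : Plane → Plane →L[ℝ] Plane := fun y => fderiv ℝ (u s) y - fderiv ℝ (u T) y
    - ∫ r in s..T, nseRhsDeriv ν (u (clampTime T r)) y with hF'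
  have hdF : ∀ y, HasFDerivAt F (F' y) y := fun y =>
    ((hdu s hs y).sub (hdu T hT' y)).sub (hdR y)
  set Q : Plane → Plane →L[ℝ] ℝ := fun y => ∫ r in s..T, fderiv ℝ (p (clampTime T r)) y with hQ
  have hQF : Q = fun y => F y 0 • coordForm 0 + F y 1 • coordForm 1 := by
    funext y
    ext1 z
    rw [map_plane_eq (Q y) z, ← nse_integral hT hu hp heq hs y 0, ← nse_integral hT hu hp heq hs y 1]
    simp [hF, mul_comm]
  have hdQ : HasFDerivAt Q (((coordForm 0).comp (F' x)).smulRight (coordForm 0)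
      + ((coordForm 1).comp (F' x)).smulRight (coordForm 1)) x := by
    rw [hQF]
    exact (((coordForm 0).hasFDerivAt.comp x (hdF x)).smul_const (coordForm 0)).add
      (((coordForm 1).hasFDerivAt.comp x (hdF x)).smul_const (coordForm 1))
  have hsym := second_derivative_symmetric hdP hdQ (planeBasis 0) (planeBasis 1)
  have hcurl : curlForm (F' x) = 0 := by
    simp [planeBasis] at hsym
    rw [curlForm_apply, planeBasis, planeBasis, hsym, sub_self]
  have hint : curlForm (∫ r in s..T, nseRhsDeriv ν (u (clampTime T r)) x)
      = ∫ r in s..T, curlForm (nseRhsDeriv ν (u (clampTime T r)) x) := by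
    have cx : Continuous fun r : ℝ => (r, x) := by fun_prop
    have c := cR'.comp cx
    simp only [Function.comp_def] at c
    exact (curlForm.intervalIntegral_comp_comm (c.intervalIntegrable _ _)).symm
  rw [hF', map_sub, map_sub, hint] at hcurl
  rw [planeCurl_eq_curlForm, planeCurl_eq_curlForm]
  linarith

/-- The time integral is itself the derivative of a periodic function, so it has zero mean; no
exchange of the two integrals is needed. -/
lemma setIntegral_intervalIntegral_fderiv (hT : 0 ≤ T) {f : ℝ → Plane → ℝ}
    {f' : ℝ → Plane → Plane →L[ℝ] ℝ} (hf : ∀ s ∈ Icc 0 T, TorusPeriodic (f s))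
    (hf' : ∀ s ∈ Icc 0 T, TorusPeriodic (f' s))
    (hc : Continuous fun q : ℝ × Plane => f (clampTime T q.1) q.2)
    (hc' : Continuous fun q : ℝ × Plane => f' (clampTime T q.1) q.2)
    (hd : ∀ s ∈ Icc 0 T, ∀ x, HasFDerivAt (f s) (f' s x) x) (s : ℝ) (v : Plane) :
    ∫ x in torusCell, (∫ r in s..T, f' (clampTime T r) x) v = 0 := by
  have hm := clampTime_mem hT
  obtain ⟨K, -, hK⟩ := exists_norm_le_of_continuous_periodic hT hf' hc'
  have hdi := hasFDerivAt_intervalIntegral (s := s) (T := T) (B := fun r => f (clampTime T r))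
    (B' := fun r => f' (clampTime T r)) hc hc' (fun r x => hd _ (hm r) x) hK
  have hper : TorusPeriodic fun x => ∫ r in s..T, f (clampTime T r) x := fun x m => by
    simp only [hf _ (hm _) x m]
  have hper' : TorusPeriodic fun x => ∫ r in s..T, f' (clampTime T r) x := fun x m => by
    simp only [hf' _ (hm _) x m]
  have hcont : Continuous fun x => ∫ r in s..T, f' (clampTime T r) x :=
    intervalIntegral.continuous_parametric_intervalIntegral_of_continuous'
      (f := fun x r => f' (clampTime T r) x)
      (hc'.comp (by fun_prop : Continuous fun q : Plane × ℝ => (q.2, q.1))) s T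
  have hcont0 : Continuous fun x => ∫ r in s..T, f (clampTime T r) x :=
    continuous_iff_continuousAt.2 fun x => (hdi x).continuousAt
  obtain ⟨M, -, hM⟩ := hper.exists_norm_le hcont0
  obtain ⟨M', -, hM'⟩ := hper'.exists_norm_le hcont
  exact setIntegral_torusCell_fderiv hper' hdi hcont hM hM' v

end NSE

/-! ### Zero mean and mild vorticity equation for a Navier–Stokes solution -/

section NSEMild

variable {ν T : ℝ} {φ : Plane → Plane} {u : ℝ → Plane → Plane}

lemma ContTimeCk.hasFDerivAt {F : Type*} [NormedAddCommGroup F] [NormedSpace ℝ F] {k : ℕ}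
    {f : ℝ → Plane → F} (hT : 0 ≤ T) (hf : ContTimeCk (k + 1) T f) (r : ℝ) (x : Plane) :
    HasFDerivAt (f (clampTime T r)) (_root_.fderiv ℝ (f (clampTime T r)) x) x :=
  ((hf.1 _ (clampTime_mem hT r)).2.differentiable (by simp) x).hasFDerivAt

/-- The flux of the `j`-th component of the momentum in the direction `i`, without pressure. -/
def momentumFlux (ν : ℝ) (v : Plane → Plane) (i j : Fin 2) (x : Plane) : ℝ :=
  ν * fderiv ℝ v x (planeBasis i) j + v x i * v x j

/-- The derivative of `momentumFlux`. -/
def momentumFluxDeriv (ν : ℝ) (v : Plane → Plane) (i j : Fin 2) (x : Plane) : Plane →L[ℝ] ℝ :=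
  ν • (coordForm j).comp (fderiv ℝ (fderiv ℝ v) x (planeBasis i))
    + (v x i • (coordForm j).comp (fderiv ℝ v x) + v x j • (coordForm i).comp (fderiv ℝ v x))

lemma hasFDerivAt_momentumFlux {v : Plane → Plane} (hv : ContDiff ℝ 2 v) (i j : Fin 2) (x : Plane) :
    HasFDerivAt (momentumFlux ν v i j) (momentumFluxDeriv ν v i j x) x := by
  have hd := (hv.differentiable two_ne_zero x).hasFDerivAt
  have hc : ∀ k, HasFDerivAt (fun x => v x k) ((coordForm k).comp (fderiv ℝ v x)) x := fun k =>
    (coordForm k).hasFDerivAt.comp x hd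
  have h2 : HasFDerivAt (fun x => fderiv ℝ v x (planeBasis i) j)
      ((coordForm j).comp (fderiv ℝ (fderiv ℝ v) x (planeBasis i))) x :=
    (coordForm j).hasFDerivAt.comp x (hasFDerivAt_fderiv_apply hv x (planeBasis i))
  exact (h2.const_mul ν).add ((hc i).mul (hc j))

/-- For zero divergence every term of the momentum equation is a space derivative of a periodic
function, so the mean is conserved. `biotSavart_planeCurl` needs this, since the curl does not see
constants. -/
lemma integral_torusCell_eq_zero (hT : 0 ≤ T) (hu : IsBackwardNSESolution ν T φ u)
    (hφ : ∫ x in torusCell, φ x = 0) {s : ℝ} (hs : s ∈ Icc 0 T) (j : Fin 2) :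
    ∫ x in torusCell, u s x j = 0 := by
  obtain ⟨hu5, ⟨p, hp, heq⟩, hdiv, huT⟩ := hu
  have hu1 := ContTimeCk.fderiv (k := 4) hu5
  have hu2 := ContTimeCk.fderiv (k := 3) hu1
  have hp1 := ContTimeCk.fderiv (k := 0) hp
  have c0 := hu5.continuous hT
  have c1 := hu1.continuous hT
  have c2 := hu2.continuous hT
  have hm := clampTime_mem hT
  have cF : ∀ i, Continuous fun q : ℝ × Plane => momentumFlux ν (u (clampTime T q.1)) i j q.2 := by
    intro i
    have c3 : Continuous fun q : ℝ × Plane =>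
        fderiv ℝ (u (clampTime T q.1)) q.2 (planeBasis i) := c1.clm_apply continuous_const
    simp only [momentumFlux]
    exact (((coordForm j).continuous.comp c3).const_mul ν).add
      (((coordForm i).continuous.comp c0).mul ((coordForm j).continuous.comp c0))
  have cD : ∀ i, Continuous fun q : ℝ × Plane =>
      momentumFluxDeriv ν (u (clampTime T q.1)) i j q.2 := by
    intro i
    have c3 : Continuous fun q : ℝ × Plane =>
        fderiv ℝ (fderiv ℝ (u (clampTime T q.1))) q.2 (planeBasis i) :=
      c2.clm_apply continuous_const
    simp only [momentumFluxDeriv]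
    exact ((continuous_const.clm_comp c3).const_smul ν).add
      ((((coordForm i).continuous.comp c0).smul (continuous_const.clm_comp c1)).add
      (((coordForm j).continuous.comp c0).smul (continuous_const.clm_comp c1)))
  have hfd : ∀ i, ∫ x in torusCell, (∫ r in s..T, momentumFluxDeriv ν (u (clampTime T r)) i j x)
      (planeBasis i) = 0 := by
    intro i
    refine setIntegral_intervalIntegral_fderiv (f := fun r => momentumFlux ν (u r) i j)
      (f' := fun r => momentumFluxDeriv ν (u r) i j) hT (fun s hs x m => ?_) (fun s hs x m => ?_)
      (cF i) (cD i)
      (fun s hs x => hasFDerivAt_momentumFlux ((hu5.1 s hs).2.of_le (by norm_num)) i j x) s _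
    · simp only [momentumFlux, (hu5.1 s hs).1 x m, (hu1.1 s hs).1 x m]
    · simp only [momentumFluxDeriv, (hu5.1 s hs).1 x m, (hu1.1 s hs).1 x m, (hu2.1 s hs).1 x m]
  have hfp : ∫ x in torusCell, (∫ r in s..T, fderiv ℝ (p (clampTime T r)) x) (planeBasis j) = 0 :=
    setIntegral_intervalIntegral_fderiv hT (fun s hs => (hp.1 s hs).1) (fun s hs => (hp1.1 s hs).1)
      (hp.continuous hT) (hp1.continuous hT)
      (fun s hs x => ((hp.1 s hs).2.differentiable (by norm_num) x).hasFDerivAt) s _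
  have hpar : ∀ {f' : ℝ → Plane → Plane →L[ℝ] ℝ} (v : Plane),
      (Continuous fun q : ℝ × Plane => f' (clampTime T q.1) q.2) →
      IntegrableOn (fun x => (∫ r in s..T, f' (clampTime T r) x) v) torusCell := by
    intro f' v hc'
    have : Continuous fun x => ∫ r in s..T, f' (clampTime T r) x :=
      intervalIntegral.continuous_parametric_intervalIntegral_of_continuous'
        (f := fun x r => f' (clampTime T r) x)
        (hc'.comp (by fun_prop : Continuous fun q : Plane × ℝ => (q.2, q.1))) s T
    exact (this.clm_apply continuous_const).continuousOn.integrableOn_compact isCompact_torusCell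
  have hpt : ∀ x, u s x j = φ x j
      + (∑ i, (∫ r in s..T, momentumFluxDeriv ν (u (clampTime T r)) i j x) (planeBasis i)
        + (∫ r in s..T, fderiv ℝ (p (clampTime T r)) x) (planeBasis j)) := by
    intro x
    have cx : Continuous fun r : ℝ => (r, x) := by fun_prop
    have cR : Continuous fun r : ℝ => nseRhs ν (u (clampTime T r)) x := by
      have := (continuous_nseRhs (ν := ν) hT hu5).comp cx
      simp only [Function.comp_def] at this
      exact this
    have cDx : ∀ i, Continuous fun r : ℝ => momentumFluxDeriv ν (u (clampTime T r)) i j x := by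
      intro i
      have := (cD i).comp cx
      simp only [Function.comp_def] at this
      exact this
    have h := nse_integral hT hu5 hp heq hs x j
    have e1 : (∫ r in s..T, nseRhs ν (u (clampTime T r)) x) j
        = ∫ r in s..T, nseRhs ν (u (clampTime T r)) x j :=
      ((coordForm j).intervalIntegral_comp_comm (cR.intervalIntegrable _ _)).symm
    have e2 : ∀ r, nseRhs ν (u (clampTime T r)) x j
        = ∑ i, momentumFluxDeriv ν (u (clampTime T r)) i j x (planeBasis i) := by
      intro r
      rw [nseRhs_apply ν (hdiv _ (hm r) x)]
      refine Finset.sum_congr rfl fun i _ => ?_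
      simp [momentumFluxDeriv]
      ring
    have e3 : ∀ i, (∫ r in s..T, momentumFluxDeriv ν (u (clampTime T r)) i j x) (planeBasis i)
        = ∫ r in s..T, momentumFluxDeriv ν (u (clampTime T r)) i j x (planeBasis i) := fun i =>
      ContinuousLinearMap.intervalIntegral_apply ((cDx i).intervalIntegrable _ _) _
    simp only [e3]
    rw [← intervalIntegral.integral_finsetSum fun i _ =>
      ((cDx i).clm_apply continuous_const).intervalIntegrable _ _]
    simp only [e1, e2, huT] at h
    linarith
  have hφc : Continuous φ := huT ▸ (hu5.1 T ⟨hT, le_rfl⟩).2.continuous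
  have hφi : IntegrableOn φ torusCell := hφc.continuousOn.integrableOn_compact isCompact_torusCell
  have hφj : ∫ x in torusCell, φ x j = 0 := by
    have := (coordForm j).integral_comp_comm hφi
    rw [hφ, map_zero] at this
    exact this
  have i1 : IntegrableOn (fun x => φ x j) torusCell := (coordForm j).integrable_comp hφi
  have i2 : IntegrableOn (fun x => ∑ i, (∫ r in s..T, momentumFluxDeriv ν (u (clampTime T r)) i j x)
      (planeBasis i)) torusCell :=
    integrable_finsetSum _ fun i _ =>
      hpar (f' := fun r => momentumFluxDeriv ν (u r) i j) (planeBasis i) (cD i)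
  have i3 : IntegrableOn (fun x => (∫ r in s..T, fderiv ℝ (p (clampTime T r)) x) (planeBasis j))
      torusCell := hpar (f' := fun r => fderiv ℝ (p r)) (planeBasis j) (hp1.continuous hT)
  have i23 : IntegrableOn (fun x =>
      ∑ i, (∫ r in s..T, momentumFluxDeriv ν (u (clampTime T r)) i j x) (planeBasis i)
      + (∫ r in s..T, fderiv ℝ (p (clampTime T r)) x) (planeBasis j)) torusCell := i2.add i3
  simp only [hpt]
  rw [integral_add i1 i23, integral_add i2 i3, integral_finsetSum _ fun i _ =>
    hpar (f' := fun r => momentumFluxDeriv ν (u r) i j) (planeBasis i) (cD i), hφj, hfp]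
  simp [hfd]

/-- The vorticity of a solution satisfies the mild form of the vorticity equation. -/
lemma planeCurl_eq_mild (hT : 0 ≤ T) (hu : IsBackwardNSESolution ν T φ u) (ε : ℝ) {s : ℝ}
    (hs : s ∈ Icc 0 T) (x : Plane) :
    planeCurl (u s) x = mild ε T (planeCurl φ x) (fun r => ε⁻¹ • planeCurl (u (clampTime T r)) x
      + (ν * ∑ i, fderiv ℝ (fderiv ℝ (planeCurl (u (clampTime T r)))) x (planeBasis i) (planeBasis i)
        + fderiv ℝ (planeCurl (u (clampTime T r))) x (u (clampTime T r) x))) s := by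
  obtain ⟨hu5, ⟨p, hp, heq⟩, hdiv, huT⟩ := hu
  have hm := clampTime_mem hT
  have e : ∀ r, curlForm (nseRhsDeriv ν (u (clampTime T r)) x) =
      ν * ∑ i, fderiv ℝ (fderiv ℝ (planeCurl (u (clampTime T r)))) x (planeBasis i) (planeBasis i)
        + fderiv ℝ (planeCurl (u (clampTime T r))) x (u (clampTime T r) x) := fun r =>
    curlForm_nseRhsDeriv ν ((hu5.1 _ (hm r)).2.of_le (by norm_num)) (hdiv _ (hm r) x)
  simp only [← e]
  have cx : Continuous fun r : ℝ => (r, x) := by fun_prop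
  have cz : Continuous fun r => curlForm (nseRhsDeriv ν (u (clampTime T r)) x) := by
    have := curlForm.continuous.comp ((continuous_nseRhsDeriv (ν := ν) hT hu5).comp cx)
    simp only [Function.comp_def] at this
    exact this
  have cy : Continuous fun r => planeCurl (u (clampTime T r)) x := by
    have := curlForm.continuous.comp
      (((ContTimeCk.fderiv (k := 4) hu5).continuous hT).comp cx)
    simp only [Function.comp_def] at this
    exact this
  -- The equation gives time derivatives of `u`, not of its space derivatives. The one of the curl
  -- comes from the integrated vorticity equation and the fundamental theorem of calculus.
  have hd : ∀ r ∈ Ioo s T, HasDerivAt (fun r => planeCurl (u (clampTime T r)) x)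
      (-(curlForm (nseRhsDeriv ν (u (clampTime T r)) x))) r := by
    intro r hr
    have h1 := ((cz.integral_hasStrictDerivAt T r).hasDerivAt.neg).const_add (planeCurl (u T) x)
    refine h1.congr_of_eventuallyEq ?_
    filter_upwards [Ioo_mem_nhds hr.1 hr.2] with q hq
    have hq' : q ∈ Icc 0 T := ⟨hs.1.trans hq.1.le, hq.2.le⟩
    rw [clampTime_of_mem hq', curl_nse_integral hT hu5 hp heq hq' x, Pi.neg_apply,
      intervalIntegral.integral_symm T q]
  have h := mild_of_hasDerivAt (ε := ε) hs.2 cy.continuousOn hd cz.continuousOn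
  rw [clampTime_of_mem hs, clampTime_of_mem ⟨hT, le_rfl⟩, huT] at h
  exact h.symm

end NSEMild

/-! ### The main theorem -/

section Convergence

variable {Ω : Type*} {mΩ : MeasurableSpace Ω} {P : Measure Ω} [IsProbabilityMeasure P]
  {τ : ℕ → Ω → ℝ} {ξ : ℕ → Ω → Plane} {ν T : ℝ} {φ : Plane → Plane} {u : ℝ → Plane → Plane}

lemma ContTimeCk.exists_lipschitz {F : Type*} [NormedAddCommGroup F] [NormedSpace ℝ F] {k : ℕ}
    {f : ℝ → Plane → F} (hT : 0 ≤ T) (hf : ContTimeCk (k + 1) T f) :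
    ∃ K, 0 ≤ K ∧ ∀ r x y, ‖f (clampTime T r) x - f (clampTime T r) y‖ ≤ K * ‖x - y‖ := by
  obtain ⟨K, hK0, hK⟩ := hf.fderiv.exists_norm_le hT
  exact ⟨K, hK0, fun r => norm_sub_le_of_hasFDerivAt (hf.hasFDerivAt hT r) (hK r)⟩

/-- Stability is applied to `V = curl u` with an error `O(ε)`. The bound uses Lipschitz third
derivatives of the curl, hence five space derivatives of `u`. -/
lemma exists_velocity_error_le (hd : IsPoissonDriver P τ ξ) (hν : 0 ≤ ν) (hT : 0 ≤ T)
    (hφ : ∫ x in torusCell, φ x = 0) (hu : IsBackwardNSESolution ν T φ u) :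
    ∃ C : ℝ, 0 < C ∧ ∀ ε ∈ Ioo (0 : ℝ) 1, ∀ X w,
      IsSchemeSolution P τ ξ ν T (planeCurl φ) ε X w →
      ∀ s ∈ Icc 0 T, ∀ x, ‖biotSavart (w s) x - u s x‖ ≤ C * ε := by
  have hm := clampTime_mem hT
  have hu5 := hu.1
  have huper : ∀ s ∈ Icc 0 T, TorusPeriodic (u s) := fun s hs => (hu5.1 s hs).1
  have hbs : ∀ s ∈ Icc 0 T, ∀ x, biotSavart (planeCurl (u s)) x = u s x := fun s hs x =>
    biotSavart_planeCurl (huper s hs) ((hu5.1 s hs).2.of_le (by norm_num)) (hu.2.2.1 s hs)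
      (integral_torusCell_eq_zero hT hu hφ hs) x
  have hV : ContTimeCk 4 T fun s => planeCurl (u s) :=
    (ContTimeCk.fderiv (k := 4) hu5).clm_comp curlForm
  have hV1 := ContTimeCk.fderiv (k := 3) hV
  have hV2 := ContTimeCk.fderiv (k := 2) hV1
  have hS : ∀ i, ContTimeCk 2 T fun s x =>
      fderiv ℝ (fderiv ℝ (planeCurl (u s))) x (planeBasis i) (planeBasis i) := fun i =>
    hV2.clm_comp ((ContinuousLinearMap.apply ℝ ℝ (planeBasis i)).comp
      (ContinuousLinearMap.apply ℝ (Plane →L[ℝ] ℝ) (planeBasis i)))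
  have hE := fun i => ContTimeCk.fderiv (k := 1) (hS i)
  obtain ⟨M, hM0, hM⟩ := hV.exists_norm_le hT
  obtain ⟨K₁, hK₁0, hK₁⟩ := hV1.exists_norm_le hT
  obtain ⟨K₂, hK₂0, hK₂⟩ := ContTimeCk.exists_lipschitz (k := 2) hT hV1
  choose K₃ hK₃0 hK₃ using fun i => ContTimeCk.exists_lipschitz (k := 1) hT (hS i)
  choose K₄ hK₄0 hK₄ using fun i => ContTimeCk.exists_lipschitz (k := 0) hT (hE i)
  set K := K₂ + (∑ i, K₃ i + ∑ i, K₄ i) with hK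
  have s3 : 0 ≤ ∑ i, K₃ i := Finset.sum_nonneg fun i _ => hK₃0 i
  have s4 : 0 ≤ ∑ i, K₄ i := Finset.sum_nonneg fun i _ => hK₄0 i
  have le3 : ∀ i, K₃ i ≤ K := fun i => by
    have := Finset.single_le_sum (fun i _ => hK₃0 i) (Finset.mem_univ i)
    linarith
  have le4 : ∀ i, K₄ i ≤ K := fun i => by
    have := Finset.single_le_sum (fun i _ => hK₄0 i) (Finset.mem_univ i)
    linarith
  have hK0 : 0 ≤ K := by positivity
  have hk := kernelMass_nonneg
  -- `N` bounds every velocity that can occur in the scheme, so the consistency constant `E` depends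
  -- neither on `ε` nor on the scheme solution.
  set N := kernelMass * M with hN
  have hN0 : 0 ≤ N := mul_nonneg hk hM0
  set E := K * (16 * ν ^ 2 + 2 * ν * N + N ^ 2) with hE'
  have hE0 : 0 ≤ E := by positivity
  set l := 2 * K₁ * kernelMass + 1 with hl
  have hl0 : 0 ≤ l := by positivity
  -- The summand `1` only makes the constant strictly positive.
  refine ⟨kernelMass * (2 * E * Real.exp (l * T)) + 1, by positivity, fun ε hε X w hX s hs x => ?_⟩
  have hε0 := hε.1
  have hVc := hV.continuous hT
  have huT : u T = φ := hu.2.2.2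
  have hcl : ∀ r ∈ Icc 0 T, clampTime T r = r := fun r hr => clampTime_of_mem hr
  have hTT : T ∈ Icc 0 T := ⟨hT, le_rfl⟩
  have hBc : Continuous (Function.uncurry fun (r : ℝ) (x : Plane) =>
      ε⁻¹ • planeCurl (u (clampTime T r)) x
      + (ν * ∑ i, fderiv ℝ (fderiv ℝ (planeCurl (u (clampTime T r)))) x (planeBasis i) (planeBasis i)
        + fderiv ℝ (planeCurl (u (clampTime T r))) x (u (clampTime T r) x))) := by
    have c1 := (hV1.continuous hT).clm_apply (hu5.continuous hT)
    exact (hVc.const_smul ε⁻¹).add (((continuous_finsetSum _ fun i _ =>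
      (hS i).continuous hT).const_mul ν).add c1)
  have herr : ∀ y, |planeCurl (u s) y - w s y| ≤ 2 * E * Real.exp (l * T) * ε := by
    intro y
    have h := hX.abs_vorticity_sub_le hd hε0 (V := fun r => planeCurl (u (clampTime T r)))
      hVc (fun r z => hM r z) (by simp only [hcl T hTT, huT]) hBc (fun r hr z => ?_)
      (E := ε * E) (K := K₁) (by positivity) hK₁0 (fun q hq z b hb => ?_) hs y
    · simp only [hcl s hs] at h
      refine h.trans ?_
      have : Real.exp (l * (T - s)) ≤ Real.exp (l * T) :=
        Real.exp_le_exp.2 (mul_le_mul_of_nonneg_left (by linarith [hs.1]) hl0)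
      calc 2 * (ε * E) * Real.exp (l * (T - s)) ≤ 2 * (ε * E) * Real.exp (l * T) := by gcongr
        _ = _ := by ring
    · simp only [hcl r hr, hcl T hTT, huT]
      exact planeCurl_eq_mild hT hu ε hr z
    · have hgen := abs_generator_sub_le (f := planeCurl (u (clampTime T q)))
        (hV.hasFDerivAt (k := 3) hT q) (hV1.hasFDerivAt (k := 2) hT q)
        (fun i => (hS i).hasFDerivAt (k := 1) hT q)
        (fun x y => (hK₂ q x y).trans (by gcongr; linarith))
        (fun i x y => (hK₃ i q x y).trans (by gcongr; exact le3 i))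
        (fun i x y => (hK₄ i q x y).trans (by gcongr; exact le4 i)) hK0 hε0 hν z b
      have hN2 : ε * (K * (16 * ν ^ 2 + 2 * ν * ‖b‖ + ‖b‖ ^ 2)) ≤ ε * E := by
        rw [hE']; gcongr
      -- The expansion is around the velocity `b` of the scheme. Replacing it by `u = K₂ * curl u`
      -- in the transport term costs `∇ curl u · (u - b)`, the Lipschitz term of the stability
      -- estimate.
      have h1 : |fderiv ℝ (planeCurl (u (clampTime T q))) z (u (clampTime T q) z - b)|
          ≤ K₁ * ‖b - u (clampTime T q) z‖ := by
        rw [← Real.norm_eq_abs, norm_sub_rev b]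
        exact (ContinuousLinearMap.le_opNorm _ _).trans
          (mul_le_mul_of_nonneg_right (hK₁ q z) (norm_nonneg _))
      rw [hbs _ (hm q)]
      rw [map_sub] at h1
      refine le_trans ?_ (add_le_add (hgen.trans hN2) h1)
      refine le_trans (le_of_eq ?_) (abs_add_le _ _)
      congr 1; ring
  have hsub := norm_biotSavart_sub_le (w := w s) (w' := planeCurl (u s))
    (hX.vorticity_regular.1 s hs).2.continuous (hV.1 s hs).2.continuous
    (M := M + 2 * E * Real.exp (l * T) * ε) (M' := M) (fun y => ?_)
    (fun y => by have := hM s y; rwa [hcl s hs] at this)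
    (fun y => by rw [abs_sub_comm]; exact herr y) x
  · rw [hbs s hs] at hsub
    refine hsub.trans ?_
    nlinarith
  · have h1 := hM s y
    rw [hcl s hs, Real.norm_eq_abs] at h1
    have h2 := herr y
    have h3 := abs_sub_abs_le_abs_sub (w s y) (planeCurl (u s) y)
    rw [abs_sub_comm] at h3
    linarith

end Convergence

theorem theorem4p5
    {Ω : Type*} [MeasurableSpace Ω] (P : Measure Ω) [IsProbabilityMeasure P]
    (τ : ℕ → Ω → ℝ) (ξ : ℕ → Ω → Plane) (hdriver : IsPoissonDriver P τ ξ)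
    (ν T : ℝ) (hν : 0 ≤ ν) (hT : 0 < T)
    (φ : Plane → Plane) (hφ_per : TorusPeriodic φ) (hφ_smooth : ContDiff ℝ 5 φ)
    (hφ_div : ∀ x, planeDiv φ x = 0) (hφ_mean : ∫ x in torusCell, φ x = 0) :
    (∀ ε ∈ Ioo (0 : ℝ) 1,
      (∃ X w, IsSchemeSolution P τ ξ ν T (planeCurl φ) ε X w) ∧
      (∀ X w X' w',
        IsSchemeSolution P τ ξ ν T (planeCurl φ) ε X w →
        IsSchemeSolution P τ ξ ν T (planeCurl φ) ε X' w' →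
        (∀ s ∈ Icc 0 T, w s = w' s) ∧
        ∀ s ∈ Icc 0 T, ∀ x, ∀ᵐ ω ∂P, ∀ t ∈ Icc s T, X s t x ω = X' s t x ω)) ∧
    ∀ u : ℝ → Plane → Plane, IsBackwardNSESolution ν T φ u →
      ∃ C : ℝ, 0 < C ∧ ∀ ε ∈ Ioo (0 : ℝ) 1, ∀ X w,
        IsSchemeSolution P τ ξ ν T (planeCurl φ) ε X w →
        ∀ s ∈ Icc 0 T, ∀ x, ‖biotSavart (w s) x - u s x‖ ≤ C * ε := by
  refine ⟨fun ε hε => ?_, fun u hu => exists_velocity_error_le hdriver hν hT.le hφ_mean hu⟩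
  obtain ⟨V, ⟨X₀, hX₀⟩, hV⟩ := exists_scheme_vorticity (ν := ν) hε.1 hε.2.le hT.le
    (contDiff_curl (n := 2) (hφ_smooth.of_le (by norm_num))) hφ_per.planeCurl hdriver
  refine ⟨⟨X₀, V, hX₀⟩, fun X w X' w' hX hX' => ?_⟩
  have hw : ∀ s ∈ Icc 0 T, w s = w' s := fun s hs => (hV X w hX s hs).trans (hV X' w' hX' s hs).symm
  refine ⟨hw, fun s hs x => ?_⟩
  -- Equal vorticities drive the same chain, so uniqueness of the paths follows from that of `w`.
  have hv : clampVelocity T w = clampVelocity T w' := by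
    funext r
    simp only [clampVelocity, hw _ (clampTime_mem hT.le r)]
  filter_upwards [hX.ae_eq_chainFlow hdriver hε.1 hs x, hX'.ae_eq_chainFlow hdriver hε.1 hs x]
    with ω h1 h2 t ht
  rw [h1 t ht, h2 t ht, hv]

end
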